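/- **Conventions.** Pauli operators are taken modulo phase; $|P|$ is the number of qubits on which $P$ is not the identity. A stabilizer code is given by finitely many pairwise commuting Pauli operators (checks). Its logical operators are the Pauli operators commuting with all checks, and the nontrivial ones are those that are not products of checks. Its distance is the least weight of a nontrivial logical operator, and it encodes $n-\operatorname{rank}$ qubits. It is $(\alpha,\beta)$-LDPC if each check acts on at most $\alpha$ qubits and each qubit is acted on by at most $\beta$ checks. Two operators are non-overlapping if their supports are disjoint. **Auxiliary graphs.** Let $P$ be a logical operator of a code consisting of two separate blocks, left and right. An auxiliary graph for $P$ is a finite connected graph $\mathcal G=(\mathcal V,\mathcal E)$ with - a port function from $\operatorname{supp}P$ to $\mathcal V$ that is injective on the qubits of each block; - for each check $s$, an edge set $\mu(s)$ whose $\mathbb F_2$-boundary is the sum of the port vertices of the qubits at which $s$ and $P$ anticommute locally ($\mu(s)=\emptyset$ if there are none); - a generating family ("cycle basis") of its cycle space over $\mathbb F_2$. Its size is $|\mathcal V|+|\mathcal E|$. Given an auxiliary graph $\mathcal G_Z$ for $P$ and an auxiliary graph $\mathcal G_X$ for $R$, where $P$ and $R$ are non-overlapping, the deformed code has the original qubits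 and one qubit per edge of each graph. Its checks are - for each original check $s$: $s\prod_{e\in\mu_Z(s)}X(e)\prod_{e\in\mu_X(s)}Z(e)$; - for each vertex $v$ of $\mathcal G_Z$: the part of $P$ on the qubits attached to $v$, times $\prod_{e\ni v}Z(e)$; - for each vertex $v$ of $\mathcal G_X$: the part of $R$ on the qubits attached to $v$, times $\prod_{e\ni v}X(e)$; - for each basis cycle $c$: $\prod_{e\in c}X(e)$ for $\mathcal G_Z$, and $\prod_{e\in c}Z(e)$ for $\mathcal G_X$. **Theorem.** For all $\alpha,\beta$ there are constants $\alpha',\beta',c$, depending only on $\alpha,\beta$, such that the following holds. Let the right code be an $(\alpha,\beta)$-LDPC stabilizer code of distance $d_r$ and let $\overline Z_r,\overline X_r$ be arbitrary non-overlapping logical operators of it. Let the left code be an $(\alpha,\beta)$-LDPC stabilizer code of distance $d_l\ge\max(|\overline Z_r|,|\overline X_r|)$ that encodes exactly two qubits and has two non-overlapping logical operators $\overline Z_l=\overline Z_l^{(1)}$ and $\overline X_l=\overline X_l^{(2)}$ of weight $d_l$, being the Pauli $Z$ of its first and the Pauli $X$ of its second logical qubit. Suppose that the weight of $\overline Z_l\overline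 X_l$ cannot be reduced below $2d_l$ by stabilizers and the remaining logical operators: for some logical operators $\overline X_l^{(1)},\overline Z_l^{(2)}$ completing $\overline Z_l,\overline X_l$ to logical Pauli operators of the two qubits (that is, $\overline X_l^{(1)}$ anticommutes with $\overline Z_l$, $\overline Z_l^{(2)}$ anticommutes with $\overline X_l$, and all other pairs commute), one has $|\Lambda\,\overline Z_l\overline X_l|\ge 2d_l$ for all $\Lambda$ in the group generated by the stabilizers, $\overline X_l^{(1)}$ and $\overline Z_l^{(2)}$. Then there are auxiliary graphs $\mathcal G_Z$ for $\overline Z_l\overline Z_r$ and $\mathcal G_X$ for $\overline X_l\overline X_r$ on the joint original code, each of size at most $c\,(d_l\log^3 d_l+1)$, such that 1. the deformed code is a stabilizer code that measures exactly $\overline Z_l\overline Z_r$ and $\overline X_l\overline X_r$: both are stabilizers of the deformed code; the operators on the original qubits that are, up to factors $X(e)$ for edges $e$ of $\mathcal G_Z$ and $Z(e)$ for edges $e$ of $\mathcal G_X$, products of checks of the deformed code are exactly those in the group generated by the original checks, $\overline Z_l\overline Z_r$ and $\overline X_l\overline X_r$; and the deformed code encodes exactly two qubits less than the two original codes together; 2.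 the deformed code is $(\alpha',\beta')$-LDPC; 3. the deformed code has distance at least $d_r$. Moreover, the toric code is an example of such a left code: for every $d\ge1$ the toric code on the $d\times d$ periodic square lattice is $(4,4)$-LDPC and, for suitable $\overline Z_l,\overline X_l$, satisfies all assumptions on the left code with $d_l=d$. -/

import Mathlib

namespace Surgery

/-! ### Pauli operators and stabilizer codes -/

/-- Pauli operators, modulo phase, on a set `Q` of qubits in symplectic notation: `P q = (x, z)` says
that `P` acts on the qubit `q` as `X ^ x * Z ^ z`. The product of Pauli operators is the sum, `0` is
the identity. -/
abbrev Pauli (Q : Type*) := Q → ZMod 2 × ZMod 2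

/-- The symplectic form of two one-qubit Pauli operators: `0` if they commute, `1` if they do not. -/
def localSymp (a b : ZMod 2 × ZMod 2) : ZMod 2 := a.1 * b.2 + a.2 * b.1

/-- Two Pauli operators commute: they anticommute on an even number of qubits. -/
def PauliCommute {Q : Type*} [Fintype Q] (P R : Pauli Q) : Prop :=
  ∑ q, localSymp (P q) (R q) = 0

/-- The weight of a Pauli operator: the number of qubits on which it is not the identity. -/
def wt {Q : Type*} [Fintype Q] (P : Pauli Q) : ℕ :=
  (Finset.univ.filter fun q => P q ≠ 0).card

/-- Two Pauli operators have disjoint supports. -/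
def NonOverlapping {Q : Type*} (P R : Pauli Q) : Prop :=
  ∀ q, P q = 0 ∨ R q = 0

/-- A family `H` of Pauli operators (the checks, the rows of a symplectic check matrix) defines a
stabilizer code if any two of them commute. -/
def IsStabilizerCode {Q S : Type*} [Fintype Q] (H : S → Pauli Q) : Prop :=
  ∀ s t, PauliCommute (H s) (H t)

/-- The stabilizer group (modulo phase): all products of checks. -/
def stab {Q S : Type*} (H : S → Pauli Q) : Submodule (ZMod 2) (Pauli Q) :=
  Submodule.span (ZMod 2) (Set.range H)

/-- Logical operators: the Pauli operators that commute with all checks. -/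
def IsLogical {Q S : Type*} [Fintype Q] (H : S → Pauli Q) (P : Pauli Q) : Prop :=
  ∀ s, PauliCommute (H s) P

/-- Nontrivial logical operators: those that are not a product of checks. -/
def IsNontrivialLogical {Q S : Type*} [Fintype Q] (H : S → Pauli Q) (P : Pauli Q) : Prop :=
  IsLogical H P ∧ P ∉ stab H

/-- The code has distance `d`: this is the least weight of a nontrivial logical operator. -/
def IsDistance {Q S : Type*} [Fintype Q] (H : S → Pauli Q) (d : ℕ) : Prop :=
  IsLeast {w | ∃ P, IsNontrivialLogical H P ∧ wt P = w} d

/-- The number of encoded qubits: the number of qubits minus the rank of the check matrix. -/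
noncomputable def numLogical {Q S : Type*} [Fintype Q] (H : S → Pauli Q) : ℤ :=
  (Fintype.card Q : ℤ) - (Module.finrank (ZMod 2) (stab H) : ℤ)

/-- `(α, β)` low-density parity-check: each check acts on at most `α` qubits and each qubit is acted
upon by at most `β` checks. -/
def IsLDPC {Q S : Type*} [Fintype Q] [Fintype S] (H : S → Pauli Q) (α β : ℕ) : Prop :=
  (∀ s, wt (H s) ≤ α) ∧ ∀ q, (Finset.univ.filter fun s => H s q ≠ 0).card ≤ β

/-- Two separate codeblocks, seen as one code. -/
def joinCode {Ql Sl Qr Sr : Type*} (Hl : Sl → Pauli Ql) (Hr : Sr → Pauli Qr) :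
    Sl ⊕ Sr → Pauli (Ql ⊕ Qr) :=
  Sum.elim (fun s => Sum.elim (Hl s) 0) (fun s => Sum.elim 0 (Hr s))

/-- The product of an operator on the left codeblock and an operator on the right codeblock. -/
def joinOp {Ql Qr : Type*} (P : Pauli Ql) (R : Pauli Qr) : Pauli (Ql ⊕ Qr) := Sum.elim P R

/-! ### The left code -/

/-- The weight of the product of the logical operators `Zl`, `Xl` of a code with two logical qubits
cannot be reduced below `w` by stabilizers and the other logical operators: if `Zl` and `Xl` are the
Pauli `Z` of the first and the Pauli `X` of the second logical qubit, the others are those generated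
modulo stabilizers by the Pauli `X` of the first logical qubit, `X₁`, and the Pauli `Z` of the
second, `Z₂`. -/
def ProductIrreducible {Q S : Type*} [Fintype Q] (H : S → Pauli Q) (Zl Xl : Pauli Q) (w : ℕ) :
    Prop :=
  ∃ X₁ Z₂ : Pauli Q, IsLogical H X₁ ∧ IsLogical H Z₂ ∧
    ¬ PauliCommute X₁ Zl ∧ PauliCommute X₁ Xl ∧
    ¬ PauliCommute Z₂ Xl ∧ PauliCommute Z₂ Zl ∧
    PauliCommute X₁ Z₂ ∧
    ∀ L ∈ stab H ⊔ Submodule.span (ZMod 2) {X₁, Z₂}, w ≤ wt (L + (Zl + Xl))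

/-- A stabilizer code of distance `d` that encodes two qubits, with two non-overlapping logical
operators `Zl`, `Xl` of weight `d` whose product cannot be reduced to weight less than `2 d`. -/
structure IsLeftCode {Q S : Type*} [Fintype Q] (H : S → Pauli Q) (d : ℕ) (Zl Xl : Pauli Q) :
    Prop where
  stabilizer : IsStabilizerCode H
  distance : IsDistance H d
  two_qubits : numLogical H = 2
  logical_Z : IsLogical H Zl
  logical_X : IsLogical H Xl
  weight_Z : wt Zl = d
  weight_X : wt Xl = d
  nonOverlapping : NonOverlapping Zl Xl
  irreducible : ProductIrreducible H Zl Xl (2 * d)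

/-- The toric code on the `d × d` periodic square lattice. There is a qubit on the horizontal edge
`Sum.inl (i, j)` from the vertex `(i, j)` to `(i + 1, j)` and on the vertical edge `Sum.inr (i, j)`
from `(i, j)` to `(i, j + 1)`. Each vertex (`Sum.inl`) carries an `X`-check on its four edges, each
face (`Sum.inr`) a `Z`-check on its four edges. -/
def toricCode (d : ℕ) : (ZMod d × ZMod d) ⊕ (ZMod d × ZMod d) →
    Pauli ((ZMod d × ZMod d) ⊕ (ZMod d × ZMod d))
  | Sum.inl (i, j) =>
      Pi.single (Sum.inl (i, j)) (1, 0) + Pi.single (Sum.inl (i - 1, j)) (1, 0) +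
      Pi.single (Sum.inr (i, j)) (1, 0) + Pi.single (Sum.inr (i, j - 1)) (1, 0)
  | Sum.inr (i, j) =>
      Pi.single (Sum.inl (i, j)) (0, 1) + Pi.single (Sum.inl (i, j + 1)) (0, 1) +
      Pi.single (Sum.inr (i, j)) (0, 1) + Pi.single (Sum.inr (i + 1, j)) (0, 1)

/-! ### Auxiliary graph surgery -/

/-- The incidence matrix of a graph over `𝔽₂`: rows are edges, columns are vertices. -/
def incidence {V : Type*} [DecidableEq V] (G : SimpleGraph V) : Matrix G.edgeSet V (ZMod 2) :=
  Matrix.of fun e v => if v ∈ (e : Sym2 V) then 1 else 0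

/-- An auxiliary graph for measuring the logical operator `P` of the code with checks `H`:
a connected graph with a port function (only its values on the support of `P` matter), a matching
for every check, and a cycle basis. -/
structure AuxGraph {Q S : Type*} [Fintype Q] (H : S → Pauli Q) (P : Pauli Q) where
  /-- The number of vertices. -/
  n : ℕ
  /-- The graph. -/
  graph : SimpleGraph (Fin n)
  connected : graph.Connected
  /-- The vertex to which a qubit of the support of `P` is attached. -/
  port : Q → Fin n
  /-- For every check `s` an edge set, which matches the vertices to which the qubits are attached
  where `s` anticommutes locally with `P`. -/
  matching : S → graph.edgeSet → ZMod 2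
  matching_boundary : ∀ s v, ∑ᶠ e, matching s e * incidence graph e v =
    ∑ q, if port q = v then localSymp (H s q) (P q) else 0
  /-- A check that commutes locally with `P` everywhere is not deformed. -/
  matching_trivial : ∀ s, (∀ q, localSymp (H s q) (P q) = 0) → matching s = 0
  /-- The number of cycles in the cycle basis. -/
  numCycles : ℕ
  /-- The cycle basis. -/
  cycle : Fin numCycles → graph.edgeSet → ZMod 2
  /-- The basis cycles generate exactly the cycle space of the graph. -/
  span_cycle : ∀ c : graph.edgeSet → ZMod 2,
    c ∈ Submodule.span (ZMod 2) (Set.range cycle) ↔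
      ∀ v, ∑ᶠ e, c e * incidence graph e v = 0

namespace AuxGraph

variable {Q S : Type*} [Fintype Q] {H : S → Pauli Q} {P R : Pauli Q}

/-- The edges of the auxiliary graph; each of them hosts an additional qubit. -/
def Edge (A : AuxGraph H P) : Type := A.graph.edgeSet

noncomputable instance (A : AuxGraph H P) : Fintype A.Edge :=
  Fintype.ofFinite A.graph.edgeSet

/-- The size of the auxiliary graph: the number of vertices plus the number of edges. -/
noncomputable def size (A : AuxGraph H P) : ℕ := A.n + Fintype.card A.Edge

/-- The edge qubits that are incident to the vertex `v`. -/
def star (A : AuxGraph H P) (v : Fin A.n) : A.Edge → ZMod 2 :=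
  fun e => incidence A.graph e v

/-- The part of `P` that is attached to the vertex `v`. -/
def attached (A : AuxGraph H P) (v : Fin A.n) : Pauli Q :=
  fun q => if A.port q = v then P q else 0

end AuxGraph

/-- On each of the two codeblocks the port function is injective, i.e. a vertex is attached to at most
one qubit from the left and at most one from the right code. -/
def AuxGraph.PortInjective {Ql Qr S : Type*} [Fintype Ql] [Fintype Qr] {H : S → Pauli (Ql ⊕ Qr)}
    {P : Pauli (Ql ⊕ Qr)} (A : AuxGraph H P) : Prop :=
  Set.InjOn (fun q => A.port (Sum.inl q)) {q | P (Sum.inl q) ≠ 0} ∧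
  Set.InjOn (fun q => A.port (Sum.inr q)) {q | P (Sum.inr q) ≠ 0}

section Deformed

variable {Q S : Type*} [Fintype Q] {H : S → Pauli Q} {P R : Pauli Q}

/-- The qubits of the deformed code. -/
abbrev DeformedQubit (A : AuxGraph H P) (B : AuxGraph H R) := Q ⊕ (A.Edge ⊕ B.Edge)

/-- The checks of the deformed code: the checks of the original code, a check for each vertex and a
check for each basis cycle of the two graphs. -/
abbrev DeformedCheck (A : AuxGraph H P) (B : AuxGraph H R) :=
  S ⊕ ((Fin A.n ⊕ Fin B.n) ⊕ (Fin A.numCycles ⊕ Fin B.numCycles))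

/-- The operator that acts as `L` on the original qubits, as `X ^ a₁ * Z ^ a₂` on the edge qubits of
the first and as `X ^ b₁ * Z ^ b₂` on those of the second graph. -/
def withEdges (A : AuxGraph H P) (B : AuxGraph H R) (L : Pauli Q) (a₁ a₂ : A.Edge → ZMod 2)
    (b₁ b₂ : B.Edge → ZMod 2) : Pauli (DeformedQubit A B) :=
  Sum.elim L (Sum.elim (fun e => (a₁ e, a₂ e)) (fun e => (b₁ e, b₂ e)))

/-- The deformed code, for measuring `P` with the graph `A` and `R` with the graph `B` simultaneously.
The vertex checks of `A` act as `Z` and its cycle checks as `X` on its edge qubits; for `B` the roles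
of `X` and `Z` are exchanged. The original checks are deformed along their matchings. -/
def deformedCode (A : AuxGraph H P) (B : AuxGraph H R) :
    DeformedCheck A B → Pauli (DeformedQubit A B)
  | Sum.inl s => withEdges A B (H s) (A.matching s) 0 0 (B.matching s)
  | Sum.inr (Sum.inl (Sum.inl v)) => withEdges A B (A.attached v) 0 (A.star v) 0 0
  | Sum.inr (Sum.inl (Sum.inr v)) => withEdges A B (B.attached v) 0 0 (B.star v) 0
  | Sum.inr (Sum.inr (Sum.inl u)) => withEdges A B 0 (A.cycle u) 0 0 0
  | Sum.inr (Sum.inr (Sum.inr u)) => withEdges A B 0 0 0 0 (B.cycle u)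

/-- The operators on the original qubits that are measured when the edge qubits of `A` are initialized
as `+1` eigenstates of `X` and those of `B` as `+1` eigenstates of `Z`, and then the checks of the
deformed code are measured: the operators that are equal to a product of checks of the deformed code
up to initial stabilizers of edge qubits. -/
def measured (A : AuxGraph H P) (B : AuxGraph H R) : Set (Pauli Q) :=
  {L | ∃ (a : A.Edge → ZMod 2) (b : B.Edge → ZMod 2), withEdges A B L a 0 0 b ∈
    stab (deformedCode A B)}

end Deformed

/-- With these auxiliary graphs exactly the two operators `P` and `R`, and their products with each
other and with stabilizers of the original code, are measured: `P` and `R` become stabilizers of the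
deformed code, no other logical operator is measured, and the deformed code has two logical qubits
less than the original code. -/
structure MeasuresExactly {Q S : Type*} [Fintype Q] {H : S → Pauli Q} {P R : Pauli Q}
    (A : AuxGraph H P) (B : AuxGraph H R) : Prop where
  mem_left : withEdges A B P 0 0 0 0 ∈ stab (deformedCode A B)
  mem_right : withEdges A B R 0 0 0 0 ∈ stab (deformedCode A B)
  measured_eq : measured A B = (stab H ⊔ Submodule.span (ZMod 2) {P, R} : Submodule _ _)
  numLogical_eq : numLogical (deformedCode A B) = numLogical H - 2

end Surgery

namespace Surgery

/-! ### Switching networks -/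

/-! Both blocks are attached to a common set `X` of 2^k ≥ d_l ports. Four properties of the
auxiliary graph suffice: bounded degree; a cycle space generated by closed walks of length four, so
that cycle checks are short and, being local, sparse; an edge between any two ports touched by a
common check, so that matchings are short; and expansion relative to the ports, meaning that every
vertex set or its complement contains at most as many ports as the set has boundary edges.

Distance (`exists_cleaned`, `le_wt_of_isNontrivialLogical`). A nontrivial logical operator T of the
deformed code commutes with the cycle checks, so its Z-part on the first graph and its X-part on the
second are coboundaries of vertex sets u and w. Multiplying by the vertex checks of u and w leaves,
on the original qubits, a logical operator M that commutes with both measured operators P, R and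
lies outside the group generated by the stabilizers, P and R. Complementing u or w only changes M by
P or R, so relative expansion applies: on each block separately, the cleaning has changed the weight
by at most the number of boundary edges already contained in T. Hence T weighs at least as much as
either block of M. If the right block of M is not a stabilizer, this gives d_r. Otherwise the left
block is a nontrivial logical operator, of weight at least d_l. If d_l < d_r, then Z_r and X_r are
too light to be nontrivial and are stabilizers; the left block commutes with Z_l and X_l, hence is
generated by these and stabilizers because the left code has only two qubits, and M would lie in the
excluded group.

Graph (`exists_gadget`). The source is a Beneš switching network on `X`: 2k layers of commuting
involutions. Averaging along all layers gives constants, which yields expansion; commutation squares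
kill all cohomology; and every permutation of `X` can be routed. A bounded degree graph on the ports
is covered by boundedly many permutations, and each of them is routed: consecutive partial routings
differ by triangles through one involution, so the added edges create no long independent cycles. To
keep the degree bounded, the layers are spread over a crossbar with one copy of `X` for each pair of
layers, where exactly these two layers are active (`filled_crossbar`); every square or triangle that
is needed lies in one copy. This costs 2^k (2k+1)^2 vertices, well within the claimed size.

Measurement. Connectedness makes P the only product of vertex checks of its graph without edge
factors, and likewise for R; a rank count gives the number of encoded qubits. For the toric code, d
disjoint translates of a string operator bound the weight of whatever anticommutes with it. -/

/-- Two fixed-point-free involutions have a common proper two-colouring. -/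
theorem exists_common_coloring {Z : Type*} (a b : Equiv.Perm Z)
    (ha : ∀ z, a (a z) = z) (hb : ∀ z, b (b z) = z) (ha' : ∀ z, a z ≠ z) (hb' : ∀ z, b z ≠ z) :
    ∃ χ : Z → Bool, (∀ z, χ (a z) = !χ z) ∧ ∀ z, χ (b z) = !χ z := by
  classical
  have ha2 : a * a = 1 := Equiv.ext ha
  have hb2 : b * b = 1 := Equiv.ext hb
  have hai : a⁻¹ = a := inv_eq_of_mul_eq_one_left ha2
  have hbi : b⁻¹ = b := inv_eq_of_mul_eq_one_left hb2
  set c : Equiv.Perm Z := b * a with hc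
  -- The two involutions generate a dihedral group: conjugation by `a` inverts the rotation `c`.
  have hconj : ∀ n : ℤ, a * c ^ n = c ^ (-n) * a := by
    intro n
    have h1 : a * c * a⁻¹ = c⁻¹ := by
      rw [hc, mul_inv_rev, hai, hbi, mul_assoc, mul_assoc, ha2, mul_one]
    have h2 : a * c ^ n * a⁻¹ = c ^ (-n) := by
      rw [← conj_zpow, h1, inv_zpow, zpow_neg]
    rw [← h2, inv_mul_cancel_right]
  have hba : b = c * a := by rw [hc, mul_assoc, ha2, mul_one]
  -- If `a` preserved an orbit of `c`, the midpoint of the way from `z` to `a z` would be fixed by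
  -- `a` (even exponent) or by `b` (odd exponent). So `a`, and with it `b = c * a`, induces one
  -- fixed-point-free involution on the orbits, and colouring the orbits is enough.
  have hcyc : ∀ z, ¬ c.SameCycle z (a z) := by
    rintro z ⟨n, hn⟩
    rcases Int.even_or_odd' n with ⟨m, rfl | rfl⟩
    · apply ha' ((c ^ m) z)
      have : (a * c ^ m) z = (c ^ (-m) * c ^ (2 * m)) z := by
        rw [hconj]; simp only [Equiv.Perm.mul_apply, hn]
      rw [← zpow_add, show -m + 2 * m = m by ring] at this
      exact this
    · apply hb' ((c ^ (m + 1)) z)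
      have : (b * c ^ (m + 1)) z = (c * c ^ (-(m + 1)) * c ^ (2 * m + 1)) z := by
        rw [hba, mul_assoc, hconj]; simp only [Equiv.Perm.mul_apply, hn]
      rw [← zpow_one_add, ← zpow_add, show 1 + -(m + 1) + (2 * m + 1) = m + 1 by ring] at this
      exact this
  have hcompat : ∀ z w, c.SameCycle z w → c.SameCycle (a z) (a w) := by
    rintro z w ⟨n, rfl⟩
    refine ⟨-n, ?_⟩
    have := congrArg (fun p : Equiv.Perm Z => p z) (hconj n)
    simpa using this.symm
  let S : Setoid Z := Equiv.Perm.SameCycle.setoid c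
  let Y := Quotient S
  let abar : Y → Y := Quotient.map a hcompat
  have habar : ∀ y, abar (abar y) = y := by
    intro y
    induction y using Quotient.inductionOn with
    | h z => change (Quotient.mk S (a (a z))) = _; rw [ha]
  have hne : ∀ y, abar y ≠ y := by
    intro y
    induction y using Quotient.inductionOn with
    | h z => intro h; exact hcyc z (Quotient.exact h).symm
  have hbb : ∀ z, Quotient.mk S (b z) = abar (Quotient.mk S z) := by
    intro z
    apply Quotient.sound
    exact ⟨-1, by rw [hba]; simp⟩
  -- An arbitrary order, used only to choose one orbit out of each pair `{y, abar y}`.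
  let _ : LinearOrder Y := IsWellOrder.linearOrder WellOrderingRel
  have key : ∀ y, decide (abar y < abar (abar y)) = !decide (y < abar y) := by
    intro y
    rw [habar]
    rcases lt_or_gt_of_ne (hne y) with h | h
    · simp [h, h.le]
    · simp [h, h.le]
  refine ⟨fun z => decide (Quotient.mk S z < abar (Quotient.mk S z)),
    fun z => key (Quotient.mk S z), fun z => ?_⟩
  simp only [hbb]
  exact key _

/-- Iterated averages of a function along a sequence of permutations. -/
noncomputable def iterAvg {X : Type*} (swap : ℕ → Equiv.Perm X) (h : X → ℝ) : ℕ → X → ℝ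
  | 0 => h
  | t + 1 => fun x => (iterAvg swap h t x + iterAvg swap h t (swap t x)) / 2

theorem iterAvg_succ {X : Type*} (swap : ℕ → Equiv.Perm X) (h : X → ℝ) (t : ℕ) (x : X) :
    iterAvg swap h (t + 1) x = (iterAvg swap h t x + iterAvg swap h t (swap t x)) / 2 := rfl

/-- A sequence of commuting involutions of `X` such that averaging along all of them gives constants,
every permutation of `X` is a product of permutations that at each step only exchange points matched
by the involution of that step, and every `𝔽₂`-cochain on the graph of the involutions that vanishes
on the commutation squares is a coboundary. -/
structure SwitchingNetwork (X : Type*) where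
  depth : ℕ
  swap : ℕ → Equiv.Perm X
  swap_swap : ∀ t x, swap t (swap t x) = x
  swap_comm : ∀ s t x, swap s (swap t x) = swap t (swap s x)
  mixing : ∀ h : X → ℝ, ∃ c, ∀ x, iterAvg swap h depth x = c
  routing : ∀ σ : Equiv.Perm X, ∃ p : ℕ → Equiv.Perm X, p 0 = 1 ∧ p depth = σ ∧
    ∀ t < depth, ∀ x, p (t + 1) x = p t x ∨ p (t + 1) x = p t (swap t x)
  filled : ∀ a : X → X → ZMod 2, (∀ x y, a x y = a y x) →
    (∀ s < depth, ∀ t < depth, ∀ x, a x (swap s x) + a (swap s x) (swap t (swap s x)) +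
      a (swap t (swap s x)) (swap t x) + a (swap t x) x = 0) →
    ∃ f : X → ZMod 2, ∀ t < depth, ∀ x, a x (swap t x) = f x + f (swap t x)

namespace SwitchingNetwork

/-- A function invariant under all involutions is constant. -/
theorem const_of_invariant {X Y : Type*} (N : SwitchingNetwork X) (D : X → Y)
    (hD : ∀ t < N.depth, ∀ x, D (N.swap t x) = D x) (x y : X) : D x = D y := by
  classical
  -- Routing the transposition moves the preimage of `y` from `y` to `x`, at each time staying put
  -- or following an involution.
  obtain ⟨p, h0, h1, hp⟩ := N.routing (Equiv.swap x y)
  have key : ∀ t ≤ N.depth, D ((p t).symm y) = D y := by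
    intro t
    induction t with
    | zero => intro _; rw [h0]; rfl
    | succ t ih =>
      intro ht
      rw [← ih (by omega)]
      rcases hp t (by omega) ((p (t + 1)).symm y) with h | h
      · rw [Equiv.apply_symm_apply] at h
        conv_rhs => rw [h]
        rw [Equiv.symm_apply_apply]
      · rw [Equiv.apply_symm_apply] at h
        conv_rhs => rw [h]
        rw [Equiv.symm_apply_apply, hD _ (by omega)]
  have := key _ le_rfl
  rw [h1] at this
  simpa using this

/-! ### The recursive construction of the Beneš network -/

/-- The network on a single point. -/
def point : SwitchingNetwork Unit where
  depth := 0
  swap _ := 1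
  swap_swap _ _ := rfl
  swap_comm _ _ _ := rfl
  mixing h := ⟨h (), fun _ => rfl⟩
  routing σ := ⟨fun _ => 1, rfl, Subsingleton.elim _ _, fun t ht => absurd ht (by omega)⟩
  filled _ _ _ := ⟨0, fun t ht => absurd ht (by omega)⟩

/-- The exchange of two copies of `X`. -/
def flip (X : Type*) : Equiv.Perm (Bool × X) where
  toFun z := (!z.1, z.2)
  invFun z := (!z.1, z.2)
  left_inv z := by simp
  right_inv z := by simp

/-- A pair of permutations acting on two copies of `X`. -/
def fiberwise {X : Type*} (ρ : Bool → Equiv.Perm X) : Equiv.Perm (Bool × X) where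
  toFun z := (z.1, ρ z.1 z.2)
  invFun z := (z.1, (ρ z.1).symm z.2)
  left_inv z := by simp
  right_inv z := by simp

@[simp] theorem flip_apply {X : Type*} (b : Bool) (x : X) : flip X (b, x) = (!b, x) := rfl

@[simp] theorem fiberwise_apply {X : Type*} (ρ : Bool → Equiv.Perm X) (b : Bool) (x : X) :
    fiberwise ρ (b, x) = (b, ρ b x) := rfl

/-- The sequence of involutions on two copies of `X`. -/
def doubleSwap {X : Type*} (N : SwitchingNetwork X) : ℕ → Equiv.Perm (Bool × X)
  | 0 => flip X
  | t + 1 => if t < N.depth then fiberwise fun _ => N.swap t else flip X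

theorem doubleSwap_mid {X : Type*} (N : SwitchingNetwork X) {t : ℕ} (ht : t < N.depth) :
    N.doubleSwap (t + 1) = fiberwise fun _ => N.swap t := by
  simp [doubleSwap, ht]

theorem doubleSwap_cases {X : Type*} (N : SwitchingNetwork X) (t : ℕ) :
    N.doubleSwap t = flip X ∨ ∃ s < N.depth, N.doubleSwap t = fiberwise fun _ => N.swap s := by
  cases t with
  | zero => exact Or.inl rfl
  | succ t =>
    by_cases h : t < N.depth
    · exact Or.inr ⟨t, h, N.doubleSwap_mid h⟩
    · left; simp [doubleSwap, h]

/-- The opening flip replaces both copies by their mean `g`, which the inner network averages to a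
constant. The closing flip changes nothing here; it serves routing. -/
theorem exists_double_mixing {X : Type*} (N : SwitchingNetwork X) (h : Bool × X → ℝ) :
    ∃ c, ∀ z, iterAvg N.doubleSwap h (N.depth + 2) z = c := by
  let g : X → ℝ := fun x => (h (true, x) + h (false, x)) / 2
  have hg : ∀ t ≤ N.depth, ∀ z : Bool × X,
      iterAvg N.doubleSwap h (t + 1) z = iterAvg N.swap g t z.2 := by
    intro t
    induction t with
    | zero =>
      rintro _ ⟨b, x⟩
      cases b <;> simp [iterAvg, doubleSwap, g, add_comm]
    | succ t ih =>
      rintro ht ⟨b, x⟩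
      rw [iterAvg_succ, ih (by omega), ih (by omega), doubleSwap_mid N (by omega)]
      rfl
  obtain ⟨c, hc⟩ := N.mixing g
  refine ⟨c, fun z => ?_⟩
  rw [iterAvg_succ, hg _ le_rfl, hg _ le_rfl, hc, hc]
  ring

/-- This is the looping algorithm. Colour each point by the copy through which it shall travel: the
points of an input pair must differ, and so must those whose images under `σ` form an output pair.
Then `σ` factors into an input exchange `τ`, a permutation `ρ'` preserving both copies, which is
routed inductively, and an output exchange `κ⁻¹`. -/
theorem exists_double_routing {X : Type*} (N : SwitchingNetwork X) (σ : Equiv.Perm (Bool × X)) :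
    ∃ p : ℕ → Equiv.Perm (Bool × X), p 0 = 1 ∧ p (N.depth + 2) = σ ∧
      ∀ t < N.depth + 2, ∀ x, p (t + 1) x = p t x ∨ p (t + 1) x = p t (N.doubleSwap t x) := by
  have hflip : ∀ z : Bool × X, flip X (flip X z) = z := by rintro ⟨b, x⟩; simp
  have hflip' : ∀ z : Bool × X, flip X z ≠ z := by
    rintro ⟨b, x⟩ h
    have := congrArg Prod.fst h
    simp at this
  obtain ⟨χ, hχ, hχ'⟩ := exists_common_coloring (flip X) (σ⁻¹ * flip X * σ) hflip
    (by intro z; simp [hflip]) hflip' (by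
      intro z h
      apply hflip' (σ z)
      have := congrArg σ h
      simpa using this)
  have hinv : ∀ (ψ : Bool × X → Bool) (hψ : ∀ z, ψ (flip X z) = !ψ z) (b : Bool) (x : X),
      ψ (b == ψ (true, x), x) = b := by
    intro ψ hψ b x
    have h1 := hψ (true, x)
    rw [flip_apply, Bool.not_true] at h1
    cases b <;> cases h2 : ψ (true, x) <;> simp [h2, h1]
  have hinv' : ∀ (ψ : Bool × X → Bool) (hψ : ∀ z, ψ (flip X z) = !ψ z) (b : Bool) (x : X),
      (ψ (b, x) == ψ (true, x)) = b := by
    intro ψ hψ b x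
    have h1 := hψ (true, x)
    rw [flip_apply, Bool.not_true] at h1
    cases b <;> cases h2 : ψ (true, x) <;> simp [h2, h1]
  -- A colouring that alternates on each pair defines an exchange within pairs, sending every point
  -- to the copy named by its colour.
  let col : (ψ : Bool × X → Bool) → (∀ z, ψ (flip X z) = !ψ z) → Equiv.Perm (Bool × X) :=
    fun ψ hψ =>
    { toFun := fun z => (ψ z, z.2)
      invFun := fun z => (z.1 == ψ (true, z.2), z.2)
      left_inv := by rintro ⟨b, x⟩; simp only [hinv' ψ hψ]
      right_inv := by rintro ⟨b, x⟩; simp only [hinv ψ hψ] }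
  have hcol : ∀ ψ hψ z, col ψ hψ z = z ∨ col ψ hψ z = flip X z := by
    rintro ψ hψ ⟨b, x⟩
    change (ψ (b, x), x) = _ ∨ (ψ (b, x), x) = (!b, x)
    cases b <;> cases ψ _ <;> simp
  let ψ : Bool × X → Bool := fun w => χ (σ⁻¹ w)
  have hψ : ∀ z, ψ (flip X z) = !ψ z := by
    intro z
    have := hχ' (σ⁻¹ z)
    simpa [ψ] using this
  let κ := col ψ hψ
  let τ := col χ hχ
  let ρ' : Equiv.Perm (Bool × X) := κ * σ * τ⁻¹
  -- Both `τ w` and `κ (σ w)` lie in the copy `χ w`.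
  have hρ' : ∀ z, (ρ' z).1 = z.1 := by
    intro z
    obtain ⟨w, rfl⟩ := τ.surjective z
    change χ (σ⁻¹ (σ (τ.symm (τ w)))) = χ w
    simp
  have hρ'' : ∀ z, (ρ'.symm z).1 = z.1 := by
    intro z
    have := hρ' (ρ'.symm z)
    rw [Equiv.apply_symm_apply] at this
    exact this.symm
  let ρ : Bool → Equiv.Perm X := fun b =>
    { toFun := fun x => (ρ' (b, x)).2
      invFun := fun x => (ρ'.symm (b, x)).2
      left_inv := by
        intro x
        have : (b, (ρ' (b, x)).2) = ρ' (b, x) := Prod.ext (hρ' (b, x)).symm rfl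
        simp [this]
      right_inv := by
        intro x
        have : (b, (ρ'.symm (b, x)).2) = ρ'.symm (b, x) := Prod.ext (hρ'' (b, x)).symm rfl
        simp [this] }
  have hρ : fiberwise ρ = ρ' := by
    ext1 ⟨b, x⟩
    exact Prod.ext (hρ' (b, x)).symm rfl
  choose p hp0 hp1 hp using fun b => N.routing (ρ b)
  -- Each layer multiplies on the right, so the partial products of `κ⁻¹ * ρ' * τ` appear with the
  -- output exchange first and `τ` in the last layer.
  refine ⟨fun t => match t with
    | 0 => 1
    | t + 1 => if t ≤ N.depth then κ⁻¹ * fiberwise (fun b => p b t) else σ, rfl, ?_, ?_⟩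
  · simp
  · have hκ : ∀ z, κ⁻¹ z = z ∨ κ⁻¹ z = flip X z := by
      intro z
      rcases hcol ψ hψ (κ⁻¹ z) with h | h
      · left; rw [← h]; exact (κ.apply_symm_apply z)
      · right
        rw [show col ψ hψ (κ⁻¹ z) = z from κ.apply_symm_apply z] at h
        conv_rhs => rw [h]
        rw [hflip]
    rintro (_ | t) ht ⟨b, x⟩
    · simp only [zero_le, if_true, hp0, doubleSwap]
      have : fiberwise (fun _ : Bool => (1 : Equiv.Perm X)) = 1 := rfl
      simp only [this, mul_one]
      exact hκ _
    · rcases Nat.lt_or_ge t N.depth with h | h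
      · simp only [h.le, Nat.succ_le_of_lt h, if_true, doubleSwap_mid N h]
        rcases hp b t h x with h' | h'
        · left; simp [h']
        · right; simp [h']
      · obtain rfl : t = N.depth := by omega
        have hf : fiberwise (fun b => p b N.depth) = ρ' := by
          rw [← hρ]; congr 1; funext b; exact hp1 b
        have hd : N.doubleSwap (N.depth + 1) = flip X := by simp [doubleSwap]
        have hd' : κ⁻¹ * ρ' = σ * τ⁻¹ := by simp only [ρ', mul_assoc, inv_mul_cancel_left]
        simp only [le_refl, if_true, hf, hd, hd']
        rw [if_neg (by omega)]
        have hτ : τ⁻¹ (b, x) = (b, x) ∨ τ⁻¹ (b, x) = flip X (b, x) := by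
          rcases hcol χ hχ (τ⁻¹ (b, x)) with h | h
          · left; rw [← h]; exact (τ.apply_symm_apply _)
          · right
            rw [show col χ hχ (τ⁻¹ (b, x)) = (b, x) from τ.apply_symm_apply _] at h
            conv_rhs => rw [h]
            rw [hflip]
        have hτ' : τ (b, x) = (b, x) ∨ τ (b, x) = flip X (b, x) := hcol χ hχ _
        rcases hτ' with h | h
        · left
          rw [Equiv.Perm.mul_apply]; congr 1
          exact (Equiv.Perm.eq_inv_iff_eq.2 h)
        · right
          rw [Equiv.Perm.mul_apply]; congr 1
          exact (Equiv.Perm.eq_inv_iff_eq.2 h)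

/-- By induction each copy has a potential. The discrepancy `D` across the flip is unchanged by
every inner involution because of the squares of a flip with it, so it is constant and can be
absorbed into the potential of one copy. -/
theorem exists_double_filled {X : Type*} (N : SwitchingNetwork X)
    (a : Bool × X → Bool × X → ZMod 2) (ha : ∀ x y, a x y = a y x)
    (hsq : ∀ s < N.depth + 2, ∀ t < N.depth + 2, ∀ x,
      a x (N.doubleSwap s x) + a (N.doubleSwap s x) (N.doubleSwap t (N.doubleSwap s x)) +
      a (N.doubleSwap t (N.doubleSwap s x)) (N.doubleSwap t x) + a (N.doubleSwap t x) x = 0) :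
    ∃ f : Bool × X → ZMod 2, ∀ t < N.depth + 2, ∀ x,
      a x (N.doubleSwap t x) = f x + f (N.doubleSwap t x) := by
  have hfib : ∀ b : Bool, ∃ f : X → ZMod 2, ∀ t < N.depth, ∀ x,
      a (b, x) (b, N.swap t x) = f x + f (N.swap t x) := by
    intro b
    apply N.filled (fun x y => a (b, x) (b, y)) (fun _ _ => ha _ _)
    intro s hs t ht x
    have := hsq (s + 1) (by omega) (t + 1) (by omega) (b, x)
    rw [doubleSwap_mid N hs, doubleSwap_mid N ht] at this
    exact this
  choose f hf using hfib
  let D : X → ZMod 2 := fun x => a (true, x) (false, x) + f true x + f false x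
  have hD : ∀ t < N.depth, ∀ x, D (N.swap t x) = D x := by
    intro t ht x
    have := hsq 0 (by omega) (t + 1) (by omega) (true, x)
    rw [doubleSwap_mid N ht] at this
    simp only [doubleSwap, flip_apply, fiberwise_apply, Bool.not_true] at this
    rw [hf _ t ht, ha _ (true, x), hf _ t ht, ha _ (true, N.swap t x)] at this
    simp only [D]
    generalize a (true, x) (false, x) = r1 at *
    generalize a (true, N.swap t x) (false, N.swap t x) = r2 at *
    generalize f true x = r3 at *
    generalize f false x = r4 at *
    generalize f true (N.swap t x) = r5 at *
    generalize f false (N.swap t x) = r6 at *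
    revert r1 r2 r3 r4 r5 r6
    decide
  have hDc := N.const_of_invariant D hD
  rcases isEmpty_or_nonempty X with hX | ⟨⟨x₀⟩⟩
  · exact ⟨0, fun t _ x => isEmptyElim x.2⟩
  obtain ⟨c₀, hc₀⟩ : ∃ c₀, ∀ x, D x = c₀ := ⟨D x₀, fun x => hDc x x₀⟩
  refine ⟨fun z => f z.1 z.2 + if z.1 then c₀ else 0, fun t ht => ?_⟩
  rcases N.doubleSwap_cases t with h | ⟨s, hs, h⟩
  · rw [h]
    have h0 : ∀ x, a (true, x) (false, x) = c₀ + f true x + f false x := by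
      intro x
      rw [← hc₀ x]
      simp only [D]
      generalize a (true, x) (false, x) = r1
      generalize f true x = r3
      generalize f false x = r4
      revert r1 r3 r4
      decide
    rintro ⟨_ | _, x⟩
    · rw [flip_apply, ha]
      simp only [Bool.not_false, h0, if_true]
      simp
      ring
    · rw [flip_apply]
      simp only [Bool.not_true, h0, if_true]
      simp
      ring
  · rw [h]
    rintro ⟨b, x⟩
    simp only [fiberwise_apply, hf b s hs]
    have h2 : ∀ r1 r3 r4 : ZMod 2, r3 + r4 = r3 + r1 + (r4 + r1) := by decide
    exact h2 _ _ _

/-- The network on two copies of `X`, with one more layer at both ends. -/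
noncomputable def double {X : Type*} (N : SwitchingNetwork X) : SwitchingNetwork (Bool × X) where
  depth := N.depth + 2
  swap := N.doubleSwap
  swap_swap t := by
    rcases N.doubleSwap_cases t with h | ⟨s, hs, h⟩ <;> rw [h] <;> rintro ⟨b, x⟩ <;>
      simp [N.swap_swap]
  swap_comm s t := by
    rcases N.doubleSwap_cases s with h | ⟨s, hs, h⟩ <;>
    rcases N.doubleSwap_cases t with h' | ⟨s', hs', h'⟩ <;> rw [h, h'] <;> rintro ⟨b, x⟩ <;>
      simp only [fiberwise_apply, flip_apply]
    rw [N.swap_comm]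
  mixing := N.exists_double_mixing
  routing := N.exists_double_routing
  filled := N.exists_double_filled

end SwitchingNetwork

/-- Two layers for each doubling: depth logarithmic in the number of points, hence only
polylogarithmic overhead in the final graph. -/
theorem exists_switchingNetwork (k : ℕ) : ∃ (X : Type) (_ : Fintype X) (N : SwitchingNetwork X),
    Fintype.card X = 2 ^ k ∧ N.depth = 2 * k := by
  induction k with
  | zero => exact ⟨Unit, inferInstance, SwitchingNetwork.point, rfl, rfl⟩
  | succ k ih =>
    obtain ⟨X, _, N, h1, h2⟩ := ih
    refine ⟨Bool × X, inferInstance, N.double, ?_, ?_⟩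
    · rw [Fintype.card_prod, h1, Fintype.card_bool]; ring
    · change N.depth + 2 = _
      omega


/-! ### Graphs whose cycles are filled by closed walks of length four -/

/-- Two vertices are equal or adjacent. -/
def LazyAdj {V : Type*} (G : SimpleGraph V) (u v : V) : Prop := u = v ∨ G.Adj u v

/-- Every `𝔽₂`-cochain that vanishes on all closed lazy walks of length four is a coboundary. -/
def Filled {V : Type*} (G : SimpleGraph V) : Prop :=
  ∀ a : V → V → ZMod 2, (∀ u v, a u v = a v u) → (∀ v, a v v = 0) →
    (∀ v₀ v₁ v₂ v₃, LazyAdj G v₀ v₁ → LazyAdj G v₁ v₂ → LazyAdj G v₂ v₃ → LazyAdj G v₃ v₀ →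
      a v₀ v₁ + a v₁ v₂ + a v₂ v₃ + a v₃ v₀ = 0) →
    ∃ f : V → ZMod 2, ∀ u v, G.Adj u v → a u v = f u + f v

/-- Every vertex has at most `D` neighbours. -/
def DegreeLE {V : Type*} (G : SimpleGraph V) (D : ℕ) : Prop :=
  ∀ v, ∃ S : Finset V, S.card ≤ D ∧ ∀ w, G.Adj v w → w ∈ S

theorem eq_of_adj_eq {V Y : Type*} {G : SimpleGraph V} (hG : G.Preconnected) (f : V → Y)
    (h : ∀ u v, G.Adj u v → f u = f v) (u v : V) : f u = f v := by
  obtain ⟨w⟩ := hG u v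
  induction w with
  | nil => rfl
  | cons hadj _ ih => exact (h _ _ hadj).trans ih

theorem filled_pathGraph (n : ℕ) : Filled (SimpleGraph.pathGraph n) := by
  intro a ha _ _
  refine ⟨fun i => ∑ j ∈ Finset.range i,
    if h : j + 1 < n then a ⟨j, by omega⟩ ⟨j + 1, h⟩ else 0, ?_⟩
  have key : ∀ i j : Fin n, i.val + 1 = j.val → a i j =
      (∑ j ∈ Finset.range i, if h : j + 1 < n then a ⟨j, by omega⟩ ⟨j + 1, h⟩ else 0) +
      (∑ j ∈ Finset.range j, if h : j + 1 < n then a ⟨j, by omega⟩ ⟨j + 1, h⟩ else 0) := by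
    intro i j hij
    rw [← hij, Finset.sum_range_succ, ← add_assoc, CharTwo.add_self_eq_zero, zero_add,
      dif_pos (by omega)]
    congr 1
    exact Fin.ext hij.symm
  intro u v huv
  rcases SimpleGraph.pathGraph_adj.1 huv with h | h
  · exact key u v h
  · rw [ha, key v u h, add_comm]

theorem degreeLE_pathGraph (n : ℕ) : DegreeLE (SimpleGraph.pathGraph n) 2 := by
  classical
  intro v
  refine ⟨Finset.univ.filter fun w => v.val + 1 = w.val ∨ w.val + 1 = v.val, ?_, ?_⟩
  · rw [Finset.filter_or]
    refine (Finset.card_union_le _ _).trans (Nat.add_le_add (b := 1) (d := 1) ?_ ?_)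
    · refine Finset.card_le_one.2 fun a ha b hb => ?_
      simp only [Finset.mem_filter, Finset.mem_univ, true_and] at ha hb
      exact Fin.ext (by omega)
    · refine Finset.card_le_one.2 fun a ha b hb => ?_
      simp only [Finset.mem_filter, Finset.mem_univ, true_and] at ha hb
      exact Fin.ext (by omega)
  · intro w hw
    simpa using SimpleGraph.pathGraph_adj.1 hw

/-- Take a potential on each fibre over `V`. For adjacent fibres, the product squares make the
discrepancy constant along `W`, so it can be read off at `w₀`, where a potential `g` of the base
corrects it. -/
theorem filled_boxProd {V W : Type*} {G : SimpleGraph V} {H : SimpleGraph W} (hH' : H.Preconnected)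
    (hG : Filled G) (hH : Filled H) : Filled (G □ H) := by
  intro a ha h0 hsq
  rcases isEmpty_or_nonempty W with hW | ⟨⟨w₀⟩⟩
  · exact ⟨0, fun u => isEmptyElim u.2⟩
  have hfib : ∀ v, ∃ f : W → ZMod 2, ∀ w w', H.Adj w w' → a (v, w) (v, w') = f w + f w' := by
    intro v
    refine hH (fun w w' => a (v, w) (v, w')) (fun _ _ => ha _ _) (fun _ => h0 _) ?_
    have hl : ∀ w w', LazyAdj H w w' → LazyAdj (G □ H) (v, w) (v, w') := by
      rintro w w' (rfl | h)
      · exact Or.inl rfl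
      · exact Or.inr (by simp [h])
    intro _ _ _ _ h1 h2 h3 h4
    exact hsq _ _ _ _ (hl _ _ h1) (hl _ _ h2) (hl _ _ h3) (hl _ _ h4)
  choose f hf using hfib
  obtain ⟨g, hg⟩ : ∃ g : V → ZMod 2, ∀ v v', G.Adj v v' → a (v, w₀) (v', w₀) = g v + g v' := by
    refine hG (fun v v' => a (v, w₀) (v', w₀)) (fun _ _ => ha _ _) (fun _ => h0 _) ?_
    have hl : ∀ v v', LazyAdj G v v' → LazyAdj (G □ H) (v, w₀) (v', w₀) := by
      rintro w w' (rfl | h)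
      · exact Or.inl rfl
      · exact Or.inr (by simp [h])
    intro _ _ _ _ h1 h2 h3 h4
    exact hsq _ _ _ _ (hl _ _ h1) (hl _ _ h2) (hl _ _ h3) (hl _ _ h4)
  refine ⟨fun z => f z.1 z.2 + f z.1 w₀ + g z.1, ?_⟩
  rintro ⟨v, w⟩ ⟨v', w'⟩ h
  rw [SimpleGraph.boxProd_adj] at h
  dsimp only at h ⊢
  rcases h with ⟨h, rfl⟩ | ⟨h, rfl⟩
  · have hD := eq_of_adj_eq hH' (fun w => a (v, w) (v', w) + f v w + f v' w) (by
      intro w w' hw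
      have := hsq (v, w) (v, w') (v', w') (v', w) (Or.inr (by simp [hw])) (Or.inr (by simp [h]))
        (Or.inr (by simp [hw.symm])) (Or.inr (by simp [h.symm]))
      rw [hf _ _ _ hw, hf _ _ _ hw.symm, ha (v', w)] at this
      generalize a (v, w) (v', w) = r1 at *
      generalize a (v, w') (v', w') = r2 at *
      have h8 : ∀ r1 r2 r3 r4 r5 r6 : ZMod 2, r3 + r4 + r2 + (r5 + r6) + r1 = 0 →
        r1 + r3 + r6 = r2 + r4 + r5 := by decide
      exact h8 _ _ _ _ _ _ this) w w₀
    rw [hg v v' h] at hD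
    have h8 : ∀ r1 r2 r3 r4 r5 r6 r7 : ZMod 2, r1 + r2 + r3 = r4 + r5 + r6 + r7 →
        r1 = r2 + r6 + r4 + (r3 + r7 + r5) := by decide
    exact h8 _ _ _ _ _ _ _ hD
  · rw [hf _ _ _ h]
    have h8 : ∀ r1 r2 r3 r4 : ZMod 2, r1 + r2 = r1 + r3 + r4 + (r2 + r3 + r4) := by decide
    exact h8 _ _ _ _

/-! ### The crossbar construction -/

/-- The crossbar of a family of graphs `E t` on `X` over a graph `P` on the index set: a copy of `X`
for each pair of indices, in which the graphs of both indices are active. -/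
def crossbar {X I : Type*} (P : SimpleGraph I) (E : I → SimpleGraph X) :
    SimpleGraph (X × (I × I)) where
  Adj u v := (u.1 = v.1 ∧ (P □ P).Adj u.2 v.2) ∨
    (u.2 = v.2 ∧ ((E u.2.1).Adj u.1 v.1 ∨ (E u.2.2).Adj u.1 v.1))
  symm := ⟨by
    rintro ⟨x, b⟩ ⟨y, c⟩ h
    dsimp only at h ⊢
    rcases h with ⟨rfl, h⟩ | ⟨rfl, h | h⟩
    · exact Or.inl ⟨rfl, h.symm⟩
    · exact Or.inr ⟨rfl, Or.inl h.symm⟩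
    · exact Or.inr ⟨rfl, Or.inr h.symm⟩⟩
  loopless := ⟨by
    rintro ⟨x, b⟩ h
    rcases h with ⟨_, h⟩ | ⟨_, h | h⟩ <;> exact h.ne rfl⟩

section Crossbar

variable {X I : Type*} {P : SimpleGraph I} {E : I → SimpleGraph X}

theorem crossbar_grid {x : X} {b c : I × I} (h : (P □ P).Adj b c) :
    (crossbar P E).Adj (x, b) (x, c) := Or.inl ⟨rfl, h⟩

theorem crossbar_left {x y : X} {t j : I} (h : (E t).Adj x y) :
    (crossbar P E).Adj (x, (t, j)) (y, (t, j)) := Or.inr ⟨rfl, Or.inl h⟩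

theorem crossbar_right {x y : X} {t j : I} (h : (E t).Adj x y) :
    (crossbar P E).Adj (x, (j, t)) (y, (j, t)) := Or.inr ⟨rfl, Or.inr h⟩

/-- A potential on each grid `{x} × I × I` gauges away the grid edges. The remaining cochain `A'` on
an edge of `E t` is constant along row `t` and column `t` of the grid, since the edge is present
there throughout and neighbouring cells bound a square. It therefore descends to a cochain on `X`.
Cell `(s, t)` contains both `E s` and `E t`, which supplies the four-walk relations that `hE`
requires. -/
theorem filled_crossbar (hP' : P.Preconnected) (hP : Filled P)
    (hE : ∀ a : X → X → ZMod 2, (∀ x y, a x y = a y x) → (∀ x, a x x = 0) →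
      (∀ s t x₀ x₁ x₂ x₃, LazyAdj (E s ⊔ E t) x₀ x₁ → LazyAdj (E s ⊔ E t) x₁ x₂ →
        LazyAdj (E s ⊔ E t) x₂ x₃ → LazyAdj (E s ⊔ E t) x₃ x₀ →
        a x₀ x₁ + a x₁ x₂ + a x₂ x₃ + a x₃ x₀ = 0) →
      ∃ f : X → ZMod 2, ∀ t x y, (E t).Adj x y → a x y = f x + f y) :
    Filled (crossbar P E) := by
  intro A hA hA0 hsq
  have hfib : ∀ x, ∃ g : I × I → ZMod 2, ∀ b c, (P □ P).Adj b c →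
      A (x, b) (x, c) = g b + g c := by
    intro x
    refine filled_boxProd hP' hP hP (fun b c => A (x, b) (x, c)) (fun _ _ => hA _ _)
      (fun _ => hA0 _) ?_
    have hl : ∀ b c, LazyAdj (P □ P) b c → LazyAdj (crossbar P E) (x, b) (x, c) := by
      rintro b c (rfl | h)
      · exact Or.inl rfl
      · exact Or.inr (crossbar_grid h)
    intro _ _ _ _ h1 h2 h3 h4
    exact hsq _ _ _ _ (hl _ _ h1) (hl _ _ h2) (hl _ _ h3) (hl _ _ h4)
  choose g hg using hfib
  let A' : X → X → I × I → ZMod 2 := fun x y b => A (x, b) (y, b) + g x b + g y b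
  have hstep : ∀ x y b c, (P □ P).Adj b c → (crossbar P E).Adj (x, b) (y, b) →
      (crossbar P E).Adj (x, c) (y, c) → A' x y b = A' x y c := by
    intro x y b c hbc hb hc
    have := hsq (x, b) (x, c) (y, c) (y, b) (Or.inr (crossbar_grid hbc)) (Or.inr hc)
      (Or.inr (crossbar_grid hbc.symm)) (Or.inr hb.symm)
    rw [hg _ _ _ hbc, hg _ _ _ hbc.symm, hA (y, b)] at this
    have h8 : ∀ r1 r2 r3 r4 r5 r6 : ZMod 2, r3 + r4 + r2 + (r5 + r6) + r1 = 0 →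
        r1 + r3 + r6 = r2 + r4 + r5 := by decide
    exact h8 _ _ _ _ _ _ this
  have hrow : ∀ x y t, (E t).Adj x y → ∀ i j, A' x y (t, i) = A' x y (t, j) := by
    intro x y t ht i j
    refine eq_of_adj_eq hP' (fun i => A' x y (t, i)) (fun i j hij => ?_) i j
    exact hstep _ _ _ _ (by simp [hij]) (crossbar_left ht) (crossbar_left ht)
  have hcol : ∀ x y t, (E t).Adj x y → ∀ i j, A' x y (i, t) = A' x y (j, t) := by
    intro x y t ht i j
    refine eq_of_adj_eq hP' (fun i => A' x y (i, t)) (fun i j hij => ?_) i j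
    exact hstep _ _ _ _ (by simp [hij]) (crossbar_right ht) (crossbar_right ht)
  classical
  -- An edge may belong to several `E t`; a row and a column of any two of them meet in a common
  -- cell, so the value does not depend on the choice.
  let a : X → X → ZMod 2 := fun x y =>
    if h : ∃ t, (E t).Adj x y then A' x y (h.choose, h.choose) else 0
  have ha : ∀ x y t, (E t).Adj x y → ∀ j, A' x y (t, j) = a x y := by
    intro x y t ht j
    have h : ∃ t, (E t).Adj x y := ⟨t, ht⟩
    simp only [a, dif_pos h]
    rw [hrow x y t ht j h.choose, hcol x y _ h.choose_spec]
  have ha' : ∀ x y t, (E t).Adj x y → ∀ j, A' x y (j, t) = a x y := by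
    intro x y t ht j
    rw [hcol x y t ht j t, ha x y t ht]
  have hA's : ∀ x y b, A' x y b = A' y x b := by
    intro x y b
    simp only [A']
    rw [hA (x, b)]
    ring
  have hasymm : ∀ x y, a x y = a y x := by
    intro x y
    by_cases h : ∃ t, (E t).Adj x y
    · obtain ⟨t, ht⟩ := h
      rw [← ha x y t ht t, ← ha y x t ht.symm t, hA's]
    · have h' : ¬ ∃ t, (E t).Adj y x := fun ⟨t, ht⟩ => h ⟨t, ht.symm⟩
      simp only [a, dif_neg h, dif_neg h']
  have ha0 : ∀ x, a x x = 0 := by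
    intro x
    have h : ¬ ∃ t, (E t).Adj x x := fun ⟨t, ht⟩ => ht.ne rfl
    simp only [a, dif_neg h]
  have hA'0 : ∀ x b, A' x x b = 0 := by
    intro x b
    simp only [A', hA0, zero_add, CharTwo.add_self_eq_zero]
  obtain ⟨f, hf⟩ := hE a hasymm ha0 (by
    intro s t x₀ x₁ x₂ x₃ h0 h1 h2 h3
    have hcell : ∀ x y, LazyAdj (E s ⊔ E t) x y →
        a x y = A' x y (s, t) ∧ LazyAdj (crossbar P E) (x, (s, t)) (y, (s, t)) := by
      rintro x y (rfl | h)
      · exact ⟨by rw [ha0, hA'0], Or.inl rfl⟩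
      · rw [SimpleGraph.sup_adj] at h
        rcases h with h | h
        · exact ⟨(ha x y s h t).symm, Or.inr (crossbar_left h)⟩
        · exact ⟨(ha' x y t h s).symm, Or.inr (crossbar_right h)⟩
    have := hsq _ _ _ _ (hcell _ _ h0).2 (hcell _ _ h1).2 (hcell _ _ h2).2 (hcell _ _ h3).2
    rw [(hcell _ _ h0).1, (hcell _ _ h1).1, (hcell _ _ h2).1, (hcell _ _ h3).1]
    simp only [A']
    rw [← this]
    have h8 : ∀ r1 r2 r3 r4 s1 s2 s3 s4 : ZMod 2, r1 + s1 + s2 + (r2 + s2 + s3) +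
      (r3 + s3 + s4) + (r4 + s4 + s1) = r1 + r2 + r3 + r4 := by
      intros
      ring_nf
      simp [show (2 : ZMod 2) = 0 from rfl]
    exact h8 _ _ _ _ _ _ _ _)
  refine ⟨fun z => g z.1 z.2 + f z.1, ?_⟩
  have h8 : ∀ r s1 s2 f1 f2 : ZMod 2, r + s1 + s2 = f1 + f2 → r = s1 + f1 + (s2 + f2) := by decide
  rintro ⟨x, b⟩ ⟨y, c⟩ h
  change (x = y ∧ (P □ P).Adj b c) ∨ (b = c ∧ ((E b.1).Adj x y ∨ (E b.2).Adj x y)) at h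
  dsimp only
  rcases h with ⟨rfl, h⟩ | ⟨rfl, h | h⟩
  · rw [hg _ _ _ h]
    have h8 : ∀ r1 r2 r4 : ZMod 2, r1 + r2 = r1 + r4 + (r2 + r4) := by decide
    exact h8 _ _ _
  · have := (ha x y _ h b.2).trans (hf _ _ _ h)
    exact h8 _ _ _ _ _ this
  · have := (ha' x y _ h b.1).trans (hf _ _ _ h)
    exact h8 _ _ _ _ _ this

theorem degreeLE_crossbar {p e : ℕ} (hP : DegreeLE P p) (hE : ∀ t, DegreeLE (E t) e) :
    DegreeLE (crossbar P E) (2 * p + 2 * e) := by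
  classical
  rintro ⟨x, s, t⟩
  obtain ⟨S, hS, hS'⟩ := hP s
  obtain ⟨S₂, hS₂, hS₂'⟩ := hP t
  obtain ⟨R, hR, hR'⟩ := hE s x
  obtain ⟨R₂, hR₂, hR₂'⟩ := hE t x
  refine ⟨(S.image (fun i => (x, (i, t))) ∪ S₂.image (fun i => (x, (s, i)))) ∪
    (R.image (fun y => (y, (s, t))) ∪ R₂.image (fun y => (y, (s, t)))), ?_, ?_⟩
  · have h1 := Finset.card_image_le (s := S) (f := fun i => (x, (i, t)))
    have h2 := Finset.card_image_le (s := S₂) (f := fun i => (x, (s, i)))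
    have h3 := Finset.card_image_le (s := R) (f := fun y => (y, (s, t)))
    have h4 := Finset.card_image_le (s := R₂) (f := fun y => (y, (s, t)))
    refine (Finset.card_union_le _ _).trans (Nat.add_le_add
      ((Finset.card_union_le _ _).trans ?_) ((Finset.card_union_le _ _).trans ?_)) <;> omega
  · rintro ⟨y, s', t'⟩ h
    change (x = y ∧ (P □ P).Adj (s, t) (s', t')) ∨
      ((s, t) = (s', t') ∧ ((E s).Adj x y ∨ (E t).Adj x y)) at h
    rw [SimpleGraph.boxProd_adj, Prod.mk_inj] at h
    simp only [Finset.mem_union, Finset.mem_image, Prod.mk.injEq]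
    rcases h with ⟨rfl, ⟨h, rfl⟩ | ⟨h, rfl⟩⟩ | ⟨⟨rfl, rfl⟩, h | h⟩
    · exact Or.inl (Or.inl ⟨_, hS' _ h, rfl, rfl, rfl⟩)
    · exact Or.inl (Or.inr ⟨_, hS₂' _ h, rfl, rfl, rfl⟩)
    · exact Or.inr (Or.inl ⟨_, hR' _ h, rfl, rfl, rfl⟩)
    · exact Or.inr (Or.inr ⟨_, hR₂' _ h, rfl, rfl, rfl⟩)

theorem preconnected_crossbar (hP : P.Preconnected)
    (hE : ∀ D : X → Prop, (∀ t x y, (E t).Adj x y → (D x ↔ D y)) → ∀ x y, D x → D y) :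
    (crossbar P E).Preconnected := by
  rintro ⟨x, s, t⟩ ⟨y, s', t'⟩
  have hgrid : ∀ z b c, (crossbar P E).Reachable (z, b) (z, c) := by
    intro z b c
    have hb := (hP.boxProd hP) b c
    obtain ⟨w⟩ := hb
    induction w with
    | nil => exact SimpleGraph.Reachable.refl _
    | cons h _ ih => exact (crossbar_grid h).reachable.trans ih
  refine hE (fun z => (crossbar P E).Reachable (x, (s, t)) (z, (s', t'))) ?_ x y (hgrid _ _ _)
  intro i z w h
  -- Walk in the grid to a cell where `E i` is active, cross the edge, and walk back.
  have h1 : (crossbar P E).Reachable (z, (s', t')) (w, (s', t')) :=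
    ((hgrid z (s', t') (i, t')).trans (crossbar_left h).reachable).trans (hgrid w _ _)
  exact ⟨fun h => h.trans h1, fun h => h.trans h1.symm⟩

end Crossbar


/-! ### Decomposing bounded degree graphs into permutations -/

/-- Greedy colouring. -/
theorem exists_greedy_coloring {E : Type*} [Finite E] (conf : E → E → Prop)
    (hsymm : ∀ e e', conf e e' → conf e' e) (hirr : ∀ e, ¬ conf e e) (m : ℕ)
    (hm : ∀ e, ∃ S : Finset E, S.card ≤ m ∧ ∀ e', conf e e' → e' ∈ S) :
    ∃ χ : E → Fin (m + 1), ∀ e e', conf e e' → χ e ≠ χ e' := by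
  classical
  have := Fintype.ofFinite E
  have key : ∀ s : Finset E, ∃ χ : E → Fin (m + 1), ∀ e ∈ s, ∀ e' ∈ s, conf e e' → χ e ≠ χ e' := by
    intro s
    induction s using Finset.induction_on with
    | empty => exact ⟨0, by simp⟩
    | insert e s he ih =>
      obtain ⟨χ, hχ⟩ := ih
      obtain ⟨S, hS, hS'⟩ := hm e
      obtain ⟨c, hc⟩ : ∃ c, c ∉ S.image χ := by
        by_contra! h
        have h1 : (Finset.univ : Finset (Fin (m + 1))) ⊆ S.image χ := fun c _ => h c
        have h2 := Finset.card_le_card h1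
        have h3 := Finset.card_image_le (s := S) (f := χ)
        rw [Finset.card_univ, Fintype.card_fin] at h2
        omega
      have hc' : ∀ e', conf e e' → χ e' ≠ c := fun e' h h' =>
        hc (Finset.mem_image.2 ⟨e', hS' e' h, h'⟩)
      refine ⟨Function.update χ e c, ?_⟩
      intro e₁ h₁ e₂ h₂ h
      by_cases h1 : e₁ = e
      · subst h1
        have h2 : e₂ ≠ e₁ := fun h2 => hirr e₁ (by rwa [h2] at h)
        rw [Function.update_self, Function.update_of_ne h2]
        exact (hc' _ h).symm
      · by_cases h2 : e₂ = e
        · subst h2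
          rw [Function.update_self, Function.update_of_ne h1]
          exact hc' _ (hsymm _ _ h)
        · rw [Function.update_of_ne h1, Function.update_of_ne h2]
          exact hχ _ (Finset.mem_of_mem_insert_of_ne h₁ h1) _
            (Finset.mem_of_mem_insert_of_ne h₂ h2) h
  obtain ⟨χ, hχ⟩ := key Finset.univ
  exact ⟨χ, fun e e' => hχ e (Finset.mem_univ _) e' (Finset.mem_univ _)⟩

/-- A graph of degree at most `Δ` is covered by the graphs of `2 Δ + 1` permutations. -/
theorem exists_covering_perms {X : Type*} [Fintype X] (M : SimpleGraph X) {Δ : ℕ}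
    (hM : DegreeLE M Δ) :
    ∃ σ : Fin (2 * Δ + 1) → Equiv.Perm X, ∀ x y, M.Adj x y → ∃ c, σ c x = y := by
  classical
  -- Directed edges conflict when they share their tail or their head, so each conflicts with at
  -- most `Δ + Δ` others.
  obtain ⟨χ, hχ⟩ := exists_greedy_coloring (E := X × X)
    (fun p q => p ≠ q ∧ M.Adj p.1 p.2 ∧ M.Adj q.1 q.2 ∧ (p.1 = q.1 ∨ p.2 = q.2))
    (fun p q h => ⟨h.1.symm, h.2.2.1, h.2.1, h.2.2.2.imp Eq.symm Eq.symm⟩)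
    (fun p h => h.1 rfl) (2 * Δ) (by
      rintro ⟨x, y⟩
      obtain ⟨S, hS, hS'⟩ := hM x
      obtain ⟨R, hR, hR'⟩ := hM y
      refine ⟨S.image (fun z => (x, z)) ∪ R.image (fun z => (z, y)), ?_, ?_⟩
      · have h1 := Finset.card_image_le (s := S) (f := fun z => (x, z))
        have h2 := Finset.card_image_le (s := R) (f := fun z => (z, y))
        refine (Finset.card_union_le _ _).trans ?_
        omega
      · rintro ⟨x', y'⟩ ⟨_, h1, h2, h3⟩
        dsimp only at h1 h2 h3
        rw [Finset.mem_union, Finset.mem_image, Finset.mem_image]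
        rcases h3 with rfl | rfl
        · exact Or.inl ⟨y', hS' _ h2, rfl⟩
        · exact Or.inr ⟨x', hR' _ h2.symm, rfl⟩)
  have hc : ∀ c, ∃ σ : Equiv.Perm X, ∀ x y, M.Adj x y → χ (x, y) = c → σ x = y := by
    intro c
    -- The directed edges of one colour form an injective partial map `f` with domain `s`, which
    -- extends to a permutation by finiteness.
    let s : Finset X := Finset.univ.filter fun x => ∃ y, M.Adj x y ∧ χ (x, y) = c
    let f : X → X := fun x => if h : ∃ y, M.Adj x y ∧ χ (x, y) = c then h.choose else x
    have hf : ∀ x ∈ s, M.Adj x (f x) ∧ χ (x, f x) = c := by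
      intro x hx
      have h : ∃ y, M.Adj x y ∧ χ (x, y) = c := by simpa [s] using hx
      simp only [f, dif_pos h]
      exact h.choose_spec
    have hinj : Set.InjOn f s := by
      intro x hx y hy hxy
      by_contra hne
      have h1 := hf x hx
      have h2 := hf y hy
      refine hχ (x, f x) (y, f y) ⟨fun h => hne (congrArg Prod.fst h), h1.1, h2.1, Or.inr hxy⟩ ?_
      rw [h1.2, h2.2]
    obtain ⟨g, hg⟩ := Finset.exists_equiv_extend_of_card_eq (t := (Finset.univ : Finset X))
      (by rw [Finset.card_univ]) (Finset.subset_univ _) hinj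
    refine ⟨g.trans (Equiv.subtypeUnivEquiv Finset.mem_univ), fun x y hxy hxc => ?_⟩
    have hx : x ∈ s := by simp only [s, Finset.mem_filter, Finset.mem_univ, true_and]; exact ⟨y, hxy, hxc⟩
    change (g x : X) = y
    rw [hg x hx]
    by_contra hne
    have h1 := hf x hx
    refine hχ (x, f x) (x, y) ⟨fun h => hne (congrArg Prod.snd h), h1.1, hxy, Or.inl rfl⟩ ?_
    rw [h1.2, hxc]
  choose σ hσ using hc
  exact ⟨σ, fun x y h => ⟨χ (x, y), hσ _ x y h rfl⟩⟩

/-! ### Expansion -/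

theorem SwitchingNetwork.sum_iterAvg {X : Type*} [Fintype X] (N : SwitchingNetwork X) (h : X → ℝ)
    (t : ℕ) : ∑ x, iterAvg N.swap h t x = ∑ x, h x := by
  induction t with
  | zero => rfl
  | succ t ih =>
    simp only [iterAvg_succ]
    rw [← Finset.sum_div, Finset.sum_add_distrib, Equiv.sum_comp (N.swap t), ih]
    ring

/-- Averaging is an ℓ¹ contraction, so errors only accumulate: step `s` adds half the variation of
`f s` along the involution and the change from `f s` to `f (s + 1)`. -/
theorem SwitchingNetwork.sum_abs_iterAvg_sub_le {X : Type*} [Fintype X] (N : SwitchingNetwork X)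
    (f : ℕ → X → ℝ) (t : ℕ) :
    ∑ x, |iterAvg N.swap (f 0) t x - f t x| ≤ ∑ s ∈ Finset.range t,
      ((∑ x, |f s (N.swap s x) - f s x|) / 2 + ∑ x, |f s x - f (s + 1) x|) := by
  induction t with
  | zero => simp [iterAvg]
  | succ t ih =>
    rw [Finset.sum_range_succ]
    have h1 : ∀ x, |iterAvg N.swap (f 0) (t + 1) x - f (t + 1) x| ≤
        (|iterAvg N.swap (f 0) t x - f t x| +
          |iterAvg N.swap (f 0) t (N.swap t x) - f t (N.swap t x)|) / 2 +
        (|f t (N.swap t x) - f t x| / 2 + |f t x - f (t + 1) x|) := by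
      intro x
      rw [iterAvg_succ]
      generalize iterAvg N.swap (f 0) t x = r1
      generalize iterAvg N.swap (f 0) t (N.swap t x) = r2
      generalize f t x = r3
      generalize f t (N.swap t x) = r4
      generalize f (t + 1) x = r5
      have e : (r1 + r2) / 2 - r5 = ((r1 - r3) + (r2 - r4)) / 2 + ((r4 - r3) / 2 + (r3 - r5)) := by
        ring
      rw [e]
      refine (abs_add_le _ _).trans (add_le_add ?_ ((abs_add_le _ _).trans (add_le_add ?_ le_rfl)))
      · rw [abs_div, abs_two]
        gcongr
        exact abs_add_le _ _
      · rw [abs_div, abs_two]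
    refine (Finset.sum_le_sum fun x _ => h1 x).trans ?_
    rw [Finset.sum_add_distrib, Finset.sum_add_distrib, ← Finset.sum_div, ← Finset.sum_div,
      Finset.sum_add_distrib,
      Equiv.sum_comp (N.swap t) fun x => |iterAvg N.swap (f 0) t x - f t x|]
    linarith

/-- A time-dependent two-colouring whose initial value is balanced has many changes in time and along
the involutions of the network. -/
theorem SwitchingNetwork.expansion {X : Type*} [Fintype X] (N : SwitchingNetwork X)
    (v : ℕ → X → ZMod 2) :
    ∃ ε : ZMod 2, 2 * (Finset.univ.filter fun x => v 0 x ≠ ε).card ≤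
      ∑ s ∈ Finset.range N.depth, ((Finset.univ.filter fun x => v s (N.swap s x) ≠ v s x).card +
        2 * (Finset.univ.filter fun x => v s x ≠ v (s + 1) x).card) := by
  classical
  let r : ZMod 2 → ℝ := fun b => if b = 0 then 0 else 1
  have h01 : ∀ b : ZMod 2, b = 0 ∨ b = 1 := by decide
  have hr : ∀ a b : ZMod 2, |r a - r b| = if a ≠ b then 1 else 0 := by
    intro a b
    rcases h01 a with rfl | rfl <;> rcases h01 b with rfl | rfl <;> simp [r]
  have hcount : ∀ v w : X → ZMod 2, ∑ x, |r (v x) - r (w x)| =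
      ((Finset.univ.filter fun x => v x ≠ w x).card : ℝ) := by
    intro v w
    simp only [hr, Finset.sum_boole]
  have hmain := N.sum_abs_iterAvg_sub_le (fun t x => r (v t x)) N.depth
  simp only [hcount] at hmain
  obtain ⟨c, hc⟩ := N.mixing (fun x => r (v 0 x))
  have hsum := N.sum_iterAvg (fun x => r (v 0 x)) N.depth
  simp only [hc] at hsum hmain
  have h0 : ∑ x, r (v 0 x) = ((Finset.univ.filter fun x => v 0 x ≠ 0).card : ℝ) := by
    have hr0 : ∀ b, r b = if b ≠ 0 then 1 else 0 := by
      intro b; simp only [r]; split_ifs <;> simp_all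
    simp only [hr0, Finset.sum_boole]
  have h1 : ∑ x, (1 - r (v 0 x)) = ((Finset.univ.filter fun x => v 0 x ≠ 1).card : ℝ) := by
    have hr1 : ∀ b : ZMod 2, 1 - r b = if b ≠ 1 then 1 else 0 := by
      intro b; rcases h01 b with rfl | rfl <;> simp [r]
    simp only [hr1, Finset.sum_boole]
  rw [Finset.sum_sub_distrib, Finset.sum_const, nsmul_one] at h1
  rw [Finset.sum_const, nsmul_eq_mul] at hsum
  -- The final average is the constant `c`, the fraction of points of colour `1` at time `0`, while
  -- the colouring at the final time is 0-1 valued: every point is off by at least the minimum of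
  -- `c` and `1 - c`.
  have hlow : ∀ m : ℝ, m ≤ c → m ≤ 1 - c →
      (Finset.univ : Finset X).card * m ≤ ∑ x, |c - r (v N.depth x)| := by
    intro m h1 h2
    rw [← nsmul_eq_mul]
    apply Finset.card_nsmul_le_sum
    intro x _
    simp only [r]
    split_ifs
    · rw [sub_zero]; exact h1.trans (le_abs_self _)
    · rw [abs_sub_comm]; exact h2.trans (le_abs_self _)
  have hfin : ∀ k : ℕ, (k : ℝ) ≤ ∑ x, |c - r (v N.depth x)| → 2 * k ≤
      ∑ s ∈ Finset.range N.depth, ((Finset.univ.filter fun x => v s (N.swap s x) ≠ v s x).card +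
        2 * (Finset.univ.filter fun x => v s x ≠ v (s + 1) x).card) := by
    intro k hk
    have h2 := mul_le_mul_of_nonneg_left (hk.trans hmain) (zero_le_two (α := ℝ))
    rw [Finset.mul_sum] at h2
    rw [← Nat.cast_le (α := ℝ)]
    push_cast
    refine h2.trans (le_of_eq (Finset.sum_congr rfl fun s _ => ?_))
    ring
  -- `ε` is a majority colour at time `0`.
  rcases le_total c (1 - c) with h | h
  · refine ⟨0, hfin _ ?_⟩
    rw [← h0, ← hsum]
    exact hlow c le_rfl h
  · refine ⟨1, hfin _ ?_⟩
    rw [← h1, ← hsum]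
    have := hlow (1 - c) h le_rfl
    rw [mul_sub, mul_one] at this
    exact this


/-! ### The auxiliary graph -/

/-- Every two-colouring of the vertices, up to exchanging the colours, has a boundary that is at least
as large as the number of points of `X` of nonzero colour; edges are counted twice. -/
def ExpandsFrom {V X : Type*} [Fintype V] [Fintype X] (G : SimpleGraph V) (ι : X → V) : Prop :=
  ∀ u : V → ZMod 2, ∃ ε : ZMod 2, 2 * (Finset.univ.filter fun x => u (ι x) ≠ ε).card ≤
    {p : V × V | G.Adj p.1 p.2 ∧ u p.1 ≠ u p.2}.ncard

namespace SwitchingNetwork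

variable {X C : Type*} (N : SwitchingNetwork X) (p : C → ℕ → Equiv.Perm X)

/-- The graph of one layer: the involution of the layer, and the partially routed permutations. -/
def layer (t : Fin (N.depth + 1)) : SimpleGraph X :=
  SimpleGraph.fromRel fun x y => ((t : ℕ) < N.depth ∧ y = N.swap t x) ∨ ∃ c, y = p c t x

theorem lazyAdj_layer_swap {t : ℕ} (ht : t < N.depth) (x : X) :
    LazyAdj (N.layer p ⟨t, by omega⟩) x (N.swap t x) := by
  by_cases h : x = N.swap t x
  · exact Or.inl h
  · exact Or.inr ((SimpleGraph.fromRel_adj _ _ _).2 ⟨h, Or.inl (Or.inl ⟨ht, rfl⟩)⟩)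

theorem lazyAdj_layer_perm {t : ℕ} (ht : t ≤ N.depth) (c : C) (x : X) :
    LazyAdj (N.layer p ⟨t, by omega⟩) x (p c t x) := by
  by_cases h : x = p c t x
  · exact Or.inl h
  · exact Or.inr ((SimpleGraph.fromRel_adj _ _ _).2 ⟨h, Or.inl (Or.inr ⟨c, rfl⟩)⟩)

/-- One neighbour from the involution, and two from each permutation because edges are undirected.
-/
theorem degreeLE_layer [Fintype C] (t : Fin (N.depth + 1)) :
    DegreeLE (N.layer p t) (1 + 2 * Fintype.card C) := by
  classical
  intro x
  refine ⟨{N.swap t x} ∪ (Finset.univ.image (fun c => p c t x) ∪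
    Finset.univ.image (fun c => (p c t).symm x)), ?_, ?_⟩
  · have h1 := Finset.card_image_le (s := Finset.univ) (f := fun c => p c t x)
    have h2 := Finset.card_image_le (s := Finset.univ) (f := fun c => (p c t).symm x)
    rw [Finset.card_univ] at h1 h2
    refine (Finset.card_union_le _ _).trans (Nat.add_le_add (Finset.card_singleton _).le
      ((Finset.card_union_le _ _).trans ?_))
    omega
  · intro y hy
    obtain ⟨_, (⟨_, h⟩ | ⟨c, h⟩) | (⟨_, h⟩ | ⟨c, h⟩)⟩ := (SimpleGraph.fromRel_adj _ _ _).1 hy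
    · simp [h]
    · simp [h]
    · simp [h, N.swap_swap]
    · have : (p c t).symm x = y := by rw [h, Equiv.symm_apply_apply]
      simp [← this]

theorem _root_.Surgery.LazyAdj.sup_left {V : Type*} {G : SimpleGraph V} (G' : SimpleGraph V)
    {u v : V} (h : LazyAdj G u v) : LazyAdj (G ⊔ G') u v := h.imp id Or.inl

theorem _root_.Surgery.LazyAdj.sup_right {V : Type*} {G : SimpleGraph V} (G' : SimpleGraph V)
    {u v : V} (h : LazyAdj G u v) : LazyAdj (G' ⊔ G) u v := h.imp id Or.inr

theorem _root_.Surgery.LazyAdj.symm {V : Type*} {G : SimpleGraph V}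
    {u v : V} (h : LazyAdj G u v) : LazyAdj G v u := h.imp Eq.symm SimpleGraph.Adj.symm

/-- The commutation squares of layers `s` and `t` lie in cell `(s, t)` and give a potential for the
involutions. It also serves the routed permutations, by induction on the layer: `p c (t + 1) x`
equals `p c t x`, or closes a triangle with the edges from `x` to `swap t x` and on by `p c t`, and
this triangle lies in cell `(t, t + 1)`. -/
theorem filled_crossbar_layer (hp0 : ∀ c, p c 0 = 1)
    (hp : ∀ c, ∀ t < N.depth, ∀ x, p c (t + 1) x = p c t x ∨ p c (t + 1) x = p c t (N.swap t x)) :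
    Filled (crossbar (SimpleGraph.pathGraph (N.depth + 1)) (N.layer p)) := by
  refine filled_crossbar (SimpleGraph.pathGraph_preconnected _) (filled_pathGraph _) ?_
  intro a ha h0 hsq
  obtain ⟨f, hf⟩ := N.filled a ha (by
    intro s hs t ht x
    refine hsq ⟨s, by omega⟩ ⟨t, by omega⟩ _ _ _ _ ?_ ?_ ?_ ?_
    · exact (N.lazyAdj_layer_swap p hs x).sup_left _
    · exact (N.lazyAdj_layer_swap p ht _).sup_right _
    · rw [← N.swap_comm]
      exact (N.lazyAdj_layer_swap p hs _).symm.sup_left _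
    · exact (N.lazyAdj_layer_swap p ht _).symm.sup_right _)
  have key : ∀ c, ∀ t ≤ N.depth, ∀ x, a x (p c t x) = f x + f (p c t x) := by
    intro c t
    induction t with
    | zero => intro _ x; rw [hp0, Equiv.Perm.one_apply, h0, CharTwo.add_self_eq_zero]
    | succ t ih =>
      intro ht x
      rcases hp c t (by omega) x with h | h
      · rw [h, ih (by omega)]
      · have h1 := hsq ⟨t, by omega⟩ ⟨t + 1, by omega⟩ x (N.swap t x) (p c (t + 1) x)
          (p c (t + 1) x) ((N.lazyAdj_layer_swap p (by omega) x).sup_left _)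
          (by rw [h]; exact (N.lazyAdj_layer_perm p (by omega) c _).sup_left _) (Or.inl rfl)
          ((N.lazyAdj_layer_perm p ht c _).symm.sup_right _)
        have h2 := ih (by omega) (N.swap t x)
        rw [← h] at h2
        rw [hf t (by omega), h2, h0, ha (p c (t + 1) x)] at h1
        have h8 : ∀ r r1 r2 r3 : ZMod 2, r1 + r2 + (r2 + r3) + 0 + r = 0 → r = r1 + r3 := by decide
        exact h8 _ _ _ _ h1
  refine ⟨f, fun t x y h => ?_⟩
  have ht := t.2
  obtain ⟨_, (⟨h1, h⟩ | ⟨c, h⟩) | (⟨h1, h⟩ | ⟨c, h⟩)⟩ := (SimpleGraph.fromRel_adj _ _ _).1 h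
  · rw [h, hf _ h1]
  · rw [h, key _ _ (by omega)]
  · rw [h, ha, hf _ h1, add_comm]
  · rw [h, ha, key _ _ (by omega), add_comm]

theorem preconnected_crossbar_layer :
    (crossbar (SimpleGraph.pathGraph (N.depth + 1)) (N.layer p)).Preconnected := by
  refine preconnected_crossbar (SimpleGraph.pathGraph_preconnected _) ?_
  intro D hD x y hx
  rw [← N.const_of_invariant D (fun t ht x => ?_) x y]
  · exact hx
  · rcases N.lazyAdj_layer_swap p ht x with h | h
    · rw [← h]
    · exact propext (hD _ _ _ h).symm

/-- Follow the line of cells from `(0, last)`, where the ports sit, to `(last, last)`. The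
involution of layer `t` is active in its cell `t`, so a vertex colouring restricted to this line is
a time-dependent colouring of `X` and `SwitchingNetwork.expansion` applies. -/
theorem expandsFrom_crossbar_layer [Fintype X] :
    ExpandsFrom (crossbar (SimpleGraph.pathGraph (N.depth + 1)) (N.layer p))
      (fun x => (x, (0, Fin.last _))) := by
  classical
  intro u
  -- `Fin.ofNat` reduces its argument, but only `t ≤ N.depth` occurs, as `hcell` records.
  let cell : ℕ → Fin (N.depth + 1) × Fin (N.depth + 1) := fun t => (Fin.ofNat _ t, Fin.last _)
  have hcell : ∀ t (ht : t ≤ N.depth), cell t = (⟨t, by omega⟩, Fin.last _) := by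
    intro t ht
    simp only [cell, Prod.mk.injEq, and_true]
    exact Fin.ext (Nat.mod_eq_of_lt (by omega))
  obtain ⟨ε, hε⟩ := N.expansion (fun t x => u (x, cell t))
  refine ⟨ε, hε.trans ?_⟩
  let S₁ : Finset (ℕ × X) := ((Finset.range N.depth) ×ˢ Finset.univ).filter
    fun z => u (N.swap z.1 z.2, cell z.1) ≠ u (z.2, cell z.1)
  let S₂ : Finset (ℕ × X) := ((Finset.range N.depth) ×ˢ Finset.univ).filter
    fun z => u (z.2, cell z.1) ≠ u (z.2, cell (z.1 + 1))
  have hS₁ : S₁.card = ∑ s ∈ Finset.range N.depth,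
      (Finset.univ.filter fun x => u (N.swap s x, cell s) ≠ u (x, cell s)).card := by
    simp only [S₁, Finset.card_filter, Finset.sum_product]
  have hS₂ : S₂.card = ∑ s ∈ Finset.range N.depth,
      (Finset.univ.filter fun x => u (x, cell s) ≠ u (x, cell (s + 1))).card := by
    simp only [S₂, Finset.card_filter, Finset.sum_product]
  rw [Finset.sum_add_distrib, ← Finset.mul_sum, ← hS₁, ← hS₂]
  -- Involution edges are listed once from each end, as `x` runs over all of `X`; grid edges are
  -- listed explicitly in both directions. This matches the count of ordered pairs.
  let F : (ℕ × X) ⊕ ((ℕ × X) ⊕ (ℕ × X)) → _ := Sum.elim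
    (fun z => ((z.2, cell z.1), (N.swap z.1 z.2, cell z.1)))
    (Sum.elim (fun z => ((z.2, cell z.1), (z.2, cell (z.1 + 1))))
      (fun z => ((z.2, cell (z.1 + 1)), (z.2, cell z.1))))
  have hcard : S₁.card + 2 * S₂.card =
      ((S₁.disjSum (S₂.disjSum S₂) : Finset ((ℕ × X) ⊕ ((ℕ × X) ⊕ (ℕ × X)))) :
        Set ((ℕ × X) ⊕ ((ℕ × X) ⊕ (ℕ × X)))).ncard := by
    rw [Set.ncard_coe_finset, Finset.card_disjSum, Finset.card_disjSum]
    ring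
  rw [hcard]
  refine Set.ncard_le_ncard_of_injOn F ?_ ?_ (Set.toFinite _)
  · intro z hz
    rw [Finset.mem_coe, Finset.mem_disjSum] at hz
    simp only [Finset.mem_disjSum] at hz
    rcases hz with ⟨⟨t, x⟩, hz, rfl⟩ | ⟨_, ⟨⟨t, x⟩, hz, rfl⟩ | ⟨⟨t, x⟩, hz, rfl⟩, rfl⟩
    · simp only [S₁, Finset.mem_filter, Finset.mem_product, Finset.mem_range] at hz
      refine ⟨?_, hz.2.symm⟩
      simp only [F, Sum.elim_inl, hcell t hz.1.1.le]
      rcases N.lazyAdj_layer_swap p hz.1.1 x with h | h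
      · exact absurd (by rw [← h]) hz.2
      · exact crossbar_left h
    · simp only [S₂, Finset.mem_filter, Finset.mem_product, Finset.mem_range] at hz
      refine ⟨?_, hz.2⟩
      simp only [F, Sum.elim_inl, Sum.elim_inr, hcell t hz.1.1.le, hcell (t + 1) hz.1.1]
      exact crossbar_grid (by simp [SimpleGraph.pathGraph_adj])
    · simp only [S₂, Finset.mem_filter, Finset.mem_product, Finset.mem_range] at hz
      refine ⟨?_, hz.2.symm⟩
      simp only [F, Sum.elim_inr, hcell t hz.1.1.le, hcell (t + 1) hz.1.1]
      exact crossbar_grid (by simp [SimpleGraph.pathGraph_adj])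
  · have hinj : ∀ s t, s ≤ N.depth → t ≤ N.depth → cell s = cell t → s = t := by
      intro s t hs ht h
      rw [hcell s hs, hcell t ht, Prod.mk.injEq, Fin.mk.injEq] at h
      exact h.1
    intro z hz w hw h
    rw [Finset.mem_coe, Finset.mem_disjSum] at hz hw
    simp only [Finset.mem_disjSum] at hz hw
    rcases hz with ⟨⟨t, x⟩, hz, rfl⟩ | ⟨_, ⟨⟨t, x⟩, hz, rfl⟩ | ⟨⟨t, x⟩, hz, rfl⟩, rfl⟩ <;>
    rcases hw with ⟨⟨s, y⟩, hw, rfl⟩ | ⟨_, ⟨⟨s, y⟩, hw, rfl⟩ | ⟨⟨s, y⟩, hw, rfl⟩, rfl⟩ <;>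
    simp only [S₁, S₂, Finset.mem_filter, Finset.mem_product, Finset.mem_range] at hz hw <;>
    simp only [F, Sum.elim_inl, Sum.elim_inr, Prod.mk.injEq] at h <;>
    obtain ⟨⟨h1, h2⟩, h3, h4⟩ := h
    · rw [h1, hinj _ _ hz.1.1.le hw.1.1.le h2]
    · have e1 := hinj _ _ hz.1.1.le hw.1.1.le h2
      have e2 := hinj _ _ hz.1.1.le hw.1.1 h4
      omega
    · have e1 := hinj _ _ hz.1.1.le hw.1.1 h2
      have e2 := hinj _ _ hz.1.1.le hw.1.1.le h4
      omega
    · have e1 := hinj _ _ hz.1.1.le hw.1.1.le h2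
      have e2 := hinj _ _ hz.1.1 hw.1.1.le h4
      omega
    · rw [h1, hinj _ _ hz.1.1.le hw.1.1.le h2]
    · have e1 := hinj _ _ hz.1.1.le hw.1.1 h2
      have e2 := hinj _ _ hz.1.1 hw.1.1.le h4
      omega
    · have e1 := hinj _ _ hz.1.1 hw.1.1.le h2
      have e2 := hinj _ _ hz.1.1.le hw.1.1.le h4
      omega
    · have e1 := hinj _ _ hz.1.1 hw.1.1.le h2
      have e2 := hinj _ _ hz.1.1.le hw.1.1 h4
      omega
    · rw [h1, hinj _ _ hz.1.1.le hw.1.1.le h4]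

end SwitchingNetwork

/-- The properties of an auxiliary graph on which the code deformation relies: it has bounded degree,
its cycles are generated by closed walks of length four, it contains the graph `M` on the ports and
expands from the ports. -/
structure IsGadget {V X : Type*} [Fintype V] [Fintype X] (M : SimpleGraph X) (G : SimpleGraph V)
    (ι : X → V) (D : ℕ) : Prop where
  injective : Function.Injective ι
  connected : G.Connected
  filled : Filled G
  degreeLE : DegreeLE G D
  adj : ∀ x y, M.Adj x y → G.Adj (ι x) (ι y)
  expands : ExpandsFrom G ι

theorem IsGadget.comap {V W X : Type*} [Fintype V] [Fintype W] [Fintype X] {M : SimpleGraph X}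
    {G : SimpleGraph V} {ι : X → V} {D : ℕ} (h : IsGadget M G ι D) (e : W ≃ V) :
    IsGadget M (G.comap e) (e.symm ∘ ι) D where
  injective := e.symm.injective.comp h.injective
  connected := (SimpleGraph.Iso.connected_iff (SimpleGraph.Iso.comap e G)).2 h.connected
  filled := by
    intro a ha h0 hsq
    obtain ⟨f, hf⟩ := h.filled (fun u v => a (e.symm u) (e.symm v)) (fun _ _ => ha _ _)
      (fun _ => h0 _) (by
        have hl : ∀ u v, LazyAdj G u v → LazyAdj (G.comap e) (e.symm u) (e.symm v) := by
          rintro u v (rfl | h)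
          · exact Or.inl rfl
          · exact Or.inr (by simpa using h)
        intro _ _ _ _ h1 h2 h3 h4
        exact hsq _ _ _ _ (hl _ _ h1) (hl _ _ h2) (hl _ _ h3) (hl _ _ h4))
    refine ⟨f ∘ e, fun u v huv => ?_⟩
    have := hf (e u) (e v) huv
    simpa using this
  degreeLE := by
    intro v
    obtain ⟨S, hS, hS'⟩ := h.degreeLE (e v)
    refine ⟨S.map e.symm.toEmbedding, by simpa using hS, fun w hw => ?_⟩
    rw [Finset.mem_map]
    exact ⟨e w, hS' _ hw, by simp⟩
  adj x y hxy := by simpa using h.adj x y hxy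
  expands := by
    intro u
    obtain ⟨ε, hε⟩ := h.expands (u ∘ e.symm)
    refine ⟨ε, hε.trans ?_⟩
    refine Set.ncard_le_ncard_of_injOn (fun p => (e.symm p.1, e.symm p.2)) ?_ ?_ (Set.toFinite _)
    · rintro ⟨p, q⟩ ⟨h1, h2⟩
      exact ⟨by simpa using h1, h2⟩
    · rintro ⟨p, q⟩ _ ⟨p', q'⟩ _ h
      simpa using h

/-- Take the crossbar over a path of `2k + 1` layers, with the `2Δ + 1` permutations covering `M`
routed through them. The degree bound adds two path directions of degree at most 2 and two active
layers of degree at most `1 + 2 * (2Δ + 1)`. -/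
theorem exists_gadget (Δ k : ℕ) : ∃ (X : Type) (_ : Fintype X), Fintype.card X = 2 ^ k ∧
    ∀ M : SimpleGraph X, DegreeLE M Δ →
      ∃ (G : SimpleGraph (Fin (2 ^ k * (2 * k + 1) ^ 2))) (ι : X → _),
        IsGadget M G ι (2 * 2 + 2 * (1 + 2 * (2 * Δ + 1))) := by
  obtain ⟨X, _, N, hX, hN⟩ := exists_switchingNetwork k
  refine ⟨X, inferInstance, hX, fun M hM => ?_⟩
  obtain ⟨σ, hσ⟩ := exists_covering_perms M hM
  choose p hp0 hp1 hp using fun c => N.routing (σ c)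
  have hne : Nonempty X := Fintype.card_pos_iff.1 (by rw [hX]; positivity)
  have hgad : IsGadget M (crossbar (SimpleGraph.pathGraph (N.depth + 1)) (N.layer p))
      (fun x => (x, (0, Fin.last _))) (2 * 2 + 2 * (1 + 2 * (2 * Δ + 1))) :=
    { injective := fun x y h => congrArg Prod.fst h
      connected := SimpleGraph.connected_iff _ |>.2
        ⟨N.preconnected_crossbar_layer p, inferInstance⟩
      filled := N.filled_crossbar_layer p hp0 hp
      degreeLE := by
        have := degreeLE_crossbar (degreeLE_pathGraph (N.depth + 1)) (N.degreeLE_layer p)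
        rwa [Fintype.card_fin] at this
      -- The second index of the port cell activates the last layer, where each routing has become
      -- the full permutation `σ c`.
      adj := by
        intro x y hxy
        apply crossbar_right
        obtain ⟨c, rfl⟩ := hσ x y hxy
        exact (SimpleGraph.fromRel_adj _ _ _).2
          ⟨hxy.ne, Or.inl (Or.inr ⟨c, by rw [Fin.val_last, hp1]⟩)⟩
      expands := N.expandsFrom_crossbar_layer p }
  have hcard : Fintype.card (X × (Fin (N.depth + 1) × Fin (N.depth + 1))) =
      2 ^ k * (2 * k + 1) ^ 2 := by
    rw [Fintype.card_prod, Fintype.card_prod, Fintype.card_fin, hX, hN, sq]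
  exact ⟨_, _, hgad.comap (Fintype.equivFinOfCardEq hcard).symm⟩


/-! ### Symplectic linear algebra -/

/-- Rank-nullity on a subspace, in the form that permits peeling off one coordinate projection after
the other. -/
theorem finrank_eq_finrank_map_add {K V W : Type*} [Field K] [AddCommGroup V] [Module K V]
    [AddCommGroup W] [Module K W] [FiniteDimensional K V] (f : V →ₗ[K] W) (D : Submodule K V) :
    Module.finrank K D = Module.finrank K (D.map f) + Module.finrank K (D ⊓ f.ker : Submodule K V) := by
  rw [← LinearMap.finrank_range_add_finrank_ker (f.domRestrict D), LinearMap.range_domRestrict,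
    LinearMap.ker_domRestrict]
  congr 1
  rw [(Submodule.equivSubtypeMap D (f.ker.comap D.subtype)).finrank_eq,
    Submodule.map_comap_subtype]

/-- The pair `(φ, ψ)` kills `W` and maps `P`, `R` to the standard basis. -/
theorem finrank_sup_span_pair {V : Type*} [AddCommGroup V] [Module (ZMod 2) V]
    [FiniteDimensional (ZMod 2) V] (W : Submodule (ZMod 2) V) {P R : V}
    (φ ψ : V →ₗ[ZMod 2] ZMod 2) (hφ : ∀ x ∈ W, φ x = 0) (hψ : ∀ x ∈ W, ψ x = 0)
    (hφP : φ P ≠ 0) (hφR : φ R = 0) (hψR : ψ R ≠ 0) (hψP : ψ P = 0) :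
    Module.finrank (ZMod 2) (W ⊔ Submodule.span (ZMod 2) {P, R} : Submodule (ZMod 2) V) =
      Module.finrank (ZMod 2) W + 2 := by
  have hone : ∀ a : ZMod 2, a ≠ 0 → a = 1 := by decide
  have hφP' := hone _ hφP
  have hψR' := hone _ hψR
  rw [finrank_eq_finrank_map_add (φ.prod ψ), add_comm]
  have h1 : (W ⊔ Submodule.span (ZMod 2) {P, R}).map (φ.prod ψ) = ⊤ := by
    rw [eq_top_iff]
    rintro ⟨a, b⟩ -
    refine ⟨a • P + b • R, Submodule.mem_sup_right (Submodule.mem_span_pair.2 ⟨a, b, rfl⟩), ?_⟩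
    simp [hφP', hφR, hψP, hψR']
  have h2 : (W ⊔ Submodule.span (ZMod 2) {P, R}) ⊓ (φ.prod ψ).ker = W := by
    apply le_antisymm
    · rintro x ⟨hx, hx'⟩
      obtain ⟨y, hy, z, hz, rfl⟩ := Submodule.mem_sup.1 hx
      obtain ⟨a, b, rfl⟩ := Submodule.mem_span_pair.1 hz
      have hx' : (φ (y + (a • P + b • R)), ψ (y + (a • P + b • R))) = (0, 0) := hx'
      rw [Prod.mk_inj] at hx'
      simp only [map_add, map_smul, hφ y hy, hψ y hy, hφP', hφR, hψP, hψR'] at hx'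
      simp only [smul_eq_mul, mul_one, mul_zero, add_zero, zero_add] at hx'
      rw [hx'.1, hx'.2, zero_smul, zero_smul, add_zero, add_zero]
      exact hy
    · refine le_inf le_sup_left fun x hx => ?_
      exact Prod.ext (hφ x hx) (hψ x hx)
  rw [h1, h2, finrank_top, Module.finrank_prod, Module.finrank_self]

theorem localSymp_comm (a b : ZMod 2 × ZMod 2) : localSymp a b = localSymp b a := by
  simp only [localSymp]; ring

@[simp] theorem localSymp_zero (a : ZMod 2 × ZMod 2) : localSymp a 0 = 0 := by simp [localSymp]

@[simp] theorem zero_localSymp (a : ZMod 2 × ZMod 2) : localSymp 0 a = 0 := by simp [localSymp]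

theorem localSymp_self (a : ZMod 2 × ZMod 2) : localSymp a a = 0 := by
  simp only [localSymp]
  rw [mul_comm a.2, CharTwo.add_self_eq_zero]

theorem localSymp_smul (c : ZMod 2) (a b : ZMod 2 × ZMod 2) :
    localSymp a (c • b) = c * localSymp a b := by
  simp only [localSymp, Prod.smul_fst, Prod.smul_snd, smul_eq_mul]; ring

/-- The symplectic form: `0` if two Pauli operators commute, `1` if they do not. -/
noncomputable def symp (Q : Type*) [Fintype Q] : LinearMap.BilinForm (ZMod 2) (Pauli Q) :=
  LinearMap.mk₂ (ZMod 2) (fun P R => ∑ q, localSymp (P q) (R q))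
    (fun P P' R => by
      rw [← Finset.sum_add_distrib]
      refine Finset.sum_congr rfl fun q _ => ?_
      simp only [localSymp, Pi.add_apply, Prod.fst_add, Prod.snd_add]; ring)
    (fun c P R => by
      rw [smul_eq_mul, Finset.mul_sum]
      refine Finset.sum_congr rfl fun q _ => ?_
      simp only [localSymp, Pi.smul_apply, Prod.smul_fst, Prod.smul_snd, smul_eq_mul]; ring)
    (fun P R R' => by
      rw [← Finset.sum_add_distrib]
      refine Finset.sum_congr rfl fun q _ => ?_
      simp only [localSymp, Pi.add_apply, Prod.fst_add, Prod.snd_add]; ring)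
    (fun c P R => by
      rw [smul_eq_mul, Finset.mul_sum]
      refine Finset.sum_congr rfl fun q _ => ?_
      simp only [localSymp, Pi.smul_apply, Prod.smul_fst, Prod.smul_snd, smul_eq_mul]; ring)

section Symp

variable {Q S : Type*} [Fintype Q] {H : S → Pauli Q}

theorem symp_apply (P R : Pauli Q) : symp Q P R = ∑ q, localSymp (P q) (R q) := rfl

theorem pauliCommute_iff (P R : Pauli Q) : PauliCommute P R ↔ symp Q P R = 0 := Iff.rfl

theorem symp_comm (P R : Pauli Q) : symp Q P R = symp Q R P :=
  Finset.sum_congr rfl fun _ _ => localSymp_comm _ _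

theorem symp_self (P : Pauli Q) : symp Q P P = 0 :=
  Finset.sum_eq_zero fun _ _ => localSymp_self _

theorem symp_eq_zero_of_nonOverlapping {P R : Pauli Q} (h : NonOverlapping P R) :
    symp Q P R = 0 := by
  refine Finset.sum_eq_zero fun q _ => ?_
  rcases h q with h | h <;> simp [h]

theorem symp_nondegenerate : (symp Q).Nondegenerate := by
  classical
  have h : ∀ P : Pauli Q, (∀ R, symp Q P R = 0) → P = 0 := by
    intro P hP
    funext q
    have h1 := hP (Pi.single q (1, 0))
    have h2 := hP (Pi.single q (0, 1))
    rw [symp_apply, Finset.sum_eq_single q (fun b _ hb => by simp [hb]) (by simp)] at h1 h2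
    simp only [Pi.single_eq_same, localSymp] at h1 h2
    exact Prod.ext (by simpa using h2) (by simpa using h1)
  exact ⟨h, fun P hP => h P fun R => by rw [symp_comm]; exact hP R⟩

/-- The space of logical operators. -/
noncomputable def logicals (H : S → Pauli Q) : Submodule (ZMod 2) (Pauli Q) :=
  (symp Q).orthogonal (stab H)

theorem symp_eq_zero_of_mem_stab {P R : Pauli Q} (hP : IsLogical H P) (hR : R ∈ stab H) :
    symp Q R P = 0 := by
  have : stab H ≤ ((symp Q).flip P).ker := by
    refine Submodule.span_le.2 ?_
    rintro _ ⟨s, rfl⟩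
    exact hP s
  exact this hR

theorem mem_logicals {P : Pauli Q} : P ∈ logicals H ↔ IsLogical H P := by
  rw [logicals, LinearMap.BilinForm.mem_orthogonal_iff]
  constructor
  · intro h s
    exact h _ (Submodule.subset_span ⟨s, rfl⟩)
  · intro h R hR
    exact symp_eq_zero_of_mem_stab h hR

theorem finrank_pauli : Module.finrank (ZMod 2) (Pauli Q) = 2 * Fintype.card Q := by
  rw [Module.finrank_pi_fintype]
  simp [Module.finrank_prod, mul_comm]

theorem finrank_logicals :
    (Module.finrank (ZMod 2) (logicals H) : ℤ) =
      2 * Fintype.card Q - Module.finrank (ZMod 2) (stab H) := by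
  rw [logicals, LinearMap.BilinForm.finrank_orthogonal symp_nondegenerate, finrank_pauli,
    Nat.cast_sub]
  · push_cast; ring
  · rw [← finrank_pauli]; exact Submodule.finrank_le _

theorem exists_nontrivialLogical (h : 0 < numLogical H) : ∃ P, IsNontrivialLogical H P := by
  by_contra! hne
  have hle : logicals H ≤ stab H := by
    intro P hP
    by_contra hP'
    exact hne P ⟨mem_logicals.1 hP, hP'⟩
  have h1 := Submodule.finrank_mono hle
  have h2 := finrank_logicals (H := H)
  simp only [numLogical] at h
  omega

theorem exists_isDistance (h : ∃ P, IsNontrivialLogical H P) : ∃ d, IsDistance H d := by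
  classical
  have hne : ∃ w, ∃ P, IsNontrivialLogical H P ∧ wt P = w := by
    obtain ⟨P, hP⟩ := h
    exact ⟨_, P, hP, rfl⟩
  exact ⟨Nat.find hne, Nat.find_spec hne, fun w hw => Nat.find_min' hne hw⟩

theorem stab_le_logicals (hH : IsStabilizerCode H) : stab H ≤ logicals H := by
  refine Submodule.span_le.2 ?_
  rintro _ ⟨s, rfl⟩
  exact mem_logicals.2 fun t => hH t s

theorem numLogical_pos (hH : IsStabilizerCode H) (h : ∃ P, IsNontrivialLogical H P) :
    0 < numLogical H := by
  obtain ⟨P, hP, hP'⟩ := h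
  have hlt : stab H < logicals H :=
    lt_of_le_of_ne (stab_le_logicals hH) fun h => hP' (h ▸ mem_logicals.2 hP)
  have h1 := Submodule.finrank_lt_finrank_of_lt hlt
  have h2 := finrank_logicals (H := H)
  simp only [numLogical]
  omega

/-- In a code with two logical qubits, a logical operator that commutes with the Pauli `Z` of the
first and the Pauli `X` of the second is generated by these two and stabilizers. -/
theorem mem_sup_of_commute (hH : IsStabilizerCode H) (h2 : numLogical H = 2) {Z X X₁ Z₂ : Pauli Q}
    (hZ : IsLogical H Z) (hX : IsLogical H X) (hX₁ : IsLogical H X₁) (hZ₂ : IsLogical H Z₂)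
    (hZX : symp Q Z X = 0) (h1Z : symp Q X₁ Z ≠ 0) (h1X : symp Q X₁ X = 0)
    (h2X : symp Q Z₂ X ≠ 0) (h2Z : symp Q Z₂ Z = 0) {P : Pauli Q} (hP : IsLogical H P)
    (hPZ : symp Q Z P = 0) (hPX : symp Q X P = 0) :
    P ∈ stab H ⊔ Submodule.span (ZMod 2) {Z, X} := by
  set W := stab H ⊔ Submodule.span (ZMod 2) {Z, X} with hW
  have hrank : Module.finrank (ZMod 2) W = Module.finrank (ZMod 2) (stab H) + 2 := by
    refine finrank_sup_span_pair _ (symp Q X₁) (symp Q Z₂) ?_ ?_ h1Z h1X h2X h2Z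
    · intro x hx; rw [symp_comm]; exact symp_eq_zero_of_mem_stab hX₁ hx
    · intro x hx; rw [symp_comm]; exact symp_eq_zero_of_mem_stab hZ₂ hx
  have hort : ∀ R, IsLogical H R → symp Q Z R = 0 → symp Q X R = 0 → R ∈ (symp Q).orthogonal W := by
    intro R hR hZR hXR
    rw [LinearMap.BilinForm.mem_orthogonal_iff]
    intro n hn
    obtain ⟨y, hy, z, hz, rfl⟩ := Submodule.mem_sup.1 hn
    obtain ⟨a, b, rfl⟩ := Submodule.mem_span_pair.1 hz
    simp only [map_add, map_smul, LinearMap.add_apply, LinearMap.smul_apply, hZR, hXR,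
      symp_eq_zero_of_mem_stab hR hy, smul_zero, add_zero]
  have hle : W ≤ (symp Q).orthogonal W := by
    refine sup_le ?_ (Submodule.span_le.2 ?_)
    · intro R hR
      have hR' := mem_logicals.1 (stab_le_logicals hH hR)
      refine hort R hR' ?_ ?_ <;> rw [symp_comm]
      · exact symp_eq_zero_of_mem_stab hZ hR
      · exact symp_eq_zero_of_mem_stab hX hR
    · rintro R (rfl | rfl)
      · exact hort _ hZ (symp_self _) (by rw [symp_comm]; exact hZX)
      · exact hort _ hX hZX (symp_self _)
  -- `W` is isotropic, and its dimension `(n - 2) + 2` is half of `2n`. So it is its own orthogonal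
  -- complement.
  have heq := Submodule.eq_of_le_of_finrank_le hle (by
    rw [LinearMap.BilinForm.finrank_orthogonal symp_nondegenerate, finrank_pauli, hrank]
    simp only [numLogical] at h2
    omega)
  rw [heq]
  exact hort P hP hPZ hPX

end Symp

section Weight

variable {Q Q' : Type*} [Fintype Q] [Fintype Q']

theorem wt_add_le (P R : Pauli Q) : wt (P + R) ≤ wt P + wt R := by
  classical
  refine (Finset.card_le_card ?_).trans (Finset.card_union_le _ _)
  intro q hq
  simp only [Finset.mem_union, Finset.mem_filter, Finset.mem_univ, true_and] at hq ⊢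
  by_contra! h
  exact hq (by rw [Pi.add_apply, h.1, h.2, add_zero])

theorem wt_sumElim (P : Pauli Q) (R : Pauli Q') : wt (Sum.elim P R : Pauli (Q ⊕ Q')) = wt P + wt R := by
  simp only [wt, Finset.card_filter, Fintype.sum_sum_type, Sum.elim_inl, Sum.elim_inr]
  rfl

theorem symp_sumElim (P P' : Pauli Q) (R R' : Pauli Q') :
    symp (Q ⊕ Q') (Sum.elim P R) (Sum.elim P' R') = symp Q P P' + symp Q' R R' := by
  simp only [symp_apply, Fintype.sum_sum_type, Sum.elim_inl, Sum.elim_inr]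

end Weight


/-! ### The deformed code -/

namespace AuxGraph

variable {Q S : Type*} [Fintype Q] {H : S → Pauli Q} {P R : Pauli Q}

/-- The incidence matrix of an auxiliary graph. -/
def inc (A : AuxGraph H P) : Matrix A.Edge (Fin A.n) (ZMod 2) := fun e v => A.star v e

/-- The coboundary of a set of vertices. -/
noncomputable def cobd (A : AuxGraph H P) : (Fin A.n → ZMod 2) →ₗ[ZMod 2] (A.Edge → ZMod 2) :=
  A.inc.mulVecLin

/-- The boundary of a set of edges. -/
noncomputable def bd (A : AuxGraph H P) : (A.Edge → ZMod 2) →ₗ[ZMod 2] (Fin A.n → ZMod 2) :=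
  A.inc.transpose.mulVecLin

/-- The edge set of a check. -/
def mat (A : AuxGraph H P) (s : S) : A.Edge → ZMod 2 := A.matching s

/-- A basis cycle. -/
def cyc (A : AuxGraph H P) (i : Fin A.numCycles) : A.Edge → ZMod 2 := A.cycle i

/-- The part of `P` that is attached to a set of vertices. -/
def part (A : AuxGraph H P) (u : Fin A.n → ZMod 2) : Pauli Q := fun q => u (A.port q) • P q

theorem cobd_apply (A : AuxGraph H P) (u : Fin A.n → ZMod 2) (e : A.Edge) :
    A.cobd u e = ∑ v, A.star v e * u v := rfl

theorem bd_apply (A : AuxGraph H P) (a : A.Edge → ZMod 2) (v : Fin A.n) :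
    A.bd a v = ∑ e, A.star v e * a e := rfl

theorem sum_mul_cobd (A : AuxGraph H P) (a : A.Edge → ZMod 2) (u : Fin A.n → ZMod 2) :
    ∑ e, a e * A.cobd u e = ∑ v, u v * A.bd a v := by
  simp only [cobd_apply, bd_apply, Finset.mul_sum]
  rw [Finset.sum_comm]
  refine Finset.sum_congr rfl fun v _ => Finset.sum_congr rfl fun e _ => ?_
  ring

theorem bd_eq_finsum (A : AuxGraph H P) (a : A.Edge → ZMod 2) (v : Fin A.n) :
    A.bd a v = ∑ᶠ e : A.graph.edgeSet, a e * incidence A.graph e v := by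
  rw [bd_apply]
  have h := finsum_eq_sum_of_fintype (α := A.Edge) fun e => A.star v e * a e
  rw [← h]
  exact finsum_congr fun e => mul_comm _ _

theorem bd_mat (A : AuxGraph H P) (s : S) (v : Fin A.n) :
    A.bd (A.mat s) v = ∑ q, if A.port q = v then localSymp (H s q) (P q) else 0 := by
  rw [bd_eq_finsum]
  exact A.matching_boundary s v

theorem mem_span_cyc (A : AuxGraph H P) (c : A.Edge → ZMod 2) :
    c ∈ Submodule.span (ZMod 2) (Set.range A.cyc) ↔ A.bd c = 0 := by
  rw [funext_iff]
  simp only [bd_eq_finsum]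
  exact A.span_cycle c

theorem bd_cyc (A : AuxGraph H P) (i : Fin A.numCycles) : A.bd (A.cyc i) = 0 :=
  (A.mem_span_cyc _).1 (Submodule.subset_span ⟨i, rfl⟩)

theorem part_apply (A : AuxGraph H P) (u : Fin A.n → ZMod 2) (q : Q) :
    A.part u q = u (A.port q) • P q := rfl

theorem part_add (A : AuxGraph H P) (u u' : Fin A.n → ZMod 2) :
    A.part (u + u') = A.part u + A.part u' := by
  funext q; simp [part_apply, add_smul]

theorem part_const (A : AuxGraph H P) (c : ZMod 2) : A.part (fun _ => c) = c • P := rfl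

theorem sum_smul_attached (A : AuxGraph H P) (u : Fin A.n → ZMod 2) :
    ∑ v, u v • A.attached v = A.part u := by
  funext q
  simp [Finset.sum_apply, attached, part_apply]

theorem attached_eq_part (A : AuxGraph H P) (v : Fin A.n) : A.attached v = A.part (Pi.single v 1) := by
  funext q
  simp only [attached, part_apply, Pi.single_apply]
  split_ifs <;> simp

theorem star_eq_cobd (A : AuxGraph H P) (v : Fin A.n) : A.star v = A.cobd (Pi.single v 1) := by
  funext e
  simp [cobd_apply, Pi.single_apply]

theorem symp_part (A : AuxGraph H P) (L : Pauli Q) (u : Fin A.n → ZMod 2) :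
    symp Q L (A.part u) = ∑ q, u (A.port q) * localSymp (L q) (P q) := by
  simp only [symp_apply, part_apply, localSymp_smul]

/-- The boundary condition on matchings in dual form. It makes the edge factors of a deformed check
compensate its local anticommutation with the vertex checks. -/
theorem symp_check_part (A : AuxGraph H P) (s : S) (u : Fin A.n → ZMod 2) :
    symp Q (H s) (A.part u) = ∑ v, u v * A.bd (A.mat s) v := by
  simp only [symp_part, bd_mat, Finset.mul_sum]
  rw [Finset.sum_comm]
  refine Finset.sum_congr rfl fun q _ => ?_
  simp

theorem symp_part_part (A : AuxGraph H P) (u u' : Fin A.n → ZMod 2) :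
    symp Q (A.part u) (A.part u') = 0 := by
  rw [symp_part]
  refine Finset.sum_eq_zero fun q _ => ?_
  rw [part_apply, localSymp_comm, localSymp_smul, localSymp_self, mul_zero, mul_zero]

theorem symp_part_part_of_nonOverlapping (hPR : NonOverlapping P R) (A : AuxGraph H P)
    (B : AuxGraph H R) (u : Fin A.n → ZMod 2) (w : Fin B.n → ZMod 2) :
    symp Q (A.part u) (B.part w) = 0 := by
  apply symp_eq_zero_of_nonOverlapping
  intro q
  rcases hPR q with h | h
  · left; rw [part_apply, h, smul_zero]
  · right; rw [part_apply, h, smul_zero]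

/-- The edge between two adjacent vertices. -/
def edge (A : AuxGraph H P) {x y : Fin A.n} (h : A.graph.Adj x y) : A.Edge :=
  (⟨s(x, y), h⟩ : A.graph.edgeSet)

theorem exists_edge (A : AuxGraph H P) (e : A.Edge) :
    ∃ (x y : Fin A.n) (h : A.graph.Adj x y), e = A.edge h := by
  obtain ⟨e, he⟩ := e
  induction e using Sym2.inductionOn with
  | hf x y => exact ⟨x, y, he, rfl⟩

theorem star_edge (A : AuxGraph H P) {x y : Fin A.n} (h : A.graph.Adj x y) (v : Fin A.n) :
    A.star v (A.edge h) = if v = x ∨ v = y then 1 else 0 := by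
  simp only [star, incidence, Matrix.of_apply, edge, Sym2.mem_iff]

theorem cobd_edge (A : AuxGraph H P) (u : Fin A.n → ZMod 2) {x y : Fin A.n} (h : A.graph.Adj x y) :
    A.cobd u (A.edge h) = u x + u y := by
  rw [cobd_apply]
  have hs : ∀ v, A.star v (A.edge h) * u v =
      (if v = x then u v else 0) + (if v = y then u v else 0) := by
    intro v
    rw [star_edge]
    by_cases h1 : v = x
    · have h2 : v ≠ y := h1 ▸ h.ne
      simp [h1, h.ne]
    · simp [h1]
  rw [Finset.sum_congr rfl fun v _ => hs v, Finset.sum_add_distrib]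
  simp

theorem cobd_const (A : AuxGraph H P) (c : ZMod 2) : A.cobd (fun _ => c) = 0 := by
  funext e
  obtain ⟨x, y, h, rfl⟩ := A.exists_edge e
  exact (A.cobd_edge _ h).trans (CharTwo.add_self_eq_zero _)

theorem eq_of_cobd_eq_zero (A : AuxGraph H P) {u : Fin A.n → ZMod 2} (h : A.cobd u = 0)
    (x y : Fin A.n) : u x = u y := by
  refine eq_of_adj_eq A.connected.preconnected u (fun x y hxy => ?_) x y
  have := A.cobd_edge u hxy
  rw [h] at this
  exact CharTwo.add_eq_zero.1 this.symm

/-- On a connected graph only constants have zero coboundary. Hence no proper part of `P` is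
measured. -/
theorem exists_part_of_cobd_eq_zero (A : AuxGraph H P) {u : Fin A.n → ZMod 2} (h : A.cobd u = 0) :
    ∃ c : ZMod 2, A.part u = c • P := by
  obtain ⟨v₀⟩ := A.connected.nonempty
  exact ⟨u v₀, by rw [← A.part_const]; congr 1; funext v; exact A.eq_of_cobd_eq_zero h _ _⟩

theorem bd_cobd_pair (A : AuxGraph H P) {a : A.Edge → ZMod 2} (ha : A.bd a = 0)
    (u : Fin A.n → ZMod 2) : ∑ e, a e * A.cobd u e = 0 := by
  rw [sum_mul_cobd, ha]; simp

/-- An edge set that meets all cycles evenly is a coboundary. -/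
theorem exists_cobd (A : AuxGraph H P) (a : A.Edge → ZMod 2)
    (h : ∀ c, A.bd c = 0 → ∑ e, c e * a e = 0) : ∃ u, A.cobd u = a := by
  classical
  let φ : Module.Dual (ZMod 2) (A.Edge → ZMod 2) :=
    { toFun := fun c => ∑ e, c e * a e
      map_add' := fun c c' => by simp only [Pi.add_apply, add_mul, Finset.sum_add_distrib]
      map_smul' := fun r c => by
        simp only [Pi.smul_apply, smul_eq_mul, RingHom.id_apply, Finset.mul_sum, mul_assoc] }
  -- Pairing with `a` annihilates the cycles, so it factors through the boundary map; the factor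
  -- `ψ`, evaluated at single vertices, is the required vertex set.
  have hφ : φ ∈ A.bd.ker.dualAnnihilator := by
    rw [Submodule.mem_dualAnnihilator]
    exact fun c hc => h c hc
  rw [← LinearMap.range_dualMap_eq_dualAnnihilator_ker] at hφ
  obtain ⟨ψ, hψ⟩ := hφ
  refine ⟨fun v => ψ (Pi.single v 1), ?_⟩
  funext e
  have h1 : φ (Pi.single e 1) = a e := by
    change ∑ e', (Pi.single e 1 : A.Edge → ZMod 2) e' * a e' = a e
    simp [Pi.single_apply]
  rw [← h1, ← hψ, LinearMap.dualMap_apply, cobd_apply]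
  have h2 : A.bd (Pi.single e 1) = ∑ v, A.star v e • (Pi.single v 1 : Fin A.n → ZMod 2) := by
    funext v
    rw [bd_apply]
    simp [Finset.sum_apply, Pi.single_apply]
  rw [h2, map_sum]
  simp only [map_smul, smul_eq_mul]

theorem finrank_cobd_add_finrank_bd (A : AuxGraph H P) :
    Module.finrank (ZMod 2) A.cobd.range + Module.finrank (ZMod 2) A.bd.ker =
      Fintype.card A.Edge := by
  have h1 := LinearMap.finrank_range_add_finrank_ker A.bd
  have h2 : Module.finrank (ZMod 2) A.bd.range = Module.finrank (ZMod 2) A.cobd.range :=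
    Matrix.rank_transpose A.inc
  rw [← h2, h1, Module.finrank_fintype_fun_eq_card]

end AuxGraph

/-! ### Stabilizers and logical operators of the deformed code in coordinates -/

section Deformed

variable {Q S : Type*} [Fintype Q] {H : S → Pauli Q} {P R : Pauli Q}
  (A : AuxGraph H P) (B : AuxGraph H R)

theorem withEdges_inj {L L' : Pauli Q} {a₁ a₂ a₁' a₂' : A.Edge → ZMod 2}
    {b₁ b₂ b₁' b₂' : B.Edge → ZMod 2} :
    withEdges A B L a₁ a₂ b₁ b₂ = withEdges A B L' a₁' a₂' b₁' b₂' ↔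
      L = L' ∧ a₁ = a₁' ∧ a₂ = a₂' ∧ b₁ = b₁' ∧ b₂ = b₂' := by
  constructor
  · intro h
    have h1 : ∀ q, L q = L' q := fun q => congrFun h (Sum.inl q)
    have h2 : ∀ e, (a₁ e, a₂ e) = (a₁' e, a₂' e) := fun e => congrFun h (Sum.inr (Sum.inl e))
    have h3 : ∀ e, (b₁ e, b₂ e) = (b₁' e, b₂' e) := fun e => congrFun h (Sum.inr (Sum.inr e))
    simp only [Prod.mk.injEq] at h2 h3
    exact ⟨funext h1, funext fun e => (h2 e).1, funext fun e => (h2 e).2,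
      funext fun e => (h3 e).1, funext fun e => (h3 e).2⟩
  · rintro ⟨rfl, rfl, rfl, rfl, rfl⟩; rfl

theorem exists_eq_withEdges (T : Pauli (DeformedQubit A B)) :
    ∃ L a₁ a₂ b₁ b₂, T = withEdges A B L a₁ a₂ b₁ b₂ := by
  refine ⟨fun q => T (Sum.inl q), fun e => (T (Sum.inr (Sum.inl e))).1,
    fun e => (T (Sum.inr (Sum.inl e))).2, fun e => (T (Sum.inr (Sum.inr e))).1,
    fun e => (T (Sum.inr (Sum.inr e))).2, ?_⟩
  funext q
  rcases q with q | e | e <;> rfl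

/-- `withEdges` as a linear map. -/
def withEdgesLin : (Pauli Q × ((A.Edge → ZMod 2) × (A.Edge → ZMod 2)) ×
    ((B.Edge → ZMod 2) × (B.Edge → ZMod 2))) →ₗ[ZMod 2] Pauli (DeformedQubit A B) where
  toFun x := withEdges A B x.1 x.2.1.1 x.2.1.2 x.2.2.1 x.2.2.2
  map_add' x y := by funext q; rcases q with q | e | e <;> rfl
  map_smul' c x := by funext q; rcases q with q | e | e <;> rfl

theorem sum_smul_withEdges {ι : Type*} [Fintype ι] (c : ι → ZMod 2) (L : ι → Pauli Q)
    (a₁ a₂ : ι → A.Edge → ZMod 2) (b₁ b₂ : ι → B.Edge → ZMod 2) :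
    ∑ i, c i • withEdges A B (L i) (a₁ i) (a₂ i) (b₁ i) (b₂ i) =
      withEdges A B (∑ i, c i • L i) (∑ i, c i • a₁ i) (∑ i, c i • a₂ i) (∑ i, c i • b₁ i)
        (∑ i, c i • b₂ i) := by
  have h := map_sum (withEdgesLin A B)
    (fun i => c i • ((L i, (a₁ i, a₂ i), (b₁ i, b₂ i)) : _ × (_ × _) × (_ × _))) Finset.univ
  simp only [map_smul] at h
  refine h.symm.trans ?_
  change withEdges A B _ _ _ _ _ = _
  rw [withEdges_inj]
  simp [Prod.fst_sum, Prod.snd_sum]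

theorem withEdges_add (L L' : Pauli Q) (a₁ a₂ a₁' a₂' : A.Edge → ZMod 2)
    (b₁ b₂ b₁' b₂' : B.Edge → ZMod 2) :
    withEdges A B L a₁ a₂ b₁ b₂ + withEdges A B L' a₁' a₂' b₁' b₂' =
      withEdges A B (L + L') (a₁ + a₁') (a₂ + a₂') (b₁ + b₁') (b₂ + b₂') := by
  funext q; rcases q with q | e | e <;> rfl

theorem symp_withEdges (L L' : Pauli Q) (a₁ a₂ a₁' a₂' : A.Edge → ZMod 2)
    (b₁ b₂ b₁' b₂' : B.Edge → ZMod 2) :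
    symp (DeformedQubit A B) (withEdges A B L a₁ a₂ b₁ b₂) (withEdges A B L' a₁' a₂' b₁' b₂') =
      symp Q L L' + ((∑ e, a₁ e * a₂' e + ∑ e, a₁' e * a₂ e) +
        (∑ e, b₁ e * b₂' e + ∑ e, b₁' e * b₂ e)) := by
  rw [withEdges, withEdges, symp_sumElim, symp_sumElim]
  congr 1
  congr 1 <;> rw [symp_apply, ← Finset.sum_add_distrib] <;>
    exact Finset.sum_congr rfl fun e _ => by simp only [localSymp]; ring

theorem deformedCode_check (s : S) :
    deformedCode A B (Sum.inl s) = withEdges A B (H s) (A.mat s) 0 0 (B.mat s) := rfl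

theorem deformedCode_left (v : Fin A.n) : deformedCode A B (Sum.inr (Sum.inl (Sum.inl v))) =
    withEdges A B (A.attached v) 0 (A.star v) 0 0 := rfl

theorem deformedCode_right (v : Fin B.n) : deformedCode A B (Sum.inr (Sum.inl (Sum.inr v))) =
    withEdges A B (B.attached v) 0 0 (B.star v) 0 := rfl

theorem deformedCode_cyc_left (i : Fin A.numCycles) :
    deformedCode A B (Sum.inr (Sum.inr (Sum.inl i))) = withEdges A B 0 (A.cyc i) 0 0 0 := rfl

theorem deformedCode_cyc_right (i : Fin B.numCycles) :
    deformedCode A B (Sum.inr (Sum.inr (Sum.inr i))) = withEdges A B 0 0 0 0 (B.cyc i) := rfl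

/-- The coefficients of checks and vertices determine everything except cycles: since the basis
cycles span the kernel of the boundary, their contribution is encoded by the two boundary equations.
-/
theorem mem_stab_deformedCode [Fintype S] (L : Pauli Q) (a₁ a₂ : A.Edge → ZMod 2)
    (b₁ b₂ : B.Edge → ZMod 2) :
    withEdges A B L a₁ a₂ b₁ b₂ ∈ stab (deformedCode A B) ↔
      ∃ (c : S → ZMod 2) (u : Fin A.n → ZMod 2) (w : Fin B.n → ZMod 2),
        L = ∑ s, c s • H s + A.part u + B.part w ∧ A.bd (a₁ + ∑ s, c s • A.mat s) = 0 ∧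
        a₂ = A.cobd u ∧ b₁ = B.cobd w ∧ B.bd (b₂ + ∑ s, c s • B.mat s) = 0 := by
  have key : ∀ c : DeformedCheck A B → ZMod 2, ∑ i, c i • deformedCode A B i =
      withEdges A B
        (∑ s, c (Sum.inl s) • H s + A.part (fun v => c (Sum.inr (Sum.inl (Sum.inl v)))) +
          B.part (fun v => c (Sum.inr (Sum.inl (Sum.inr v)))))
        (∑ s, c (Sum.inl s) • A.mat s + ∑ i, c (Sum.inr (Sum.inr (Sum.inl i))) • A.cyc i)
        (A.cobd fun v => c (Sum.inr (Sum.inl (Sum.inl v))))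
        (B.cobd fun v => c (Sum.inr (Sum.inl (Sum.inr v))))
        (∑ s, c (Sum.inl s) • B.mat s + ∑ i, c (Sum.inr (Sum.inr (Sum.inr i))) • B.cyc i) := by
    intro c
    have hstarA : ∑ v, c (Sum.inr (Sum.inl (Sum.inl v))) • A.star v =
        A.cobd fun v => c (Sum.inr (Sum.inl (Sum.inl v))) := by
      funext e; simp [A.cobd_apply, Finset.sum_apply, mul_comm]
    have hstarB : ∑ v, c (Sum.inr (Sum.inl (Sum.inr v))) • B.star v =
        B.cobd fun v => c (Sum.inr (Sum.inl (Sum.inr v))) := by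
      funext e; simp [B.cobd_apply, Finset.sum_apply, mul_comm]
    simp only [Fintype.sum_sum_type, deformedCode_check, deformedCode_left, deformedCode_right,
      deformedCode_cyc_left, deformedCode_cyc_right, sum_smul_withEdges, withEdges_add]
    rw [withEdges_inj, A.sum_smul_attached, B.sum_smul_attached, hstarA, hstarB]
    simp only [smul_zero, Finset.sum_const_zero, add_zero, zero_add, ← add_assoc, and_self]
  rw [stab, Submodule.mem_span_range_iff_exists_fun]
  have hcancel : ∀ {M : Type _} [AddCommGroup M] [Module (ZMod 2) M] (x y : M),
      x + y + x = y := by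
    intro M _ _ x y
    rw [add_right_comm, ← two_smul (ZMod 2) x, show (2 : ZMod 2) = 0 from rfl, zero_smul, zero_add]
  constructor
  · rintro ⟨c, hc⟩
    rw [key, withEdges_inj] at hc
    obtain ⟨rfl, rfl, rfl, rfl, rfl⟩ := hc
    refine ⟨_, _, _, rfl, ?_, rfl, rfl, ?_⟩
    · rw [hcancel, ← A.mem_span_cyc, Submodule.mem_span_range_iff_exists_fun]
      exact ⟨_, rfl⟩
    · rw [hcancel, ← B.mem_span_cyc, Submodule.mem_span_range_iff_exists_fun]
      exact ⟨_, rfl⟩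
  · rintro ⟨c, u, w, rfl, h1, rfl, rfl, h2⟩
    rw [← AuxGraph.mem_span_cyc, Submodule.mem_span_range_iff_exists_fun] at h1 h2
    obtain ⟨x, hx⟩ := h1
    obtain ⟨y, hy⟩ := h2
    refine ⟨Sum.elim c (Sum.elim (Sum.elim u w) (Sum.elim x y)), ?_⟩
    rw [key, withEdges_inj]
    simp only [Sum.elim_inl, Sum.elim_inr, hx, hy, true_and]
    constructor
    · rw [← add_assoc, hcancel]
    · rw [← add_assoc, hcancel]

theorem isLogical_deformedCode (L : Pauli Q) (a₁ a₂ : A.Edge → ZMod 2)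
    (b₁ b₂ : B.Edge → ZMod 2) :
    IsLogical (deformedCode A B) (withEdges A B L a₁ a₂ b₁ b₂) ↔
      (∀ s, symp Q (H s) L + ((∑ e, A.mat s e * a₂ e) + ∑ e, b₁ e * B.mat s e) = 0) ∧
      (∀ v, symp Q (A.attached v) L + A.bd a₁ v = 0) ∧
      (∀ v, symp Q (B.attached v) L + B.bd b₂ v = 0) ∧
      (∀ i, ∑ e, A.cyc i e * a₂ e = 0) ∧ (∀ i, ∑ e, b₁ e * B.cyc i e = 0) := by
  have hA : ∀ v, A.bd a₁ v = ∑ e, a₁ e * A.star v e :=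
    fun v => Finset.sum_congr rfl fun e _ => mul_comm _ _
  have hB : ∀ v, B.bd b₂ v = ∑ e, B.star v e * b₂ e := fun v => rfl
  simp only [hA, hB]
  constructor
  · intro h
    refine ⟨fun s => ?_, fun v => ?_, fun v => ?_, fun i => ?_, fun i => ?_⟩
    · have := h (Sum.inl s)
      rw [pauliCommute_iff, deformedCode_check, symp_withEdges] at this
      simpa using this
    · have := h (Sum.inr (Sum.inl (Sum.inl v)))
      rw [pauliCommute_iff, deformedCode_left, symp_withEdges] at this
      simpa using this
    · have := h (Sum.inr (Sum.inl (Sum.inr v)))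
      rw [pauliCommute_iff, deformedCode_right, symp_withEdges] at this
      simpa using this
    · have := h (Sum.inr (Sum.inr (Sum.inl i)))
      rw [pauliCommute_iff, deformedCode_cyc_left, symp_withEdges] at this
      simpa using this
    · have := h (Sum.inr (Sum.inr (Sum.inr i)))
      rw [pauliCommute_iff, deformedCode_cyc_right, symp_withEdges] at this
      simpa using this
  · rintro ⟨h1, h2, h3, h4, h5⟩ (s | (v | v) | (i | i)) <;> rw [pauliCommute_iff]
    · rw [deformedCode_check, symp_withEdges]
      simpa using h1 s
    · rw [deformedCode_left, symp_withEdges]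
      simpa using h2 v
    · rw [deformedCode_right, symp_withEdges]
      simpa using h3 v
    · rw [deformedCode_cyc_left, symp_withEdges]
      simpa using h4 i
    · rw [deformedCode_cyc_right, symp_withEdges]
      simpa using h5 i

end Deformed


/-! ### Commutation, measured operators and the number of encoded qubits -/

section Deformed

variable {Q S : Type*} [Fintype Q] {H : S → Pauli Q} {P R : Pauli Q}
  (A : AuxGraph H P) (B : AuxGraph H R)

/-- Deformed checks carry only X on the first graph and only Z on the second, so they still commute
with each other. Against vertex checks the matching boundary compensates; vertex checks of different
graphs commute because `P` and `R` do not overlap; a cycle meets every vertex star evenly. -/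
theorem isStabilizerCode_deformedCode (hH : IsStabilizerCode H) (hPR : NonOverlapping P R) :
    IsStabilizerCode (deformedCode A B) := by
  have hRP : NonOverlapping R P := fun q => (hPR q).symm
  intro t s
  suffices h : IsLogical (deformedCode A B) (deformedCode A B s) from h t
  rcases s with s | (v | v) | (i | i)
  · rw [deformedCode_check, isLogical_deformedCode]
    refine ⟨fun t => ?_, fun v => ?_, fun v => ?_, fun i => ?_, fun i => ?_⟩
    · simpa using (pauliCommute_iff _ _).1 (hH t s)
    · rw [A.attached_eq_part, symp_comm, A.symp_check_part]
      simp [Pi.single_apply, CharTwo.add_self_eq_zero]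
    · rw [B.attached_eq_part, symp_comm, B.symp_check_part]
      simp [Pi.single_apply, CharTwo.add_self_eq_zero]
    · simp
    · simp
  · rw [deformedCode_left, isLogical_deformedCode]
    refine ⟨fun t => ?_, fun v' => ?_, fun v' => ?_, fun i => ?_, fun i => ?_⟩
    · rw [A.attached_eq_part, A.symp_check_part, A.star_eq_cobd, A.sum_mul_cobd]
      simp [CharTwo.add_self_eq_zero]
    · rw [A.attached_eq_part, A.attached_eq_part, A.symp_part_part]
      simp
    · rw [A.attached_eq_part, B.attached_eq_part, B.symp_part_part_of_nonOverlapping hRP]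
      simp
    · rw [A.star_eq_cobd]
      exact A.bd_cobd_pair (A.bd_cyc i) _
    · simp
  · rw [deformedCode_right, isLogical_deformedCode]
    refine ⟨fun t => ?_, fun v' => ?_, fun v' => ?_, fun i => ?_, fun i => ?_⟩
    · rw [B.attached_eq_part, B.symp_check_part, B.star_eq_cobd]
      simp only [mul_comm _ (B.mat t _)]
      rw [B.sum_mul_cobd]
      simp [CharTwo.add_self_eq_zero]
    · rw [A.attached_eq_part, B.attached_eq_part, A.symp_part_part_of_nonOverlapping hPR]
      simp
    · rw [B.attached_eq_part, B.attached_eq_part, B.symp_part_part]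
      simp
    · simp
    · rw [B.star_eq_cobd]
      simp only [mul_comm _ (B.cyc i _)]
      exact B.bd_cobd_pair (B.bd_cyc i) _
  · rw [deformedCode_cyc_left, isLogical_deformedCode]
    refine ⟨fun t => ?_, fun v' => ?_, fun v' => ?_, fun i => ?_, fun i => ?_⟩ <;> simp [A.bd_cyc]
  · rw [deformedCode_cyc_right, isLogical_deformedCode]
    refine ⟨fun t => ?_, fun v' => ?_, fun v' => ?_, fun i => ?_, fun i => ?_⟩ <;> simp [B.bd_cyc]

theorem mem_sup_span_pair [Fintype S] {L : Pauli Q} :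
    L ∈ stab H ⊔ Submodule.span (ZMod 2) {P, R} ↔
      ∃ (c : S → ZMod 2) (i j : ZMod 2), L = ∑ s, c s • H s + i • P + j • R := by
  rw [Submodule.mem_sup]
  constructor
  · rintro ⟨y, hy, z, hz, rfl⟩
    obtain ⟨c, rfl⟩ := (Submodule.mem_span_range_iff_exists_fun _).1 hy
    obtain ⟨i, j, rfl⟩ := Submodule.mem_span_pair.1 hz
    exact ⟨c, i, j, (add_assoc _ _ _).symm⟩
  · rintro ⟨c, i, j, rfl⟩
    exact ⟨_, (Submodule.mem_span_range_iff_exists_fun _).2 ⟨c, rfl⟩, _,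
      Submodule.mem_span_pair.2 ⟨i, j, rfl⟩, (add_assoc _ _ _).symm⟩

/-- Without vertex-type factors on the edges, both vertex sets have zero coboundary and contribute
only multiples of `P` and `R`. Conversely, the deformation factors of original checks are of the
type that is free. -/
theorem measured_deformedCode [Fintype S] :
    measured A B = (stab H ⊔ Submodule.span (ZMod 2) {P, R} : Submodule _ _) := by
  ext L
  rw [SetLike.mem_coe, mem_sup_span_pair]
  constructor
  · rintro ⟨a, b, h⟩
    obtain ⟨c, u, w, rfl, -, hu, hw, -⟩ := (mem_stab_deformedCode A B _ _ _ _ _).1 h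
    obtain ⟨i, hi⟩ := A.exists_part_of_cobd_eq_zero hu.symm
    obtain ⟨j, hj⟩ := B.exists_part_of_cobd_eq_zero hw.symm
    exact ⟨c, i, j, by rw [hi, hj]⟩
  · rintro ⟨c, i, j, rfl⟩
    refine ⟨∑ s, c s • A.mat s, ∑ s, c s • B.mat s, (mem_stab_deformedCode A B _ _ _ _ _).2
      ⟨c, fun _ => i, fun _ => j, rfl, ?_, (A.cobd_const i).symm, (B.cobd_const j).symm, ?_⟩⟩
    · rw [map_add]; funext v; exact CharTwo.add_self_eq_zero _
    · rw [map_add]; funext v; exact CharTwo.add_self_eq_zero _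

theorem left_mem_stab_deformedCode [Fintype S] :
    withEdges A B P 0 0 0 0 ∈ stab (deformedCode A B) := by
  rw [mem_stab_deformedCode]
  refine ⟨0, fun _ => 1, 0, ?_, ?_, (A.cobd_const 1).symm, (map_zero _).symm, ?_⟩
  · rw [A.part_const]; simp only [Pi.zero_apply, zero_smul, Finset.sum_const_zero, zero_add, one_smul]
    funext q; simp [B.part_apply]
  · simp
  · simp

theorem right_mem_stab_deformedCode [Fintype S] :
    withEdges A B R 0 0 0 0 ∈ stab (deformedCode A B) := by
  rw [mem_stab_deformedCode]
  refine ⟨0, 0, fun _ => 1, ?_, ?_, (map_zero _).symm, (B.cobd_const 1).symm, ?_⟩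
  · rw [B.part_const]; simp only [Pi.zero_apply, zero_smul, Finset.sum_const_zero, zero_add, one_smul]
    funext q; simp [A.part_apply]
  · simp
  · simp

/-- The boundary of the edges that are attached to a product of checks. -/
theorem AuxGraph.bd_sum_mat [Fintype S] (c : S → ZMod 2) (v : Fin A.n) :
    A.bd (∑ s, c s • A.mat s) v = symp Q (A.attached v) (∑ s, c s • H s) := by
  rw [symp_comm, A.attached_eq_part, map_sum, map_sum, LinearMap.sum_apply, Finset.sum_apply]
  refine Finset.sum_congr rfl fun s _ => ?_
  rw [map_smul, map_smul, LinearMap.smul_apply, A.symp_check_part, Pi.smul_apply]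
  simp [Pi.single_apply]

/-- Project successively to `a₂`, `b₁`, the original qubits, `a₁` and `b₂`. The images are the
coboundaries of both graphs, the measured group, and the cycles of both graphs; on each graph the
coboundary rank and the cycle rank add up to the number of edges. The functionals `φ`, `ψ` witness
that `P` and `R` are independent modulo stabilizers, so that the measured group gains rank two. -/
theorem finrank_stab_deformedCode [Fintype S] (φ ψ : Pauli Q →ₗ[ZMod 2] ZMod 2)
    (hφ : ∀ x ∈ stab H, φ x = 0) (hψ : ∀ x ∈ stab H, ψ x = 0)
    (hφP : φ P ≠ 0) (hφR : φ R = 0) (hψR : ψ R ≠ 0) (hψP : ψ P = 0) :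
    Module.finrank (ZMod 2) (stab (deformedCode A B)) = Module.finrank (ZMod 2) (stab H) + 2 +
      Fintype.card A.Edge + Fintype.card B.Edge := by
  let M := Pauli (DeformedQubit A B)
  let pL : M →ₗ[ZMod 2] Pauli Q := LinearMap.funLeft (ZMod 2) _ Sum.inl
  let pA : M →ₗ[ZMod 2] (A.Edge → ZMod 2 × ZMod 2) :=
    LinearMap.funLeft (ZMod 2) _ (Sum.inr ∘ Sum.inl)
  let pB : M →ₗ[ZMod 2] (B.Edge → ZMod 2 × ZMod 2) :=
    LinearMap.funLeft (ZMod 2) _ (Sum.inr ∘ Sum.inr)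
  let pa₁ : M →ₗ[ZMod 2] (A.Edge → ZMod 2) := (LinearMap.fst (ZMod 2) _ _).compLeft A.Edge ∘ₗ pA
  let pa₂ : M →ₗ[ZMod 2] (A.Edge → ZMod 2) := (LinearMap.snd (ZMod 2) _ _).compLeft A.Edge ∘ₗ pA
  let pb₁ : M →ₗ[ZMod 2] (B.Edge → ZMod 2) := (LinearMap.fst (ZMod 2) _ _).compLeft B.Edge ∘ₗ pB
  let pb₂ : M →ₗ[ZMod 2] (B.Edge → ZMod 2) := (LinearMap.snd (ZMod 2) _ _).compLeft B.Edge ∘ₗ pB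
  have hL : ∀ L a₁ a₂ b₁ b₂, pL (withEdges A B L a₁ a₂ b₁ b₂) = L := fun _ _ _ _ _ => rfl
  have ha₁ : ∀ L a₁ a₂ b₁ b₂, pa₁ (withEdges A B L a₁ a₂ b₁ b₂) = a₁ := fun _ _ _ _ _ => rfl
  have ha₂ : ∀ L a₁ a₂ b₁ b₂, pa₂ (withEdges A B L a₁ a₂ b₁ b₂) = a₂ := fun _ _ _ _ _ => rfl
  have hb₁ : ∀ L a₁ a₂ b₁ b₂, pb₁ (withEdges A B L a₁ a₂ b₁ b₂) = b₁ := fun _ _ _ _ _ => rfl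
  have hb₂ : ∀ L a₁ a₂ b₁ b₂, pb₂ (withEdges A B L a₁ a₂ b₁ b₂) = b₂ := fun _ _ _ _ _ => rfl
  set D := stab (deformedCode A B) with hD
  have e1 : D.map pa₂ = A.cobd.range := by
    apply le_antisymm
    · rintro _ ⟨T, hT, rfl⟩
      obtain ⟨L, a₁, a₂, b₁, b₂, rfl⟩ := exists_eq_withEdges A B T
      obtain ⟨c, u, w, -, -, rfl, -⟩ := (mem_stab_deformedCode A B _ _ _ _ _).1 hT
      exact ⟨u, rfl⟩
    · rintro _ ⟨u, rfl⟩
      exact ⟨withEdges A B (A.part u) 0 (A.cobd u) 0 0, (mem_stab_deformedCode A B _ _ _ _ _).2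
        ⟨0, u, 0, by funext q; simp [B.part_apply], by simp, rfl, by simp, by simp⟩, rfl⟩
  have e2 : (D ⊓ pa₂.ker).map pb₁ = B.cobd.range := by
    apply le_antisymm
    · rintro _ ⟨T, hT, rfl⟩
      obtain ⟨L, a₁, a₂, b₁, b₂, rfl⟩ := exists_eq_withEdges A B T
      obtain ⟨c, u, w, -, -, -, rfl, -⟩ := (mem_stab_deformedCode A B _ _ _ _ _).1 hT.1
      exact ⟨w, rfl⟩
    · rintro _ ⟨w, rfl⟩
      exact ⟨withEdges A B (B.part w) 0 0 (B.cobd w) 0, ⟨(mem_stab_deformedCode A B _ _ _ _ _).2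
        ⟨0, 0, w, by funext q; simp [A.part_apply], by simp, by simp, rfl, by simp⟩, rfl⟩, rfl⟩
  have e3 : (D ⊓ pa₂.ker ⊓ pb₁.ker).map pL = stab H ⊔ Submodule.span (ZMod 2) {P, R} := by
    apply SetLike.coe_injective
    rw [← measured_deformedCode A B]
    ext L
    constructor
    · rintro ⟨T, ⟨⟨h1, h2⟩, h3⟩, rfl⟩
      obtain ⟨L, a₁, a₂, b₁, b₂, rfl⟩ := exists_eq_withEdges A B T
      obtain rfl : a₂ = 0 := h2
      obtain rfl : b₁ = 0 := h3
      exact ⟨a₁, b₂, h1⟩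
    · rintro ⟨a, b, h⟩
      exact ⟨_, ⟨⟨h, rfl⟩, rfl⟩, rfl⟩
  -- If the product is trivial on the original qubits, `φ` and `ψ` rule out factors `P` and `R`. The
  -- original checks involved then multiply to the identity, so their matchings sum to cycles.
  have key : ∀ a b, withEdges A B 0 a 0 0 b ∈ D ↔ A.bd a = 0 ∧ B.bd b = 0 := by
    intro a b
    constructor
    · intro h
      obtain ⟨c, u, w, h0, h1, hu, hw, h2⟩ := (mem_stab_deformedCode A B _ _ _ _ _).1 h
      obtain ⟨i, hi⟩ := A.exists_part_of_cobd_eq_zero hu.symm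
      obtain ⟨j, hj⟩ := B.exists_part_of_cobd_eq_zero hw.symm
      have hs : ∑ s, c s • H s ∈ stab H := (Submodule.mem_span_range_iff_exists_fun _).2 ⟨c, rfl⟩
      rw [hi, hj] at h0
      have hi0 : i = 0 := by
        have := congrArg φ h0
        rw [map_zero, map_add, map_add, map_smul, map_smul, hφ _ hs, hφR, smul_zero, add_zero,
          zero_add, smul_eq_mul] at this
        exact (mul_eq_zero.1 this.symm).resolve_right hφP
      have hj0 : j = 0 := by
        have := congrArg ψ h0
        rw [map_zero, map_add, map_add, map_smul, map_smul, hψ _ hs, hψP, smul_zero, add_zero,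
          zero_add, smul_eq_mul] at this
        exact (mul_eq_zero.1 this.symm).resolve_right hψR
      rw [hi0, hj0, zero_smul, zero_smul, add_zero, add_zero] at h0
      have hA : A.bd (∑ s, c s • A.mat s) = 0 := by
        funext v; rw [A.bd_sum_mat, ← h0, map_zero]; rfl
      have hB : B.bd (∑ s, c s • B.mat s) = 0 := by
        funext v; rw [B.bd_sum_mat, ← h0, map_zero]; rfl
      rw [map_add, hA, add_zero] at h1
      rw [map_add, hB, add_zero] at h2
      exact ⟨h1, h2⟩
    · rintro ⟨h1, h2⟩
      refine (mem_stab_deformedCode A B _ _ _ _ _).2 ⟨0, 0, 0, ?_, ?_, ?_, ?_, ?_⟩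
      · funext q; simp [A.part_apply, B.part_apply]
      · simpa using h1
      · simp
      · simp
      · simpa using h2
  have e4 : (D ⊓ pa₂.ker ⊓ pb₁.ker ⊓ pL.ker).map pa₁ = A.bd.ker := by
    apply le_antisymm
    · rintro _ ⟨T, ⟨⟨⟨h1, h2⟩, h3⟩, h4⟩, rfl⟩
      obtain ⟨L, a₁, a₂, b₁, b₂, rfl⟩ := exists_eq_withEdges A B T
      obtain rfl : a₂ = 0 := h2
      obtain rfl : b₁ = 0 := h3
      obtain rfl : L = 0 := h4
      exact ((key _ _).1 h1).1
    · intro a ha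
      exact ⟨_, ⟨⟨⟨(key a 0).2 ⟨ha, map_zero _⟩, rfl⟩, rfl⟩, rfl⟩, rfl⟩
  have e5 : (D ⊓ pa₂.ker ⊓ pb₁.ker ⊓ pL.ker ⊓ pa₁.ker).map pb₂ = B.bd.ker := by
    apply le_antisymm
    · rintro _ ⟨T, ⟨⟨⟨⟨h1, h2⟩, h3⟩, h4⟩, h5⟩, rfl⟩
      obtain ⟨L, a₁, a₂, b₁, b₂, rfl⟩ := exists_eq_withEdges A B T
      obtain rfl : a₂ = 0 := h2
      obtain rfl : b₁ = 0 := h3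
      obtain rfl : L = 0 := h4
      exact ((key _ _).1 h1).2
    · intro b hb
      exact ⟨_, ⟨⟨⟨⟨(key 0 b).2 ⟨map_zero _, hb⟩, rfl⟩, rfl⟩, rfl⟩, rfl⟩, rfl⟩
  have e6 : D ⊓ pa₂.ker ⊓ pb₁.ker ⊓ pL.ker ⊓ pa₁.ker ⊓ pb₂.ker = ⊥ := by
    rw [eq_bot_iff]
    rintro T ⟨⟨⟨⟨⟨h1, h2⟩, h3⟩, h4⟩, h5⟩, h6⟩
    obtain ⟨L, a₁, a₂, b₁, b₂, rfl⟩ := exists_eq_withEdges A B T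
    obtain rfl : a₂ = 0 := h2
    obtain rfl : b₁ = 0 := h3
    obtain rfl : L = 0 := h4
    obtain rfl : a₁ = 0 := h5
    obtain rfl : b₂ = 0 := h6
    exact map_zero (withEdgesLin A B)
  have hA := A.finrank_cobd_add_finrank_bd
  have hB := B.finrank_cobd_add_finrank_bd
  rw [finrank_eq_finrank_map_add pa₂ D, e1, finrank_eq_finrank_map_add pb₁ (D ⊓ _), e2,
    finrank_eq_finrank_map_add pL (D ⊓ _ ⊓ _), e3, finrank_eq_finrank_map_add pa₁ (D ⊓ _ ⊓ _ ⊓ _),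
    e4, finrank_eq_finrank_map_add pb₂ (D ⊓ _ ⊓ _ ⊓ _ ⊓ _), e5, e6, finrank_bot,
    finrank_sup_span_pair _ φ ψ hφ hψ hφP hφR hψR hψP]
  omega

theorem measuresExactly_deformedCode [Fintype S] (φ ψ : Pauli Q →ₗ[ZMod 2] ZMod 2)
    (hφ : ∀ x ∈ stab H, φ x = 0) (hψ : ∀ x ∈ stab H, ψ x = 0)
    (hφP : φ P ≠ 0) (hφR : φ R = 0) (hψR : ψ R ≠ 0) (hψP : ψ P = 0) : MeasuresExactly A B where
  mem_left := left_mem_stab_deformedCode A B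
  mem_right := right_mem_stab_deformedCode A B
  measured_eq := measured_deformedCode A B
  numLogical_eq := by
    rw [numLogical, numLogical, finrank_stab_deformedCode A B φ ψ hφ hψ hφP hφR hψR hψP,
      Fintype.card_sum, Fintype.card_sum]
    push_cast
    ring

/-! ### Cleaning logical operators off the edge qubits -/

theorem wt_withEdges (L : Pauli Q) (a₁ a₂ : A.Edge → ZMod 2) (b₁ b₂ : B.Edge → ZMod 2) :
    wt (withEdges A B L a₁ a₂ b₁ b₂) = wt L +
      ((Finset.univ.filter fun e => (a₁ e, a₂ e) ≠ 0).card +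
        (Finset.univ.filter fun e => (b₁ e, b₂ e) ≠ 0).card) := by
  rw [withEdges, wt_sumElim, wt_sumElim]
  rfl

/-- Multiplying a nontrivial logical operator of the deformed code by vertex checks gives a logical
operator of the original code that commutes with both measured operators. -/
theorem exists_cleaned [Fintype S] (hPR : NonOverlapping P R) {T : Pauli (DeformedQubit A B)}
    (hT : IsNontrivialLogical (deformedCode A B) T) :
    ∃ (M : Pauli Q) (u : Fin A.n → ZMod 2) (w : Fin B.n → ZMod 2), IsLogical H M ∧
      symp Q P M = 0 ∧ symp Q R M = 0 ∧ M ∉ stab H ⊔ Submodule.span (ZMod 2) {P, R} ∧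
      wt (M + A.part u + B.part w) + (Finset.univ.filter fun e => A.cobd u e ≠ 0).card +
        (Finset.univ.filter fun e => B.cobd w e ≠ 0).card ≤ wt T := by
  obtain ⟨L, a₁, a₂, b₁, b₂, rfl⟩ := exists_eq_withEdges A B T
  obtain ⟨hlog, hnot⟩ := hT
  obtain ⟨h1, h2, h3, h4, h5⟩ := (isLogical_deformedCode A B _ _ _ _ _).1 hlog
  have hRP : NonOverlapping R P := fun q => (hPR q).symm
  -- Commuting with the basis cycles means meeting every cycle evenly, hence being a coboundary.
  have hspan : ∀ {P : Pauli Q} (A : AuxGraph H P) (a : A.Edge → ZMod 2),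
      (∀ i, ∑ e, A.cyc i e * a e = 0) → ∃ u, A.cobd u = a := by
    intro P A a h
    refine A.exists_cobd a fun c hc => ?_
    obtain ⟨x, rfl⟩ := (Submodule.mem_span_range_iff_exists_fun _).1 ((A.mem_span_cyc c).2 hc)
    simp only [Finset.sum_apply, Pi.smul_apply, smul_eq_mul, Finset.sum_mul]
    rw [Finset.sum_comm]
    refine Finset.sum_eq_zero fun i _ => ?_
    simp only [mul_assoc]
    rw [← Finset.mul_sum, h i, mul_zero]
  obtain ⟨u, rfl⟩ := hspan A a₂ h4
  obtain ⟨w, rfl⟩ := hspan B b₁ (fun i => by rw [← h5 i]; exact Finset.sum_congr rfl fun _ _ => mul_comm _ _)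
  -- The product of all vertex checks of a graph is the measured operator without edge factors.
  have hsum : ∀ {P : Pauli Q} (A : AuxGraph H P) (a : A.Edge → ZMod 2),
      (∀ v, symp Q (A.attached v) L + A.bd a v = 0) → symp Q P L = 0 := by
    intro P A a h
    have h6 := A.sum_mul_cobd a fun _ => 1
    rw [A.cobd_const] at h6
    simp only [Pi.zero_apply, mul_zero, Finset.sum_const_zero, one_mul] at h6
    have h7 := Finset.sum_eq_zero fun v (_ : v ∈ Finset.univ) => h v
    rw [Finset.sum_add_distrib, ← h6, add_zero] at h7
    have h8 := A.sum_smul_attached fun _ => 1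
    rw [A.part_const, one_smul] at h8
    simp only [one_smul] at h8
    rw [← h8, map_sum, LinearMap.sum_apply, h7]
  have hPart : ∀ {P : Pauli Q} (A : AuxGraph H P) (u), symp Q P (A.part u) = 0 := by
    intro P A u
    have := A.symp_part_part (fun _ => 1) u
    rwa [A.part_const, one_smul] at this
  have hPart' : ∀ {P R : Pauli Q} (_ : NonOverlapping P R) (A : AuxGraph H P) (B : AuxGraph H R) (w),
      symp Q P (B.part w) = 0 := by
    intro P R hPR A B w
    have := A.symp_part_part_of_nonOverlapping hPR B (fun _ => 1) w
    rwa [A.part_const, one_smul] at this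
  have htwo : ∀ x y : Pauli Q, x + y + y = x := fun x y => by
    rw [add_assoc, ← two_smul (ZMod 2) y, show (2 : ZMod 2) = 0 from rfl, zero_smul, add_zero]
  refine ⟨L + A.part u + B.part w, u, w, ?_, ?_, ?_, ?_, ?_⟩
  · intro s
    rw [pauliCommute_iff, map_add, map_add, A.symp_check_part, B.symp_check_part, ← A.sum_mul_cobd,
      ← B.sum_mul_cobd, add_assoc]
    simpa only [mul_comm (B.cobd w _)] using h1 s
  · rw [map_add, map_add, hsum A a₁ h2, hPart A, hPart' hPR A B, add_zero, add_zero]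
  · rw [map_add, map_add, hsum B b₂ h3, hPart B, hPart' hRP B A, add_zero, add_zero]
  -- Otherwise `T` would be a stabilizer: commuting with the vertex checks forces the remaining edge
  -- factors `a₁`, `b₂` to agree with the matchings up to cycles.
  · intro hmem
    apply hnot
    obtain ⟨c, i, j, hc⟩ := mem_sup_span_pair.1 hmem
    rw [mem_stab_deformedCode]
    have hL : L = ∑ s, c s • H s + A.part ((fun _ => i) + u) + B.part ((fun _ => j) + w) := by
      rw [A.part_add, B.part_add, A.part_const, B.part_const]
      calc L = L + A.part u + B.part w + A.part u + B.part w := by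
            rw [add_right_comm (L + A.part u), htwo, htwo]
        _ = _ := by rw [hc]; abel
    refine ⟨c, (fun _ => i) + u, (fun _ => j) + w, hL, ?_, ?_, ?_, ?_⟩
    · funext v
      have := h2 v
      rw [hL, map_add, map_add, A.attached_eq_part, A.symp_part_part,
        A.symp_part_part_of_nonOverlapping hPR, ← A.attached_eq_part, ← A.bd_sum_mat, add_zero,
        add_zero, add_comm] at this
      rw [map_add]
      exact this
    · rw [map_add, A.cobd_const, zero_add]
    · rw [map_add, B.cobd_const, zero_add]
    · funext v
      have := h3 v
      rw [hL, map_add, map_add, B.attached_eq_part, B.symp_part_part,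
        B.symp_part_part_of_nonOverlapping hRP, ← B.attached_eq_part, ← B.bd_sum_mat, add_zero,
        add_zero, add_comm] at this
      rw [map_add]
      exact this
  -- On the edge qubits only `a₂` and `b₁` are counted; the factors `a₁` and `b₂` can only increase
  -- the weight of `T`.
  · rw [wt_withEdges, add_right_comm (L + A.part u), htwo, htwo, add_assoc]
    refine Nat.add_le_add_left (Nat.add_le_add ?_ ?_) _ <;> apply Finset.card_le_card <;>
      intro e he <;> simp only [Finset.mem_filter, Finset.mem_univ, true_and] at he ⊢ <;>
      intro h <;> rw [Prod.mk_eq_zero] at h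
    · exact he h.2
    · exact he h.1

end Deformed


/-! ### Auxiliary graphs from gadgets -/

section EdgeVec

variable {V : Type*} [DecidableEq V] {G : SimpleGraph V}

/-- The indicator of the edge between two vertices; `0` if there is none. -/
def edgeVec (G : SimpleGraph V) (x y : V) : G.edgeSet → ZMod 2 :=
  fun e => if (e : Sym2 V) = s(x, y) then 1 else 0

theorem edgeVec_comm (x y : V) : edgeVec G x y = edgeVec G y x := by
  funext e; rw [edgeVec, edgeVec, Sym2.eq_swap]

theorem edgeVec_self (x : V) : edgeVec G x x = 0 := by
  funext ⟨e, he⟩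
  rw [edgeVec, if_neg]
  · rfl
  · rintro rfl
    exact (SimpleGraph.mem_edgeSet G).1 he |>.ne rfl

theorem edgeVec_ne_zero {x y : V} {e : G.edgeSet} (h : edgeVec G x y e ≠ 0) :
    (e : Sym2 V) = s(x, y) := by
  by_contra h'
  exact h (if_neg h')

theorem edgeVec_eq_single {x y : V} (h : G.Adj x y) [DecidableEq G.edgeSet] :
    edgeVec G x y = Pi.single ⟨s(x, y), h⟩ 1 := by
  funext e
  rw [edgeVec, Pi.single_apply]
  congr 1
  rw [Subtype.ext_iff]

variable [Fintype G.edgeSet]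

theorem card_edgeVec_le (x y : V) : (Finset.univ.filter fun e => edgeVec G x y e ≠ 0).card ≤ 1 := by
  refine Finset.card_le_one.2 fun e he e' he' => Subtype.ext ?_
  simp only [Finset.mem_filter, Finset.mem_univ, true_and] at he he'
  rw [edgeVec_ne_zero he, edgeVec_ne_zero he']

/-- The boundary of an edge set. -/
def boundary (G : SimpleGraph V) [Fintype G.edgeSet] :
    (G.edgeSet → ZMod 2) →ₗ[ZMod 2] (V → ZMod 2) :=
  (incidence G).transpose.mulVecLin

theorem boundary_apply (c : G.edgeSet → ZMod 2) (v : V) :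
    boundary G c v = ∑ᶠ e, c e * incidence G e v := by
  rw [finsum_eq_sum_of_fintype]
  exact Finset.sum_congr rfl fun e _ => mul_comm _ _

theorem boundary_edgeVec {x y : V} (h : LazyAdj G x y) :
    boundary G (edgeVec G x y) = Pi.single x 1 + Pi.single y 1 := by
  classical
  rcases h with rfl | h
  · rw [edgeVec_self, map_zero]
    funext v
    exact (CharTwo.add_self_eq_zero _).symm
  · funext v
    rw [boundary_apply, finsum_eq_sum_of_fintype, edgeVec_eq_single h]
    simp only [Pi.single_apply, ite_mul, one_mul, zero_mul, Finset.sum_ite_eq', Finset.mem_univ,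
      if_true, Pi.add_apply, incidence, Matrix.of_apply, Sym2.mem_iff]
    by_cases h1 : v = x
    · subst h1; simp [h.ne]
    · simp [h1]

variable [Fintype V]

/-- The cycle of a lazy closed walk of length four. -/
def walkVec (G : SimpleGraph V) (t : V × V × V × V) : G.edgeSet → ZMod 2 :=
  edgeVec G t.1 t.2.1 + edgeVec G t.2.1 t.2.2.1 + edgeVec G t.2.2.1 t.2.2.2 + edgeVec G t.2.2.2 t.1

/-- Four vertices form a closed lazy walk. -/
def IsLazyWalk (G : SimpleGraph V) (t : V × V × V × V) : Prop :=
  LazyAdj G t.1 t.2.1 ∧ LazyAdj G t.2.1 t.2.2.1 ∧ LazyAdj G t.2.2.1 t.2.2.2 ∧ LazyAdj G t.2.2.2 t.1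

open Classical in
/-- The cycles of the closed lazy walks of length four, indexed by all quadruples of vertices. -/
noncomputable def walkCycle (G : SimpleGraph V) (t : V × V × V × V) : G.edgeSet → ZMod 2 :=
  if IsLazyWalk G t then walkVec G t else 0

theorem boundary_walkCycle (t : V × V × V × V) : boundary G (walkCycle G t) = 0 := by
  rw [walkCycle]
  split_ifs with h
  · obtain ⟨h1, h2, h3, h4⟩ := h
    simp only [walkVec, map_add, boundary_edgeVec h1, boundary_edgeVec h2, boundary_edgeVec h3,
      boundary_edgeVec h4]
    funext v
    simp only [Pi.add_apply, Pi.zero_apply]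
    have h8 : ∀ r1 r2 r3 r4 : ZMod 2, r1 + r2 + (r2 + r3) + (r3 + r4) + (r4 + r1) = 0 := by decide
    exact h8 _ _ _ _
  · exact map_zero _

/-- By duality: a functional that vanishes on all four-walks is, evaluated on edges, a cochain as in
`Filled`, hence a coboundary, hence zero on every cycle. So no cycle can be separated from the span.
-/
theorem mem_span_walkCycle (hG : Filled G) (c : G.edgeSet → ZMod 2) :
    c ∈ Submodule.span (ZMod 2) (Set.range (walkCycle G)) ↔ boundary G c = 0 := by
  classical
  constructor
  · intro h
    have hle : Submodule.span (ZMod 2) (Set.range (walkCycle G)) ≤ (boundary G).ker := by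
      refine Submodule.span_le.2 ?_
      rintro _ ⟨t, rfl⟩
      exact boundary_walkCycle t
    exact hle h
  · intro hc
    by_contra hmem
    obtain ⟨φ, hφ, hφ'⟩ := Submodule.exists_le_ker_of_notMem hmem
    obtain ⟨f, hf⟩ := hG (fun x y => φ (edgeVec G x y)) (fun x y => by rw [edgeVec_comm])
      (fun x => by rw [edgeVec_self, map_zero]) (by
        intro v₀ v₁ v₂ v₃ h0 h1 h2 h3
        rw [← map_add, ← map_add, ← map_add]
        apply hφ'
        apply Submodule.subset_span
        exact ⟨(v₀, v₁, v₂, v₃), if_pos ⟨h0, h1, h2, h3⟩⟩)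
    apply hφ
    have hsingle : ∀ e : G.edgeSet, φ (Pi.single e 1) = ∑ v, incidence G e v * f v := by
      rintro ⟨e, he⟩
      induction e using Sym2.inductionOn with
      | hf x y =>
        have hadj : G.Adj x y := he
        rw [← edgeVec_eq_single hadj, hf x y hadj]
        have hs : ∀ v, incidence G ⟨s(x, y), he⟩ v * f v =
            (if v = x then f v else 0) + (if v = y then f v else 0) := by
          intro v
          simp only [incidence, Matrix.of_apply, Sym2.mem_iff]
          by_cases h1 : v = x
          · subst h1; simp [hadj.ne]
          · simp [h1]
        rw [Finset.sum_congr rfl fun v _ => hs v, Finset.sum_add_distrib]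
        simp
    have hcs : c = ∑ e, c e • (Pi.single e 1 : G.edgeSet → ZMod 2) := by
      funext e
      simp [Finset.sum_apply, Pi.single_apply]
    rw [hcs, map_sum]
    simp only [map_smul, hsingle, smul_eq_mul, Finset.mul_sum]
    rw [Finset.sum_comm]
    refine Finset.sum_eq_zero fun v _ => ?_
    have := congrFun hc v
    rw [boundary_apply, finsum_eq_sum_of_fintype, Pi.zero_apply] at this
    simp only [← mul_assoc]
    rw [← Finset.sum_mul, this, zero_mul]

end EdgeVec

section Support

/-- The size of the support of a sum is at most the sum of the sizes of the supports. -/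
theorem card_support_sum_le {ι E : Type*} [Fintype E] (s : Finset ι) (f : ι → E → ZMod 2) (m : ℕ)
    (h : ∀ i ∈ s, (Finset.univ.filter fun e => f i e ≠ 0).card ≤ m) :
    (Finset.univ.filter fun e => (∑ i ∈ s, f i) e ≠ 0).card ≤ s.card * m := by
  classical
  refine (Finset.card_le_card (t := s.biUnion fun i => Finset.univ.filter fun e => f i e ≠ 0) ?_).trans
    (Finset.card_biUnion_le_card_mul _ _ _ h)
  intro e he
  simp only [Finset.mem_filter, Finset.mem_univ, true_and, Finset.mem_biUnion] at he ⊢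
  by_contra! h'
  exact he (by rw [Finset.sum_apply]; exact Finset.sum_eq_zero h')

end Support

/-- The qubits at which a check and an operator anticommute. -/
def antiSet {Q S : Type*} [Fintype Q] (H : S → Pauli Q) (P : Pauli Q) (s : S) : Finset Q :=
  Finset.univ.filter fun q => localSymp (H s q) (P q) ≠ 0

/-- Points of `X` are adjacent if they host qubits at which a common check anticommutes with `P`. -/
def portGraph {Q S X : Type*} [Fintype Q] (H : S → Pauli Q) (P : Pauli Q) (pos : Q → X) :
    SimpleGraph X :=
  SimpleGraph.fromRel fun x y => ∃ s, ∃ q ∈ antiSet H P s, ∃ q' ∈ antiSet H P s, pos q = x ∧ pos q' = y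

section Port

variable {Q S X : Type*} [Fintype Q] {H : S → Pauli Q} {P : Pauli Q} {pos : Q → X}

theorem mem_antiSet {s : S} {q : Q} : q ∈ antiSet H P s ↔ localSymp (H s q) (P q) ≠ 0 := by
  simp [antiSet]

theorem ne_zero_of_mem_antiSet {s : S} {q : Q} (h : q ∈ antiSet H P s) : H s q ≠ 0 ∧ P q ≠ 0 := by
  rw [mem_antiSet] at h
  constructor <;> intro h' <;> apply h <;> rw [h'] <;> simp

theorem card_antiSet_le [Fintype S] {α β : ℕ} (hH : IsLDPC H α β) (s : S) :
    (antiSet H P s).card ≤ α := by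
  refine (Finset.card_le_card fun q hq => ?_).trans (hH.1 s)
  simpa using (ne_zero_of_mem_antiSet hq).1

/-- At most two qubits sit at a point, each is in at most `β` checks, and each check touches at most
`α` qubits. -/
theorem degreeLE_portGraph [Fintype S] {α β : ℕ} (hH : IsLDPC H α β)
    (hpos : ∀ x, ∃ F : Finset Q, F.card ≤ 2 ∧ ∀ q, P q ≠ 0 → pos q = x → q ∈ F) :
    DegreeLE (portGraph H P pos) (2 * (β * α)) := by
  classical
  intro x
  obtain ⟨F, hF, hF'⟩ := hpos x
  refine ⟨(F.biUnion fun q => (Finset.univ.filter fun s => H s q ≠ 0).biUnion fun s =>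
    antiSet H P s).image pos, ?_, ?_⟩
  · refine Finset.card_image_le.trans ?_
    refine (Finset.card_biUnion_le_card_mul _ _ (β * α) fun q _ => ?_).trans
      (Nat.mul_le_mul_right _ hF)
    refine (Finset.card_biUnion_le_card_mul _ _ α fun s _ => card_antiSet_le hH s).trans ?_
    exact Nat.mul_le_mul_right _ (hH.2 q)
  · have key : ∀ {y s q q'}, q ∈ antiSet H P s → q' ∈ antiSet H P s → pos q = x → pos q' = y →
        y ∈ (F.biUnion fun q => (Finset.univ.filter fun s => H s q ≠ 0).biUnion fun s =>
          antiSet H P s).image pos := by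
      intro y s q q' hq hq' h1 h2
      simp only [Finset.mem_image, Finset.mem_biUnion, Finset.mem_filter, Finset.mem_univ, true_and]
      exact ⟨q', ⟨q, hF' q (ne_zero_of_mem_antiSet hq).2 h1, s, (ne_zero_of_mem_antiSet hq).1, hq'⟩,
        h2⟩
    intro y hy
    obtain ⟨_, ⟨s, q, hq, q', hq', h1, h2⟩ | ⟨s, q, hq, q', hq', h1, h2⟩⟩ :=
      (SimpleGraph.fromRel_adj _ _ _).1 hy
    · exact key hq hq' h1 h2
    · exact key hq' hq h2 h1

variable {n : ℕ} [Fintype X] {G : SimpleGraph (Fin n)} {ι : X → Fin n} {D : ℕ}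

open Classical in
/-- The edges that connect the ports of the qubits at which a check anticommutes with `P` to one of
them. -/
noncomputable def starMatching (H : S → Pauli Q) (P : Pauli Q) (G : SimpleGraph (Fin n))
    (port : Q → Fin n) (s : S) : G.edgeSet → ZMod 2 :=
  if h : (antiSet H P s).Nonempty then
    ∑ q ∈ antiSet H P s, edgeVec G (port h.choose) (port q)
  else 0

/-- Every edge of the star contributes its outer end and the centre. The centre cancels because a
check commuting with `P` anticommutes with it locally at an even number of qubits; degenerate edges,
where two qubits share a port, vanish consistently. -/
theorem starMatching_boundary (hP : IsLogical H P) (hG : IsGadget (portGraph H P pos) G ι D) (s : S)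
    (v : Fin n) : ∑ᶠ e, starMatching H P G (ι ∘ pos) s e * incidence G e v =
      ∑ q, if (ι ∘ pos) q = v then localSymp (H s q) (P q) else 0 := by
  classical
  have hone : ∀ a : ZMod 2, a ≠ 0 → a = 1 := by decide
  have hrhs : ∑ q, (if (ι ∘ pos) q = v then localSymp (H s q) (P q) else 0) =
      ∑ q ∈ antiSet H P s, (Pi.single ((ι ∘ pos) q) 1 : Fin n → ZMod 2) v := by
    rw [antiSet, Finset.sum_filter]
    refine Finset.sum_congr rfl fun q _ => ?_
    by_cases h : localSymp (H s q) (P q) = 0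
    · simp [h]
    · rw [if_pos h, hone _ h, Pi.single_apply]
      simp only [eq_comm]
  rw [hrhs, ← boundary_apply, starMatching]
  split_ifs with h
  · have hadj : ∀ q ∈ antiSet H P s, LazyAdj G ((ι ∘ pos) h.choose) ((ι ∘ pos) q) := by
      intro q hq
      by_cases heq : pos h.choose = pos q
      · left; simp [heq]
      · right
        exact hG.adj _ _ ((SimpleGraph.fromRel_adj _ _ _).2
          ⟨heq, Or.inl ⟨s, _, h.choose_spec, q, hq, rfl, rfl⟩⟩)
    rw [map_sum, Finset.sum_congr rfl fun q hq => boundary_edgeVec (hadj q hq),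
      Finset.sum_add_distrib, Finset.sum_const, Pi.add_apply, Finset.sum_apply, Pi.smul_apply]
    have hcard : ((antiSet H P s).card : ZMod 2) = 0 := by
      have h1 : symp Q (H s) P = 0 := hP s
      rw [symp_apply] at h1
      rw [← h1, antiSet, Finset.card_filter, Nat.cast_sum]
      refine Finset.sum_congr rfl fun q _ => ?_
      by_cases h : localSymp (H s q) (P q) = 0
      · simp [h]
      · rw [if_pos h, hone _ h, Nat.cast_one]
    rw [nsmul_eq_mul, hcard, zero_mul, zero_add]
  · rw [Finset.not_nonempty_iff_eq_empty.1 h, map_zero]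
    simp

/-- The auxiliary graph of a gadget that contains the port graph. -/
noncomputable def IsGadget.auxGraph (hG : IsGadget (portGraph H P pos) G ι D) (hP : IsLogical H P) :
    AuxGraph H P where
  n := n
  graph := G
  connected := hG.connected
  port := ι ∘ pos
  matching := starMatching H P G (ι ∘ pos)
  matching_boundary := starMatching_boundary hP hG
  matching_trivial s hs := by
    rw [starMatching, dif_neg]
    rintro ⟨q, hq⟩
    exact mem_antiSet.1 hq (hs q)
  -- A redundant generating family suffices: all quadruples of vertices are indices, and those that
  -- are not closed walks give zero.
  numCycles := Fintype.card (Fin n × Fin n × Fin n × Fin n)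
  cycle i := walkCycle G ((Fintype.equivFin _).symm i)
  span_cycle c := by
    classical
    have : Set.range (fun i => walkCycle G ((Fintype.equivFin (Fin n × Fin n × Fin n × Fin n)).symm i))
        = Set.range (walkCycle G) := EquivLike.range_comp (walkCycle G) (Fintype.equivFin _).symm
    rw [this]
    have h := mem_span_walkCycle hG.filled c
    rw [h, funext_iff]
    simp only [boundary_apply, Pi.zero_apply]

end Port


/-! ### Sparsity of the deformed code -/

theorem card_filter_mono {E : Type*} [Fintype E] {p q : E → Prop} [DecidablePred p]
    [DecidablePred q] (h : ∀ e, p e → q e) :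
    (Finset.univ.filter p).card ≤ (Finset.univ.filter q).card :=
  Finset.card_le_card fun e he => by
    rw [Finset.mem_filter] at he ⊢
    exact ⟨he.1, h e he.2⟩

theorem card_filter_eq_zero {E : Type*} [Fintype E] {p : E → Prop} [DecidablePred p]
    (h : ∀ e, ¬ p e) : (Finset.univ.filter p).card = 0 :=
  Finset.card_eq_zero.2 (Finset.filter_eq_empty_iff.2 fun e _ => h e)

theorem card_filter_eq_ncard {E : Type*} [Fintype E] (p : E → Prop) [DecidablePred p] :
    (Finset.univ.filter p).card = {e | p e}.ncard := by
  rw [← Set.ncard_coe_finset]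
  congr 1
  ext e
  simp

namespace AuxGraph

variable {Q S : Type*} [Fintype Q] {H : S → Pauli Q} {P : Pauli Q}

/-- Bounds on the sparsity of an auxiliary graph. -/
structure IsSparse [Fintype S] (A : AuxGraph H P) (p D m μ κ : ℕ) : Prop where
  attached : ∀ v, wt (A.attached v) ≤ p
  star : ∀ v, (Finset.univ.filter fun e => A.star v e ≠ 0).card ≤ D
  mat : ∀ s, (Finset.univ.filter fun e => A.mat s e ≠ 0).card ≤ m
  cyc : ∀ i, (Finset.univ.filter fun e => A.cyc i e ≠ 0).card ≤ 4
  edge_mat : ∀ e, (Finset.univ.filter fun s => A.mat s e ≠ 0).card ≤ μ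
  edge_cyc : ∀ e, (Finset.univ.filter fun i => A.cyc i e ≠ 0).card ≤ κ

theorem card_star_edge_le (A : AuxGraph H P) (e : A.Edge) :
    (Finset.univ.filter fun v => A.star v e ≠ 0).card ≤ 2 := by
  classical
  obtain ⟨x, y, h, rfl⟩ := A.exists_edge e
  refine (Finset.card_le_card (t := {x, y}) fun v hv => ?_).trans Finset.card_le_two
  rw [Finset.mem_filter, star_edge] at hv
  have h' : v = x ∨ v = y := by
    by_contra h'
    exact hv.2 (if_neg h')
  simpa using h'

theorem card_attached_le (A : AuxGraph H P) (q : Q) :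
    (Finset.univ.filter fun v => A.attached v q ≠ 0).card ≤ 1 := by
  refine Finset.card_le_one.2 fun v hv w hw => ?_
  rw [Finset.mem_filter] at hv hw
  have h1 : A.port q = v := by by_contra h; exact hv.2 (if_neg h)
  have h2 : A.port q = w := by by_contra h; exact hw.2 (if_neg h)
  rw [← h1, ← h2]

theorem IsSparse.size_le [Fintype S] {A : AuxGraph H P} {p D m μ κ : ℕ} (hA : A.IsSparse p D m μ κ) :
    A.size ≤ A.n * (1 + D) := by
  classical
  have h : (Finset.univ : Finset A.Edge) ⊆
      (Finset.univ : Finset (Fin A.n)).biUnion fun v => Finset.univ.filter fun e => A.star v e ≠ 0 := by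
    intro e _
    obtain ⟨x, y, h, rfl⟩ := A.exists_edge e
    simp only [Finset.mem_biUnion, Finset.mem_filter, Finset.mem_univ, true_and]
    exact ⟨x, by rw [star_edge]; simp⟩
  have h2 := (Finset.card_le_card h).trans (Finset.card_biUnion_le_card_mul _ _ D fun v _ => hA.star v)
  rw [Finset.card_univ, Finset.card_univ, Fintype.card_fin] at h2
  rw [size, mul_add, mul_one]
  exact Nat.add_le_add_left h2 _

end AuxGraph

/-- The weight bound adds up the bounds `α + 2m`, `p + D` and `4` for the three kinds of checks. An
original qubit gains at most one vertex check per graph; an edge qubit sees its two end vertices, at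
most `μ` deformed checks and at most `κ` cycles. -/
theorem isLDPC_deformedCode {Q S : Type*} [Fintype Q] [Fintype S] {H : S → Pauli Q} {P R : Pauli Q}
    {A : AuxGraph H P} {B : AuxGraph H R} {α β p D m μ κ : ℕ} (hH : IsLDPC H α β)
    (hA : A.IsSparse p D m μ κ) (hB : B.IsSparse p D m μ κ) :
    IsLDPC (deformedCode A B) (α + 2 * m + p + D + 4) (β + 2 + μ + κ) := by
  classical
  have hfst : ∀ {E : Type _} [Fintype E] (a : E → ZMod 2),
      (Finset.univ.filter fun e => (a e, (0 : E → ZMod 2) e) ≠ 0).card ≤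
        (Finset.univ.filter fun e => a e ≠ 0).card :=
    fun a => card_filter_mono fun e h h' => h (Prod.ext h' rfl)
  have hsnd : ∀ {E : Type _} [Fintype E] (a : E → ZMod 2),
      (Finset.univ.filter fun e => ((0 : E → ZMod 2) e, a e) ≠ 0).card ≤
        (Finset.univ.filter fun e => a e ≠ 0).card :=
    fun a => card_filter_mono fun e h h' => h (Prod.ext rfl h')
  have hnone : ∀ {E : Type _} [Fintype E],
      (Finset.univ.filter fun e => ((0 : E → ZMod 2) e, (0 : E → ZMod 2) e) ≠ 0).card = 0 :=
    card_filter_eq_zero fun e h => h rfl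
  have hzero : wt (0 : Pauli Q) = 0 := card_filter_eq_zero fun e h => h rfl
  constructor
  · rintro (s | (v | v) | (i | i))
    · rw [deformedCode_check, wt_withEdges]
      have := hH.1 s
      have := (hfst (A.mat s)).trans (hA.mat s)
      have := (hsnd (B.mat s)).trans (hB.mat s)
      omega
    · rw [deformedCode_left, wt_withEdges, hnone]
      have := hA.attached v
      have := (hsnd (A.star v)).trans (hA.star v)
      omega
    · rw [deformedCode_right, wt_withEdges, hnone]
      have := hB.attached v
      have := (hfst (B.star v)).trans (hB.star v)
      omega
    · rw [deformedCode_cyc_left, wt_withEdges, hnone, hzero]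
      have := (hfst (A.cyc i)).trans (hA.cyc i)
      omega
    · rw [deformedCode_cyc_right, wt_withEdges, hnone, hzero]
      have := (hsnd (B.cyc i)).trans (hB.cyc i)
      omega
  · have hsplit : ∀ f : DeformedCheck A B → ZMod 2 × ZMod 2,
        (Finset.univ.filter fun c => f c ≠ 0).card =
        (Finset.univ.filter fun s => f (Sum.inl s) ≠ 0).card +
        (((Finset.univ.filter fun v => f (Sum.inr (Sum.inl (Sum.inl v))) ≠ 0).card +
          (Finset.univ.filter fun v => f (Sum.inr (Sum.inl (Sum.inr v))) ≠ 0).card) +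
        ((Finset.univ.filter fun i => f (Sum.inr (Sum.inr (Sum.inl i))) ≠ 0).card +
          (Finset.univ.filter fun i => f (Sum.inr (Sum.inr (Sum.inr i))) ≠ 0).card)) := by
      intro f
      simp only [Finset.card_filter, Fintype.sum_sum_type]
    rintro (q | e | e)
    · rw [hsplit]
      refine (Nat.add_le_add (hH.2 q) (Nat.add_le_add (Nat.add_le_add (A.card_attached_le q)
        (B.card_attached_le q)) (Nat.add_le_add (card_filter_eq_zero fun i h => h rfl).le
          (card_filter_eq_zero fun i h => h rfl).le))).trans ?_
      omega
    · rw [hsplit]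
      refine (Nat.add_le_add
        ((card_filter_mono fun s h h' => h (Prod.ext h' rfl)).trans (hA.edge_mat e))
        (Nat.add_le_add (Nat.add_le_add
          ((card_filter_mono fun v h h' => h (Prod.ext rfl h')).trans (A.card_star_edge_le e))
          (card_filter_eq_zero fun i h => h rfl).le) (Nat.add_le_add
          ((card_filter_mono fun i h h' => h (Prod.ext h' rfl)).trans (hA.edge_cyc e))
          (card_filter_eq_zero fun i h => h rfl).le))).trans ?_
      omega
    · rw [hsplit]
      refine (Nat.add_le_add
        ((card_filter_mono fun s h h' => h (Prod.ext rfl h')).trans (hB.edge_mat e))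
        (Nat.add_le_add (Nat.add_le_add (card_filter_eq_zero fun i h => h rfl).le
          ((card_filter_mono fun v h h' => h (Prod.ext h' rfl)).trans (B.card_star_edge_le e)))
          (Nat.add_le_add (card_filter_eq_zero fun i h => h rfl).le
          ((card_filter_mono fun i h h' => h (Prod.ext rfl h')).trans (hB.edge_cyc e))))).trans ?_
      omega

section Gadget

variable {Q S X : Type*} [Fintype Q] {H : S → Pauli Q} {P : Pauli Q} {pos : Q → X} {n : ℕ}
  [Fintype X] {G : SimpleGraph (Fin n)} {ι : X → Fin n} {D : ℕ}

theorem ncard_starMatching_le [Fintype S] {α β : ℕ} (hH : IsLDPC H α β) (port : Q → Fin n) (s : S) :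
    {e | starMatching H P G port s e ≠ 0}.ncard ≤ α := by
  classical
  rw [← card_filter_eq_ncard, starMatching]
  split_ifs with h
  · refine (card_support_sum_le _ _ 1 fun q _ => card_edgeVec_le _ _).trans ?_
    rw [mul_one]
    exact card_antiSet_le hH s
  · exact (card_filter_eq_zero fun e h => h rfl).le.trans (Nat.zero_le _)

theorem ncard_incidence_le (hG : DegreeLE G D) (v : Fin n) :
    {e : G.edgeSet | incidence G e v ≠ 0}.ncard ≤ D := by
  classical
  obtain ⟨N, hN, hN'⟩ := hG v
  have himage := (Finset.card_image_le (s := N) (f := fun w => s(v, w))).trans hN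
  rw [← Set.ncard_coe_finset] at himage
  refine le_trans ?_ himage
  refine Set.ncard_le_ncard_of_injOn (fun e : G.edgeSet => (e : Sym2 (Fin n))) ?_
    Subtype.val_injective.injOn (Set.toFinite _)
  rintro ⟨e, he⟩ hev
  induction e using Sym2.inductionOn with
  | hf x y =>
    have hv : v ∈ s(x, y) := by
      by_contra h'; exact hev (if_neg h')
    rw [Finset.mem_coe, Finset.mem_image]
    rcases Sym2.mem_iff.1 hv with rfl | rfl
    · exact ⟨y, hN' _ he, rfl⟩
    · exact ⟨x, hN' _ (show G.Adj x v from he).symm, Sym2.eq_swap⟩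

theorem ncard_walkCycle_le (t : Fin n × Fin n × Fin n × Fin n) :
    {e | walkCycle G t e ≠ 0}.ncard ≤ 4 := by
  classical
  rw [← card_filter_eq_ncard, walkCycle]
  split_ifs with h
  · have hsub : (Finset.univ.filter fun e : G.edgeSet => walkVec G t e ≠ 0) ⊆
        ((Finset.univ.filter fun e => edgeVec G t.1 t.2.1 e ≠ 0) ∪
        (Finset.univ.filter fun e => edgeVec G t.2.1 t.2.2.1 e ≠ 0)) ∪
        ((Finset.univ.filter fun e => edgeVec G t.2.2.1 t.2.2.2 e ≠ 0) ∪
        (Finset.univ.filter fun e => edgeVec G t.2.2.2 t.1 e ≠ 0)) := by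
      intro e he
      simp only [Finset.mem_union, Finset.mem_filter, Finset.mem_univ, true_and] at he ⊢
      by_contra! h'
      exact he (by simp only [walkVec, Pi.add_apply, h'.1.1, h'.1.2, h'.2.1, h'.2.2, add_zero])
    exact (Finset.card_le_card hsub).trans ((Finset.card_union_le _ _).trans (Nat.add_le_add
      ((Finset.card_union_le _ _).trans (Nat.add_le_add (card_edgeVec_le _ _) (card_edgeVec_le _ _)))
      ((Finset.card_union_le _ _).trans (Nat.add_le_add (card_edgeVec_le _ _) (card_edgeVec_le _ _)))))
  · exact (card_filter_eq_zero fun e h => h rfl).le.trans (Nat.zero_le _)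

/-- Both ends of an edge in the star of `s` are ports of qubits in the support of `s`. One end of
the edge hosts at most two qubits, and each of these lies in at most `β` checks. -/
theorem ncard_starMatching_edge_le [Fintype S] {α β : ℕ} (hH : IsLDPC H α β) {port : Q → Fin n}
    (hport : ∀ v, ∃ F : Finset Q, F.card ≤ 2 ∧ ∀ q, P q ≠ 0 → port q = v → q ∈ F)
    (e : G.edgeSet) : {s | starMatching H P G port s e ≠ 0}.ncard ≤ 2 * β := by
  classical
  obtain ⟨x, hx⟩ : ∃ x, x ∈ (e : Sym2 (Fin n)) := ⟨_, Sym2.out_fst_mem _⟩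
  obtain ⟨F, hF, hF'⟩ := hport x
  rw [← card_filter_eq_ncard]
  refine (Finset.card_le_card (t := F.biUnion fun q => Finset.univ.filter fun s => H s q ≠ 0) ?_).trans
    ((Finset.card_biUnion_le_card_mul _ _ β fun q _ => hH.2 q).trans (Nat.mul_le_mul_right _ hF))
  intro s hs
  rw [Finset.mem_filter, starMatching] at hs
  have hs := hs.2
  split_ifs at hs with h
  · rw [Finset.sum_apply] at hs
    obtain ⟨q, hq, hq'⟩ := Finset.exists_ne_zero_of_sum_ne_zero hs
    rw [edgeVec_ne_zero hq'] at hx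
    simp only [Finset.mem_biUnion, Finset.mem_filter, Finset.mem_univ, true_and]
    rcases Sym2.mem_iff.1 hx with h1 | h1
    · have := ne_zero_of_mem_antiSet h.choose_spec
      exact ⟨_, hF' _ this.2 h1.symm, this.1⟩
    · have := ne_zero_of_mem_antiSet hq
      exact ⟨_, hF' _ this.2 h1.symm, this.1⟩
  · exact absurd rfl hs

/-- A walk using the edge passes through its end `x`, so all four vertices lie within distance three
of `x`, in a ball `U` of at most `(D + 1) ^ 3` vertices. -/
theorem ncard_walkCycle_edge_le (hG : DegreeLE G D) (e : G.edgeSet) :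
    {t | walkCycle G t e ≠ 0}.ncard ≤ ((D + 1) * ((D + 1) * (D + 1))) ^ 4 := by
  classical
  choose N hN hN' using hG
  obtain ⟨x, hxe⟩ : ∃ x, x ∈ (e : Sym2 (Fin n)) := ⟨_, Sym2.out_fst_mem _⟩
  let L : Fin n → Finset (Fin n) := fun v => insert v (N v)
  have hL : ∀ v, (L v).card ≤ D + 1 := fun v =>
    (Finset.card_insert_le _ _).trans (Nat.add_le_add_right (hN v) 1)
  have hL' : ∀ v w, LazyAdj G v w → w ∈ L v := by
    rintro v w (rfl | h)
    · exact Finset.mem_insert_self _ _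
    · exact Finset.mem_insert_of_mem (hN' v w h)
  let U : Finset (Fin n) := (L x).biUnion fun y => (L y).biUnion L
  have hU : U.card ≤ (D + 1) * ((D + 1) * (D + 1)) := by
    refine (Finset.card_biUnion_le_card_mul _ _ ((D + 1) * (D + 1)) fun v _ => ?_).trans
      (Nat.mul_le_mul_right _ (hL x))
    exact (Finset.card_biUnion_le_card_mul _ _ (D + 1) fun w _ => hL w).trans
      (Nat.mul_le_mul_right _ (hL v))
  have hU' : ∀ a b c, LazyAdj G x a → LazyAdj G a b → LazyAdj G b c →
      x ∈ U ∧ a ∈ U ∧ b ∈ U ∧ c ∈ U := by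
    have hm : ∀ a b c, LazyAdj G x a → LazyAdj G a b → LazyAdj G b c → c ∈ U := by
      intro a b c h1 h2 h3
      simp only [U, Finset.mem_biUnion]
      exact ⟨a, hL' _ _ h1, b, hL' _ _ h2, hL' _ _ h3⟩
    intro a b c h1 h2 h3
    exact ⟨hm x x x (Or.inl rfl) (Or.inl rfl) (Or.inl rfl), hm x x a (Or.inl rfl) (Or.inl rfl) h1,
      hm x a b (Or.inl rfl) h1 h2, hm a b c h1 h2 h3⟩
  have hcard : (U ×ˢ U ×ˢ U ×ˢ U).card ≤ ((D + 1) * ((D + 1) * (D + 1))) ^ 4 := by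
    rw [Finset.card_product, Finset.card_product, Finset.card_product]
    calc _ = U.card ^ 4 := by ring
      _ ≤ _ := Nat.pow_le_pow_left hU 4
  refine le_trans ?_ hcard
  rw [← Set.ncard_coe_finset]
  refine Set.ncard_le_ncard ?_ (Set.toFinite _)
  rintro ⟨a, b, c, d⟩ ht
  rw [Set.mem_ofPred_eq, walkCycle] at ht
  rw [Finset.mem_coe]
  split_ifs at ht with h
  · obtain ⟨h1, h2, h3, h4⟩ := h
    dsimp only at h1 h2 h3 h4
    have hx : x = a ∨ x = b ∨ x = c ∨ x = d := by
      by_contra! hne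
      apply ht
      have hz : ∀ u v, x ≠ u → x ≠ v → edgeVec G u v e = 0 := by
        intro u v hu hv
        by_contra h0
        rw [edgeVec_ne_zero h0] at hxe
        rcases Sym2.mem_iff.1 hxe with h | h
        · exact hu h
        · exact hv h
      simp only [walkVec, Pi.add_apply, hz _ _ hne.1 hne.2.1, hz _ _ hne.2.1 hne.2.2.1,
        hz _ _ hne.2.2.1 hne.2.2.2, hz _ _ hne.2.2.2 hne.1, add_zero]
    simp only [Finset.mem_product]
    rcases hx with rfl | rfl | rfl | rfl
    · exact hU' _ _ _ h1 h2 h3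
    · obtain ⟨e1, e2, e3, e4⟩ := hU' _ _ _ h2 h3 h4
      exact ⟨e4, e1, e2, e3⟩
    · obtain ⟨e1, e2, e3, e4⟩ := hU' _ _ _ h3 h4 h1
      exact ⟨e3, e4, e1, e2⟩
    · obtain ⟨e1, e2, e3, e4⟩ := hU' _ _ _ h4 h1 h2
      exact ⟨e2, e3, e4, e1⟩
  · exact absurd rfl ht

theorem isSparse_auxGraph [Fintype S] {α β : ℕ} (hH : IsLDPC H α β)
    (hpos : ∀ x, ∃ F : Finset Q, F.card ≤ 2 ∧ ∀ q, P q ≠ 0 → pos q = x → q ∈ F)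
    (hG : IsGadget (portGraph H P pos) G ι D) (hP : IsLogical H P) :
    (hG.auxGraph hP).IsSparse 2 D α (2 * β) (((D + 1) * ((D + 1) * (D + 1))) ^ 4) := by
  classical
  have hport : ∀ v, ∃ F : Finset Q, F.card ≤ 2 ∧ ∀ q, P q ≠ 0 → (ι ∘ pos) q = v → q ∈ F := by
    intro v
    by_cases hv : ∃ x, ι x = v
    · obtain ⟨x, rfl⟩ := hv
      obtain ⟨F, hF, hF'⟩ := hpos x
      exact ⟨F, hF, fun q hq h => hF' q hq (hG.injective h)⟩
    · exact ⟨∅, by simp, fun q _ h => absurd ⟨_, h⟩ hv⟩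
  refine ⟨?_, ?_, ?_, ?_, ?_, ?_⟩
  · intro v
    obtain ⟨F, hF, hF'⟩ := hport v
    refine (Finset.card_le_card fun q hq => ?_).trans hF
    rw [Finset.mem_filter] at hq
    have hq := hq.2
    rw [AuxGraph.attached] at hq
    split_ifs at hq with h
    · exact hF' q hq h
    · exact absurd rfl hq
  · intro v
    rw [card_filter_eq_ncard]
    exact ncard_incidence_le hG.degreeLE v
  · intro s
    rw [card_filter_eq_ncard]
    exact ncard_starMatching_le hH _ s
  · intro i
    rw [card_filter_eq_ncard]
    exact ncard_walkCycle_le _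
  · intro e
    rw [card_filter_eq_ncard]
    exact ncard_starMatching_edge_le hH hport e
  · intro e
    rw [card_filter_eq_ncard]
    refine le_trans ?_ (ncard_walkCycle_edge_le hG.degreeLE e)
    refine Set.ncard_le_ncard_of_injOn (Fintype.equivFin (Fin n × Fin n × Fin n × Fin n)).symm ?_
      (Equiv.injective _).injOn (Set.toFinite _)
    intro i hi
    exact hi

/-- Each boundary edge accounts for two ordered pairs, which cancels the factor 2 in `ExpandsFrom`.
-/
theorem expands_auxGraph (hG : IsGadget (portGraph H P pos) G ι D) (hP : IsLogical H P)
    (u : Fin n → ZMod 2) :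
    ∃ ε : ZMod 2, (Finset.univ.filter fun x => u (ι x) ≠ ε).card ≤
      (Finset.univ.filter fun e => (hG.auxGraph hP).cobd u e ≠ 0).card := by
  classical
  obtain ⟨ε, hε⟩ := hG.expands u
  refine ⟨ε, ?_⟩
  let A := hG.auxGraph hP
  suffices h : {p : Fin n × Fin n | G.Adj p.1 p.2 ∧ u p.1 ≠ u p.2}.ncard ≤
      (Finset.univ.filter fun e => A.cobd u e ≠ 0).card * 2 from
    Nat.le_of_mul_le_mul_left ((hε.trans h).trans (mul_comm _ _).le) two_pos
  let val : A.Edge → Sym2 (Fin n) := fun e : G.edgeSet => (e : Sym2 (Fin n))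
  have hsub : {p : Fin n × Fin n | G.Adj p.1 p.2 ∧ u p.1 ≠ u p.2} ⊆
      ((Finset.univ.filter fun e => A.cobd u e ≠ 0).biUnion fun e =>
        Finset.univ.filter fun p : Fin n × Fin n => s(p.1, p.2) = val e :
        Finset (Fin n × Fin n)) := by
    rintro ⟨x, y⟩ ⟨h1, h2⟩
    rw [Finset.mem_coe, Finset.mem_biUnion]
    have h1' : A.graph.Adj x y := h1
    refine ⟨A.edge h1', ?_, ?_⟩
    · rw [Finset.mem_filter]
      refine ⟨Finset.mem_univ _, fun h3 => ?_⟩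
      exact h2 (CharTwo.add_eq_zero.1 ((A.cobd_edge u h1').symm.trans h3))
    · rw [Finset.mem_filter]
      exact ⟨Finset.mem_univ _, rfl⟩
  refine (Set.ncard_le_ncard hsub (Set.toFinite _)).trans ?_
  rw [Set.ncard_coe_finset]
  refine Finset.card_biUnion_le_card_mul _ _ 2 fun e _ => ?_
  obtain ⟨x, y, h, rfl⟩ := A.exists_edge e
  refine (Finset.card_le_card (t := {(x, y), (y, x)}) ?_).trans Finset.card_le_two
  rintro ⟨a, b⟩ hp
  have hp' : s(a, b) = s(x, y) := (Finset.mem_filter.1 hp).2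
  rw [Sym2.eq_iff] at hp'
  rcases hp' with ⟨rfl, rfl⟩ | ⟨rfl, rfl⟩
  · exact Finset.mem_insert_self _ _
  · exact Finset.mem_insert_of_mem (Finset.mem_singleton_self _)

end Gadget


/-! ### Two codeblocks -/

section Join

variable {Ql Sl Qr Sr : Type*} [Fintype Ql] [Fintype Qr] {Hl : Sl → Pauli Ql} {Hr : Sr → Pauli Qr}

theorem wt_zero {Q : Type*} [Fintype Q] : wt (0 : Pauli Q) = 0 :=
  card_filter_eq_zero fun _ h => h rfl

theorem isLDPC_joinCode [Fintype Sl] [Fintype Sr] {α β : ℕ} (hl : IsLDPC Hl α β)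
    (hr : IsLDPC Hr α β) : IsLDPC (joinCode Hl Hr) α β := by
  classical
  constructor
  · rintro (s | s)
    · refine (wt_sumElim (Hl s) 0).trans_le ?_
      rw [wt_zero]
      exact hl.1 s
    · refine (wt_sumElim 0 (Hr s)).trans_le ?_
      rw [wt_zero, zero_add]
      exact hr.1 s
  · rintro (q | q)
    · refine le_trans ?_ (hl.2 q)
      rw [← Finset.card_map Function.Embedding.inl (α := Sl) (β := Sl ⊕ Sr)]
      refine Finset.card_le_card fun s hs => ?_
      rw [Finset.mem_filter] at hs
      rcases s with s | s
      · exact Finset.mem_map_of_mem _ (Finset.mem_filter.2 ⟨Finset.mem_univ _, hs.2⟩)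
      · exact absurd rfl hs.2
    · refine le_trans ?_ (hr.2 q)
      rw [← Finset.card_map Function.Embedding.inr (α := Sr) (β := Sl ⊕ Sr)]
      refine Finset.card_le_card fun s hs => ?_
      rw [Finset.mem_filter] at hs
      rcases s with s | s
      · exact absurd rfl hs.2
      · exact Finset.mem_map_of_mem _ (Finset.mem_filter.2 ⟨Finset.mem_univ _, hs.2⟩)

theorem isLogical_joinCode (P : Pauli Ql) (R : Pauli Qr) :
    IsLogical (joinCode Hl Hr) (Sum.elim P R) ↔ IsLogical Hl P ∧ IsLogical Hr R := by
  have h1 : ∀ s, symp (Ql ⊕ Qr) (joinCode Hl Hr (Sum.inl s)) (Sum.elim P R) = symp Ql (Hl s) P :=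
    fun s => (symp_sumElim _ _ _ _).trans (by rw [LinearMap.map_zero, LinearMap.zero_apply, add_zero])
  have h2 : ∀ s, symp (Ql ⊕ Qr) (joinCode Hl Hr (Sum.inr s)) (Sum.elim P R) = symp Qr (Hr s) R :=
    fun s => (symp_sumElim _ _ _ _).trans (by rw [LinearMap.map_zero, LinearMap.zero_apply, zero_add])
  constructor
  · intro h
    exact ⟨fun s => (h1 s).symm.trans (h (Sum.inl s)), fun s => (h2 s).symm.trans (h (Sum.inr s))⟩
  · rintro ⟨hP, hR⟩ (s | s)
    · exact (h1 s).trans (hP s)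
    · exact (h2 s).trans (hR s)

theorem isStabilizerCode_joinCode (hl : IsStabilizerCode Hl) (hr : IsStabilizerCode Hr) :
    IsStabilizerCode (joinCode Hl Hr) := by
  intro s t
  rcases t with t | t
  · exact (isLogical_joinCode (Hl t) 0).2 ⟨fun s => hl s t, fun s => map_zero (symp Qr (Hr s))⟩ s
  · exact (isLogical_joinCode 0 (Hr t)).2 ⟨fun s => map_zero (symp Ql (Hl s)), fun s => hr s t⟩ s

/-- Operators on the left codeblock, seen as operators on both. -/
def inlPauli (Ql Qr : Type*) : Pauli Ql →ₗ[ZMod 2] Pauli (Ql ⊕ Qr) where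
  toFun P := Sum.elim P 0
  map_add' P R := by funext q; rcases q with q | q <;> simp
  map_smul' c P := by funext q; rcases q with q | q <;> simp

/-- Operators on the right codeblock, seen as operators on both. -/
def inrPauli (Ql Qr : Type*) : Pauli Qr →ₗ[ZMod 2] Pauli (Ql ⊕ Qr) where
  toFun P := Sum.elim 0 P
  map_add' P R := by funext q; rcases q with q | q <;> simp
  map_smul' c P := by funext q; rcases q with q | q <;> simp

theorem stab_joinCode :
    stab (joinCode Hl Hr) = (stab Hl).map (inlPauli Ql Qr) ⊔ (stab Hr).map (inrPauli Ql Qr) := by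
  rw [stab, stab, stab, Submodule.map_span, Submodule.map_span, ← Submodule.span_union,
    ← Set.range_comp, ← Set.range_comp, joinCode, Set.Sum.elim_range]
  rfl

theorem sumElim_mem_stab_joinCode {P : Pauli Ql} {R : Pauli Qr} (hP : P ∈ stab Hl) (hR : R ∈ stab Hr) :
    (Sum.elim P R : Pauli (Ql ⊕ Qr)) ∈ stab (joinCode Hl Hr) := by
  rw [stab_joinCode]
  have h : (Sum.elim P R : Pauli (Ql ⊕ Qr)) = inlPauli Ql Qr P + inrPauli Ql Qr R := by
    funext q; rcases q with q | q <;> simp [inlPauli, inrPauli]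
  rw [h]
  exact Submodule.add_mem_sup (Submodule.mem_map_of_mem hP) (Submodule.mem_map_of_mem hR)

/-- This inequality is all that is needed to see that the deformed code still encodes a qubit and so
has a distance. -/
theorem numLogical_add_le_numLogical_joinCode :
    numLogical Hl + numLogical Hr ≤ numLogical (joinCode Hl Hr) := by
  have h1 := Submodule.finrank_add_le_finrank_add_finrank
    ((stab Hl).map (inlPauli Ql Qr)) ((stab Hr).map (inrPauli Ql Qr))
  have h2 := Submodule.finrank_map_le (inlPauli Ql Qr) (stab Hl)
  have h3 := Submodule.finrank_map_le (inrPauli Ql Qr) (stab Hr)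
  rw [← stab_joinCode] at h1
  rw [numLogical, numLogical, numLogical, Fintype.card_sum]
  push_cast
  omega

theorem IsDistance.pos {Q S : Type*} [Fintype Q] {H : S → Pauli Q} {d : ℕ} (h : IsDistance H d) :
    0 < d := by
  obtain ⟨P, hP, rfl⟩ := h.1
  rw [Nat.pos_iff_ne_zero]
  intro h0
  apply hP.2
  have : P = 0 := by
    funext q
    by_contra hq
    exact (Finset.filter_eq_empty_iff.1 (Finset.card_eq_zero.1 h0)) (Finset.mem_univ q) hq
  rw [this]
  exact Submodule.zero_mem _

end Join

/-! ### The distance of the deformed code -/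

section Distance

variable {Ql Sl Qr Sr : Type*} [Fintype Ql] [Fintype Qr] {Hl : Sl → Pauli Ql} {Hr : Sr → Pauli Qr}

/-- Relative expansion on both codeblocks: the part of `P` attached to a vertex set or to its
complement has, on each block, at most the weight of the edge boundary. -/
def AuxGraph.ExpandsOnBlocks {S : Type*} {H : S → Pauli (Ql ⊕ Qr)} {P : Pauli (Ql ⊕ Qr)}
    (A : AuxGraph H P) : Prop :=
  ∀ u : Fin A.n → ZMod 2, ∃ ε : ZMod 2,
    wt (fun q => A.part (u + fun _ => ε) (Sum.inl q)) ≤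
      (Finset.univ.filter fun e => A.cobd u e ≠ 0).card ∧
    wt (fun q => A.part (u + fun _ => ε) (Sum.inr q)) ≤
      (Finset.univ.filter fun e => A.cobd u e ≠ 0).card

theorem pauli_add_self {Q : Type*} (P : Pauli Q) : P + P = 0 := by
  funext q
  exact Prod.ext (CharTwo.add_self_eq_zero _) (CharTwo.add_self_eq_zero _)

theorem wt_le_wt_add_add {Q : Type*} [Fintype Q] (M p r : Pauli Q) :
    wt M ≤ wt (M + p + r) + wt p + wt r := by
  have h1 := wt_add_le (M + p + r) (p + r)
  have h2 := wt_add_le p r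
  have h3 : M + p + r + (p + r) = M := by
    rw [add_assoc M p r, add_assoc, pauli_add_self, add_zero]
  rw [h3] at h1
  omega

/-- After cleaning, relative expansion bounds the weight of `T` from below by that of either block
of the cleaned operator, and at least one block is nontrivial. The only dangerous case is a left
block lighter than `dr`; it is excluded because the measured operators then reduce to left operators
modulo right stabilizers. -/
theorem le_wt_of_isNontrivialLogical [Fintype Sl] [Fintype Sr] {dl dr : ℕ} {Zl Xl X₁ Z₂ : Pauli Ql}
    {Zr Xr : Pauli Qr} (hl : IsStabilizerCode Hl) (h2 : numLogical Hl = 2) (hdl : IsDistance Hl dl)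
    (hZl : IsLogical Hl Zl) (hXl : IsLogical Hl Xl) (hX₁ : IsLogical Hl X₁) (hZ₂ : IsLogical Hl Z₂)
    (h1Z : symp Ql X₁ Zl ≠ 0) (h1X : symp Ql X₁ Xl = 0) (h2X : symp Ql Z₂ Xl ≠ 0)
    (h2Z : symp Ql Z₂ Zl = 0) (hNl : NonOverlapping Zl Xl)
    (hdr : IsDistance Hr dr) (hZr : IsLogical Hr Zr) (hXr : IsLogical Hr Xr) (hNr : NonOverlapping Zr Xr)
    (hwt : max (wt Zr) (wt Xr) ≤ dl)
    {P R : Pauli (Ql ⊕ Qr)} (hP : P = joinOp Zl Zr) (hR : R = joinOp Xl Xr)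
    {A : AuxGraph (joinCode Hl Hr) P} {B : AuxGraph (joinCode Hl Hr) R}
    (hA : A.ExpandsOnBlocks) (hB : B.ExpandsOnBlocks) {T : Pauli (DeformedQubit A B)}
    (hT : IsNontrivialLogical (deformedCode A B) T) : dr ≤ wt T := by
  have hN : NonOverlapping P R := by
    rw [hP, hR]
    rintro (q | q)
    · exact hNl q
    · exact hNr q
  have hZXl := symp_eq_zero_of_nonOverlapping hNl
  have hlogP : IsLogical (joinCode Hl Hr) P := hP ▸ (isLogical_joinCode Zl Zr).2 ⟨hZl, hZr⟩
  have hlogR : IsLogical (joinCode Hl Hr) R := hR ▸ (isLogical_joinCode Xl Xr).2 ⟨hXl, hXr⟩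
  obtain ⟨M, u, w, hM, hPM, hRM, hMW, hle⟩ := exists_cleaned A B hN hT
  obtain ⟨ε, hεl, hεr⟩ := hA u
  obtain ⟨δ, hδl, hδr⟩ := hB w
  have hPR : symp (Ql ⊕ Qr) P R = 0 := symp_eq_zero_of_nonOverlapping hN
  set W := stab (joinCode Hl Hr) ⊔ Submodule.span (ZMod 2) {P, R} with hW
  have hPW : P ∈ W := Submodule.mem_sup_right (Submodule.subset_span (Set.mem_insert _ _))
  have hRW : R ∈ W := Submodule.mem_sup_right
    (Submodule.subset_span (Set.mem_insert_of_mem _ (Set.mem_singleton _)))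
  -- Replacing `u` and `w` by the complements chosen by the expansion keeps the coboundaries and
  -- multiplies `M` by `P` or `R`.
  obtain ⟨M', hM'⟩ : ∃ M', M' = M + ε • P + δ • R := ⟨_, rfl⟩
  have hM'W : M' ∉ W := by
    intro h
    apply hMW
    have : M = M' - δ • R - ε • P := by rw [hM']; abel
    rw [this]
    exact W.sub_mem (W.sub_mem h (W.smul_mem _ hRW)) (W.smul_mem _ hPW)
  have hM'log : IsLogical (joinCode Hl Hr) M' := by
    rw [hM', ← mem_logicals]
    exact Submodule.add_mem _ (Submodule.add_mem _ (mem_logicals.2 hM)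
      (Submodule.smul_mem _ _ (mem_logicals.2 hlogP))) (Submodule.smul_mem _ _ (mem_logicals.2 hlogR))
  have hPM' : symp (Ql ⊕ Qr) P M' = 0 := by
    rw [hM', map_add, map_add, map_smul, map_smul, hPM, hPR, symp_self]; simp
  have hRM' : symp (Ql ⊕ Qr) R M' = 0 := by
    rw [hM', map_add, map_add, map_smul, map_smul, hRM, symp_comm R P, hPR, symp_self]; simp
  have hsum : M + A.part u + B.part w =
      M' + A.part (u + fun _ => ε) + B.part (w + fun _ => δ) := by
    rw [hM', A.part_add, B.part_add, A.part_const, B.part_const]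
    have e : M + ε • P + δ • R + (A.part u + ε • P) + (B.part w + δ • R) =
        M + A.part u + B.part w + (ε • P + ε • P) + (δ • R + δ • R) := by abel
    rw [e, pauli_add_self, pauli_add_self, add_zero, add_zero]
  rw [hsum] at hle
  set p := A.part (u + fun _ => ε)
  set r := B.part (w + fun _ => δ)
  have hsplit : wt (M' + p + r) = wt (fun q => (M' + p + r) (Sum.inl q)) +
      wt (fun q => (M' + p + r) (Sum.inr q)) := by
    rw [← wt_sumElim]
    congr 1
    exact (Sum.elim_comp_inl_inr (M' + p + r)).symm
  -- On one block, restoring the cleaned parts costs at most the edge weights, which `hle` counts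
  -- once. The other block of `T` is simply dropped, so the two bounds are used one at a time and
  -- never added.
  have hleft := wt_le_wt_add_add (fun q => M' (Sum.inl q)) (fun q => p (Sum.inl q))
    (fun q => r (Sum.inl q))
  have hright := wt_le_wt_add_add (fun q => M' (Sum.inr q)) (fun q => p (Sum.inr q))
    (fun q => r (Sum.inr q))
  have hel : ((fun q => M' (Sum.inl q)) + (fun q => p (Sum.inl q)) + fun q => r (Sum.inl q)) =
      fun q => (M' + p + r) (Sum.inl q) := rfl
  have her : ((fun q => M' (Sum.inr q)) + (fun q => p (Sum.inr q)) + fun q => r (Sum.inr q)) =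
      fun q => (M' + p + r) (Sum.inr q) := rfl
  rw [hel] at hleft
  rw [her] at hright
  obtain ⟨Ml, hMl⟩ : ∃ Ml : Pauli Ql, Ml = fun q => M' (Sum.inl q) := ⟨_, rfl⟩
  obtain ⟨Mr, hMr⟩ : ∃ Mr : Pauli Qr, Mr = fun q => M' (Sum.inr q) := ⟨_, rfl⟩
  have hMe : M' = Sum.elim Ml Mr := by
    rw [hMl, hMr]; exact (Sum.elim_comp_inl_inr M').symm
  rw [← hMl] at hleft
  rw [← hMr] at hright
  rw [hMe, isLogical_joinCode] at hM'log
  -- A right stabilizer commutes with `Zr` and `Xr`, so commutation with the joint operators passes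
  -- to the left block.
  by_cases hMrs : Mr ∈ stab Hr
  · rw [hMe, hP, joinOp, symp_sumElim, symp_comm Zr, symp_eq_zero_of_mem_stab hZr hMrs,
      add_zero] at hPM'
    rw [hMe, hR, joinOp, symp_sumElim, symp_comm Xr, symp_eq_zero_of_mem_stab hXr hMrs,
      add_zero] at hRM'
    have hMls : Ml ∉ stab Hl := by
      intro h
      apply hM'W
      rw [hMe]
      exact Submodule.mem_sup_left (sumElim_mem_stab_joinCode h hMrs)
    have h1 : dl ≤ wt Ml := hdl.2 ⟨Ml, ⟨hM'log.1, hMls⟩, rfl⟩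
    have h3 : dr ≤ dl := by
      -- Now `Zr` and `Xr` have weight at most `dl < dr` and must be stabilizers. The left block is
      -- generated by `Zl`, `Xl` and stabilizers, and trading `Zl`, `Xl` for `P`, `R` changes the
      -- right block only by stabilizers, so `M'` would lie in `W`.
      by_contra hlt
      have hZs : Zr ∈ stab Hr := by
        by_contra h
        have := hdr.2 ⟨Zr, ⟨hZr, h⟩, rfl⟩
        have := le_max_left (wt Zr) (wt Xr)
        omega
      have hXs : Xr ∈ stab Hr := by
        by_contra h
        have := hdr.2 ⟨Xr, ⟨hXr, h⟩, rfl⟩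
        have := le_max_right (wt Zr) (wt Xr)
        omega
      have hmem := mem_sup_of_commute hl h2 hZl hXl hX₁ hZ₂ hZXl h1Z h1X h2X h2Z hM'log.1 hPM' hRM'
      rw [mem_sup_span_pair] at hmem
      obtain ⟨c, i, j, hc⟩ := hmem
      apply hM'W
      have hst : (Sum.elim (∑ s, c s • Hl s) (Mr - i • Zr - j • Xr) : Pauli (Ql ⊕ Qr)) ∈
          stab (joinCode Hl Hr) :=
        sumElim_mem_stab_joinCode
          (Submodule.sum_mem _ fun s _ => Submodule.smul_mem _ _ (Submodule.subset_span ⟨s, rfl⟩))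
          (Submodule.sub_mem _ (Submodule.sub_mem _ hMrs (Submodule.smul_mem _ _ hZs))
            (Submodule.smul_mem _ _ hXs))
      have hdec : M' = Sum.elim (∑ s, c s • Hl s) (Mr - i • Zr - j • Xr) + i • P + j • R := by
        rw [hMe, hc, hP, hR, joinOp, joinOp]
        funext q
        rcases q with q | q
        · rfl
        · show Mr q = Mr q - i • Zr q - j • Xr q + i • Zr q + j • Xr q
          abel
      rw [hdec]
      exact W.add_mem (W.add_mem (Submodule.mem_sup_left hst) (W.smul_mem _ hPW)) (W.smul_mem _ hRW)
    omega
  · have h1 : dr ≤ wt Mr := hdr.2 ⟨Mr, ⟨hM'log.2, hMrs⟩, rfl⟩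
    omega

end Distance


/-! ### Auxiliary graphs for two codeblocks -/

theorem exists_injOn_support {Q X : Type*} [Fintype Q] [Fintype X] [Nonempty X] (P : Pauli Q)
    (h : wt P ≤ Fintype.card X) : ∃ f : Q → X, Set.InjOn f {q | P q ≠ 0} := by
  classical
  obtain ⟨f⟩ : Nonempty ({q // P q ≠ 0} ↪ X) := by
    refine Function.Embedding.nonempty_of_card_le ?_
    rw [Fintype.card_subtype]
    exact h
  refine ⟨fun q => if hq : P q ≠ 0 then f ⟨q, hq⟩ else Classical.arbitrary X, ?_⟩
  intro q hq q' hq' heq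
  have hq₁ : P q ≠ 0 := hq
  have hq₂ : P q' ≠ 0 := hq'
  simp only [dif_pos hq₁, dif_pos hq₂] at heq
  exact congrArg Subtype.val (f.injective heq)

theorem wt_le_card_of_injOn {Q X : Type*} [Fintype Q] [Fintype X] {P L : Pauli Q} {f : Q → X}
    (hf : Set.InjOn f {q | P q ≠ 0}) {p : X → Prop} [DecidablePred p]
    (h : ∀ q, L q ≠ 0 → P q ≠ 0 ∧ p (f q)) : wt L ≤ (Finset.univ.filter p).card := by
  classical
  refine Finset.card_le_card_of_injOn f (fun q hq => ?_) fun q hq q' hq' heq => ?_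
  · rw [Finset.mem_coe, Finset.mem_filter] at *
    exact ⟨Finset.mem_univ _, (h q hq.2).2⟩
  · rw [Finset.mem_coe, Finset.mem_filter] at *
    exact hf (h q hq.2).1 (h q' hq'.2).1 heq

section

variable {Ql Qr S : Type*} [Fintype Ql] [Fintype Qr] [Fintype S] {H : S → Pauli (Ql ⊕ Qr)}

/-- The supports on the two blocks are injected independently into the same `X`, so a vertex carries
at most one qubit of each block. One colour `ε` from the expansion then serves both blocks at once.
-/
theorem exists_auxGraph {α β : ℕ} (hH : IsLDPC H α β) {P : Pauli (Ql ⊕ Qr)} (hP : IsLogical H P)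
    (k : ℕ) (hl : wt (fun q => P (Sum.inl q)) ≤ 2 ^ k) (hr : wt (fun q => P (Sum.inr q)) ≤ 2 ^ k) :
    ∃ A : AuxGraph H P, A.n = 2 ^ k * (2 * k + 1) ^ 2 ∧ A.PortInjective ∧ A.ExpandsOnBlocks ∧
      A.IsSparse 2 (2 * 2 + 2 * (1 + 2 * (2 * (2 * (β * α)) + 1))) α (2 * β)
        (((2 * 2 + 2 * (1 + 2 * (2 * (2 * (β * α)) + 1)) + 1) *
          ((2 * 2 + 2 * (1 + 2 * (2 * (2 * (β * α)) + 1)) + 1) *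
          (2 * 2 + 2 * (1 + 2 * (2 * (2 * (β * α)) + 1)) + 1))) ^ 4) := by
  classical
  obtain ⟨X, _, hX, hgad⟩ := exists_gadget (2 * (β * α)) k
  have : Nonempty X := Fintype.card_pos_iff.1 (by rw [hX]; positivity)
  obtain ⟨fl, hfl⟩ := exists_injOn_support (X := X) _ (hl.trans hX.ge)
  obtain ⟨fr, hfr⟩ := exists_injOn_support (X := X) _ (hr.trans hX.ge)
  let pos : Ql ⊕ Qr → X := Sum.elim fl fr
  have hpos : ∀ x, ∃ F : Finset (Ql ⊕ Qr), F.card ≤ 2 ∧ ∀ q, P q ≠ 0 → pos q = x → q ∈ F := by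
    intro x
    let Fl := Finset.univ.filter fun q => P (Sum.inl q) ≠ 0 ∧ fl q = x
    let Fr := Finset.univ.filter fun q => P (Sum.inr q) ≠ 0 ∧ fr q = x
    have hFl : Fl.card ≤ 1 := Finset.card_le_one.2 fun q hq q' hq' => by
      rw [Finset.mem_filter] at hq hq'
      exact hfl hq.2.1 hq'.2.1 (hq.2.2.trans hq'.2.2.symm)
    have hFr : Fr.card ≤ 1 := Finset.card_le_one.2 fun q hq q' hq' => by
      rw [Finset.mem_filter] at hq hq'
      exact hfr hq.2.1 hq'.2.1 (hq.2.2.trans hq'.2.2.symm)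
    refine ⟨Fl.disjSum Fr, ?_, ?_⟩
    · rw [Finset.card_disjSum]; omega
    · rintro (q | q) hq hx
      · exact Finset.inl_mem_disjSum.2 (Finset.mem_filter.2 ⟨Finset.mem_univ _, hq, hx⟩)
      · exact Finset.inr_mem_disjSum.2 (Finset.mem_filter.2 ⟨Finset.mem_univ _, hq, hx⟩)
  obtain ⟨G, ι, hG⟩ := hgad (portGraph H P pos) (degreeLE_portGraph hH hpos)
  have hzmod : ∀ a b : ZMod 2, a + b ≠ 0 → a ≠ b := by decide
  refine ⟨hG.auxGraph hP, rfl, ⟨?_, ?_⟩, ?_, isSparse_auxGraph hH hpos hG hP⟩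
  · intro q hq q' hq' h
    exact hfl hq hq' (hG.injective h)
  · intro q hq q' hq' h
    exact hfr hq hq' (hG.injective h)
  · intro u
    obtain ⟨ε, hε⟩ := expands_auxGraph hG hP u
    have hpart : ∀ q, (hG.auxGraph hP).part (u + fun _ => ε) q ≠ 0 → P q ≠ 0 ∧ u (ι (pos q)) ≠ ε := by
      intro q hq
      rw [AuxGraph.part_apply] at hq
      exact ⟨fun h => hq (by rw [h, smul_zero]),
        hzmod _ _ fun h => hq (smul_eq_zero_of_left h _)⟩
    refine ⟨ε, le_trans ?_ hε, le_trans ?_ hε⟩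
    · exact wt_le_card_of_injOn hfl fun q hq => hpart (Sum.inl q) hq
    · exact wt_le_card_of_injOn hfr fun q hq => hpart (Sum.inr q) hq

end

/-- The left side is of order `d log² d`. For `d ≥ 2` a further logarithm is bounded below by `log
2`; the summand `1` covers `d = 1`, where the logarithm vanishes. -/
theorem two_pow_clog_mul_le {d : ℕ} (hd : 0 < d) :
    ((2 ^ Nat.clog 2 d * (2 * Nat.clog 2 d + 1) ^ 2 : ℕ) : ℝ) ≤
      243 * (d * Real.log d ^ 3 + 1) := by
  rcases Nat.lt_or_ge d 2 with h | h
  · have h1 : d = 1 := by omega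
    subst h1
    norm_num
  · set k := Nat.clog 2 d with hk
    have hk1 : 1 ≤ k := Nat.clog_pos one_lt_two h
    have hlt : 2 ^ (k - 1) < d := Nat.pow_pred_clog_lt_self one_lt_two h
    obtain ⟨m, hm⟩ : ∃ m, k = m + 1 := ⟨k - 1, by omega⟩
    have hm' : k - 1 = m := by omega
    rw [hm'] at hlt
    have hltR : (2 : ℝ) ^ m ≤ d := by exact_mod_cast hlt.le
    have hlog2 := Real.log_two_gt_d9
    have hdR : (2 : ℝ) ≤ d := by exact_mod_cast h
    have hL : Real.log 2 ≤ Real.log d := Real.log_le_log (by norm_num) hdR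
    have hmL : m * Real.log 2 ≤ Real.log d := by
      rw [← Real.log_pow]
      exact Real.log_le_log (by positivity) hltR
    set L := Real.log d
    have hm0 : (0 : ℝ) ≤ m := Nat.cast_nonneg m
    -- Both `m * log 2` and `log 2` are at most `L`, so the left side is at most `5 L / log 2 < 9
    -- L`. The constant `121` below works since `81 ≤ 121 log 2`, and `243` exceeds `2 * 121`.
    have hlin : 2 * ((m : ℝ) + 1) + 1 ≤ 9 * L := by nlinarith
    have hsq : (2 * ((m : ℝ) + 1) + 1) ^ 2 ≤ (9 * L) ^ 2 := pow_le_pow_left₀ (by positivity) hlin 2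
    have hcube : (9 * L) ^ 2 ≤ 121 * L ^ 3 := by
      have : (9 * L) ^ 2 = 81 * L ^ 2 := by ring
      rw [this, pow_succ L 2]
      nlinarith [sq_nonneg L, mul_nonneg (sq_nonneg L) (show (0 : ℝ) ≤ L - 0.6931471803 by linarith)]
    rw [hm]
    push_cast
    have h2 : (2 : ℝ) ^ (m + 1) ≤ 2 * d := by rw [pow_succ]; linarith
    have hL3 : 0 ≤ d * L ^ 3 := mul_nonneg (by linarith) (pow_nonneg (by linarith) 3)
    calc (2 : ℝ) ^ (m + 1) * (2 * ((m : ℝ) + 1) + 1) ^ 2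
        ≤ (2 * d) * (121 * L ^ 3) :=
          mul_le_mul h2 (hsq.trans hcube) (sq_nonneg _) (by positivity)
      _ ≤ 243 * (d * L ^ 3 + 1) := by nlinarith

theorem exists_auxGraphs_of_isLeftCode (α β : ℕ) : ∃ (α' β' : ℕ) (c : ℝ),
    ∀ (Ql Sl Qr Sr : Type*) [Fintype Ql] [Fintype Sl] [Fintype Qr] [Fintype Sr]
      (Hl : Sl → Pauli Ql) (Hr : Sr → Pauli Qr) (dl dr : ℕ)
      (Zl Xl : Pauli Ql) (Zr Xr : Pauli Qr),
      IsLDPC Hr α β → IsStabilizerCode Hr → IsDistance Hr dr →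
      IsLogical Hr Zr → IsLogical Hr Xr → NonOverlapping Zr Xr →
      IsLDPC Hl α β → IsLeftCode Hl dl Zl Xl → max (wt Zr) (wt Xr) ≤ dl →
      ∃ (A : AuxGraph (joinCode Hl Hr) (joinOp Zl Zr)) (B : AuxGraph (joinCode Hl Hr) (joinOp Xl Xr)),
        A.PortInjective ∧ B.PortInjective ∧
        (A.size : ℝ) ≤ c * (dl * Real.log dl ^ 3 + 1) ∧
        (B.size : ℝ) ≤ c * (dl * Real.log dl ^ 3 + 1) ∧
        IsStabilizerCode (deformedCode A B) ∧ MeasuresExactly A B ∧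
        IsLDPC (deformedCode A B) α' β' ∧ ∃ d, IsDistance (deformedCode A B) d ∧ dr ≤ d := by
  obtain ⟨D, hD⟩ : ∃ D, D = 2 * 2 + 2 * (1 + 2 * (2 * (2 * (β * α)) + 1)) := ⟨_, rfl⟩
  obtain ⟨κ, hκ⟩ : ∃ κ, κ = ((D + 1) * ((D + 1) * (D + 1))) ^ 4 := ⟨_, rfl⟩
  refine ⟨α + 2 * α + 2 + D + 4, β + 2 + 2 * β + κ, 243 * (1 + D), ?_⟩
  intro Ql Sl Qr Sr _ _ _ _ Hl Hr dl dr Zl Xl Zr Xr hrL hr hdr hZr hXr hNr hlL hleft hmax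
  obtain ⟨X₁, Z₂, hX₁, hZ₂, h1Z, h1X, h2X, h2Z, -, -⟩ := hleft.irreducible
  have hL := isLDPC_joinCode hlL hrL
  have hS := isStabilizerCode_joinCode hleft.stabilizer hr
  have hP : IsLogical (joinCode Hl Hr) (joinOp Zl Zr) :=
    (isLogical_joinCode Zl Zr).2 ⟨hleft.logical_Z, hZr⟩
  have hR : IsLogical (joinCode Hl Hr) (joinOp Xl Xr) :=
    (isLogical_joinCode Xl Xr).2 ⟨hleft.logical_X, hXr⟩
  have hN : NonOverlapping (joinOp Zl Zr) (joinOp Xl Xr) := by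
    rintro (q | q)
    · exact hleft.nonOverlapping q
    · exact hNr q
  have hclog : dl ≤ 2 ^ Nat.clog 2 dl := Nat.le_pow_clog one_lt_two dl
  -- The number of ports is the least power of two not below `dl`, which bounds the weights of the
  -- measured operators on both blocks.
  obtain ⟨A, hAn, hAp, hAe, hAs⟩ := exists_auxGraph hL hP (Nat.clog 2 dl)
    (hleft.weight_Z.trans_le hclog) (((le_max_left _ _).trans hmax).trans hclog)
  obtain ⟨B, hBn, hBp, hBe, hBs⟩ := exists_auxGraph hL hR (Nat.clog 2 dl)
    (hleft.weight_X.trans_le hclog) (((le_max_right _ _).trans hmax).trans hclog)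
  rw [← hD, ← hκ] at hAs hBs
  have hsize : ∀ {n s : ℕ}, n = 2 ^ Nat.clog 2 dl * (2 * Nat.clog 2 dl + 1) ^ 2 → s ≤ n * (1 + D) →
      (s : ℝ) ≤ 243 * (1 + D) * (dl * Real.log dl ^ 3 + 1) := by
    intro n s hn hs
    have h1 := two_pow_clog_mul_le hleft.distance.pos
    rw [← hn] at h1
    have h2 : (s : ℝ) ≤ n * (1 + D) := by exact_mod_cast hs
    have h3 : (0 : ℝ) ≤ 1 + D := by positivity
    refine h2.trans ((mul_le_mul_of_nonneg_right h1 h3).trans_eq ?_)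
    ring
  have hφ : ∀ Y, IsLogical Hl Y → ∀ x ∈ stab (joinCode Hl Hr),
      symp (Ql ⊕ Qr) (Sum.elim Y 0) x = 0 := by
    intro Y hY x hx
    rw [symp_comm]
    exact symp_eq_zero_of_mem_stab
      ((isLogical_joinCode Y 0).2 ⟨hY, fun s => map_zero (symp Qr (Hr s))⟩) hx
  have hval : ∀ (Y L : Pauli Ql) (L' : Pauli Qr),
      symp (Ql ⊕ Qr) (Sum.elim Y 0) (joinOp L L') = symp Ql Y L := by
    intro Y L L'
    rw [joinOp, symp_sumElim, LinearMap.map_zero, LinearMap.zero_apply, add_zero]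
  -- The conjugate logical operators `X₁` and `Z₂` of the left code, extended by the identity, tell
  -- the two measured operators apart from each other and from stabilizers.
  have hM : MeasuresExactly A B := measuresExactly_deformedCode A B
    (symp (Ql ⊕ Qr) (Sum.elim X₁ 0)) (symp (Ql ⊕ Qr) (Sum.elim Z₂ 0)) (hφ X₁ hX₁) (hφ Z₂ hZ₂)
    (by rw [hval]; exact h1Z) (by rw [hval]; exact h1X) (by rw [hval]; exact h2X)
    (by rw [hval]; exact h2Z)
  -- The left code has two qubits and the right code at least one, since it has a distance;
  -- measuring removes only two.
  obtain ⟨d, hd⟩ : ∃ d, IsDistance (deformedCode A B) d := by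
    apply exists_isDistance
    apply exists_nontrivialLogical
    have h1 := numLogical_add_le_numLogical_joinCode (Hl := Hl) (Hr := Hr)
    have h2 := hleft.two_qubits
    have h3 : 0 < numLogical Hr := numLogical_pos hr ⟨_, hdr.1.choose_spec.1⟩
    rw [hM.numLogical_eq]
    omega
  refine ⟨A, B, hAp, hBp, hsize hAn hAs.size_le, hsize hBn hBs.size_le,
    isStabilizerCode_deformedCode A B hS hN, hM, isLDPC_deformedCode hL hAs hBs, d, hd, ?_⟩
  obtain ⟨T, hT, rfl⟩ := hd.1
  exact le_wt_of_isNontrivialLogical hleft.stabilizer hleft.two_qubits hleft.distance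
    hleft.logical_Z hleft.logical_X hX₁ hZ₂ h1Z h1X h2X h2Z hleft.nonOverlapping hdr hZr hXr hNr hmax
    rfl rfl hAe hBe hT


/-! ### The toric code -/

theorem card_le_wt_of_injective {ι Q : Type*} [Fintype ι] [Fintype Q] {P : Pauli Q} (f : ι → Q)
    (hf : Function.Injective f) (h : ∀ i, P (f i) ≠ 0) : Fintype.card ι ≤ wt P :=
  Finset.card_le_card_of_injOn f (fun i _ => Finset.mem_coe.2 (Finset.mem_filter.2
    ⟨Finset.mem_univ _, h i⟩)) hf.injOn

theorem wt_single_le {Q : Type*} [Fintype Q] [DecidableEq Q] (q : Q) (a : ZMod 2 × ZMod 2) :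
    wt (Pi.single q a : Pauli Q) ≤ 1 := by
  have h : ∀ q', (Pi.single q a : Pauli Q) q' ≠ 0 → q' = q := fun q' hq' => by
    by_contra h
    exact hq' (by rw [Pi.single_apply, if_neg h])
  refine Finset.card_le_one.2 fun q₁ h₁ q₂ h₂ => ?_
  rw [h q₁ (Finset.mem_filter.1 h₁).2, h q₂ (Finset.mem_filter.1 h₂).2]

theorem symp_single {Q : Type*} [Fintype Q] [DecidableEq Q] (q : Q) (a : ZMod 2 × ZMod 2)
    (P : Pauli Q) : symp Q (Pi.single q a) P = localSymp a (P q) := by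
  rw [symp_apply, Finset.sum_eq_single q, Pi.single_eq_same]
  · intro q' _ h
    rw [Pi.single_eq_of_ne h]
    simp [localSymp]
  · intro h
    exact absurd (Finset.mem_univ _) h

/-! ### Conserved sums on the periodic lattice -/

section ZModSums

variable {d : ℕ} [NeZero d]

theorem eq_apply_zero_of_shift {α : Type*} {f : ZMod d → α} (h : ∀ i, f (i + 1) = f i) (i : ZMod d) :
    f i = f 0 := by
  obtain ⟨n, rfl⟩ := ZMod.natCast_zmod_surjective i
  induction n with
  | zero => simp
  | succ n ih => rw [Nat.cast_succ, h, ih]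

theorem eq_apply_zero_of_shift_or {α : Type*} {s : ZMod d} (hs : s = 1 ∨ s = -1) {f : ZMod d → α}
    (h : ∀ i, f (i + s) = f i) (i : ZMod d) : f i = f 0 := by
  rcases hs with rfl | rfl
  · exact eq_apply_zero_of_shift h i
  · refine eq_apply_zero_of_shift (fun i => ?_) i
    rw [← h (i + 1), add_neg_cancel_right]

/-- A discrete conservation law: summed over `j`, the two terms in `h` cancel by periodicity, so
consecutive line sums of `g` agree. -/
theorem sum_eq_of_shift {s : ZMod d} (hs : s = 1 ∨ s = -1) {g h : ZMod d → ZMod d → ZMod 2}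
    (H : ∀ i j, g i j + g (i + s) j + h i j + h i (j + s) = 0) (i : ZMod d) :
    ∑ j, g i j = ∑ j, g 0 j := by
  refine eq_apply_zero_of_shift_or hs (f := fun i => ∑ j, g i j) (fun i => ?_) i
  have h1 : ∑ j, (g i j + g (i + s) j + h i j + h i (j + s)) = 0 :=
    Finset.sum_eq_zero fun j _ => H i j
  have h2 : ∑ j, h i (j + s) = ∑ j, h i j := Equiv.sum_comp (Equiv.addRight s) (h i)
  rw [Finset.sum_add_distrib, Finset.sum_add_distrib, Finset.sum_add_distrib,
    h2, add_assoc, CharTwo.add_self_eq_zero, add_zero] at h1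
  exact (CharTwo.add_eq_zero.1 h1).symm

end ZModSums

/-! ### Checks, rank and string operators of the toric code -/

section Toric

variable {d : ℕ} [NeZero d]

/-- The qubits of the toric code. -/
abbrev ToricQubit (d : ℕ) := (ZMod d × ZMod d) ⊕ (ZMod d × ZMod d)

theorem symp_toricCode_inl (i j : ZMod d) (P : Pauli (ToricQubit d)) :
    symp (ToricQubit d) (toricCode d (Sum.inl (i, j))) P = (P (Sum.inl (i, j))).2 + (P (Sum.inl (i - 1, j))).2 +
      (P (Sum.inr (i, j))).2 + (P (Sum.inr (i, j - 1))).2 := by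
  simp only [toricCode, map_add, LinearMap.add_apply, symp_single, localSymp]
  ring

theorem symp_toricCode_inr (i j : ZMod d) (P : Pauli (ToricQubit d)) :
    symp (ToricQubit d) (toricCode d (Sum.inr (i, j))) P = (P (Sum.inl (i, j))).1 + (P (Sum.inl (i, j + 1))).1 +
      (P (Sum.inr (i, j))).1 + (P (Sum.inr (i + 1, j))).1 := by
  simp only [toricCode, map_add, LinearMap.add_apply, symp_single, localSymp]
  ring

theorem isLogical_toricCode {P : Pauli (ToricQubit d)} : IsLogical (toricCode d) P ↔
    (∀ i j, (P (Sum.inl (i, j))).2 + (P (Sum.inl (i - 1, j))).2 +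
      (P (Sum.inr (i, j))).2 + (P (Sum.inr (i, j - 1))).2 = 0) ∧
    ∀ i j, (P (Sum.inl (i, j))).1 + (P (Sum.inl (i, j + 1))).1 +
      (P (Sum.inr (i, j))).1 + (P (Sum.inr (i + 1, j))).1 = 0 := by
  constructor
  · intro h
    exact ⟨fun i j => (symp_toricCode_inl i j P).symm.trans (h _),
      fun i j => (symp_toricCode_inr i j P).symm.trans (h _)⟩
  · rintro ⟨h1, h2⟩ (⟨i, j⟩ | ⟨i, j⟩)
    · exact (symp_toricCode_inl i j P).trans (h1 i j)
    · exact (symp_toricCode_inr i j P).trans (h2 i j)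

theorem isLDPC_toricCode (d : ℕ) [NeZero d] : IsLDPC (toricCode d) 4 4 := by
  classical
  constructor
  · rintro (⟨i, j⟩ | ⟨i, j⟩)
    all_goals
      refine (wt_add_le _ _).trans ?_
      refine (Nat.add_le_add ((wt_add_le _ _).trans (Nat.add_le_add ((wt_add_le _ _).trans
        (Nat.add_le_add (wt_single_le _ _) (wt_single_le _ _))) (wt_single_le _ _)))
        (wt_single_le _ _)).trans ?_
      norm_num
  · rintro (⟨i, j⟩ | ⟨i, j⟩)
    · refine (Finset.card_le_card (t := {Sum.inl (i, j), Sum.inl (i + 1, j), Sum.inr (i, j),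
        Sum.inr (i, j - 1)}) ?_).trans Finset.card_le_four
      rintro (⟨a, b⟩ | ⟨a, b⟩) hs
      · have h := (Finset.mem_filter.1 hs).2
        by_contra hc
        simp only [Finset.mem_insert, Finset.mem_singleton, Sum.inl.injEq, Prod.mk.injEq,
          reduceCtorEq, or_false, not_or] at hc
        apply h
        have h1 : ¬(i = a ∧ j = b) := fun h => hc.1 ⟨h.1.symm, h.2.symm⟩
        have h2 : ¬(i = a - 1 ∧ j = b) := fun h => hc.2 ⟨by rw [h.1, sub_add_cancel], h.2.symm⟩
        simp [toricCode, h1, h2]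
      · have h := (Finset.mem_filter.1 hs).2
        by_contra hc
        simp only [Finset.mem_insert, Finset.mem_singleton, Sum.inr.injEq, Prod.mk.injEq,
          reduceCtorEq, false_or, not_or] at hc
        apply h
        have h1 : ¬(i = a ∧ j = b) := fun h => hc.1 ⟨h.1.symm, h.2.symm⟩
        have h2 : ¬(i = a ∧ j = b + 1) := fun h => hc.2 ⟨h.1.symm, by rw [h.2, add_sub_cancel_right]⟩
        simp [toricCode, h1, h2]
    · refine (Finset.card_le_card (t := {Sum.inl (i, j), Sum.inl (i, j + 1), Sum.inr (i, j),
        Sum.inr (i - 1, j)}) ?_).trans Finset.card_le_four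
      rintro (⟨a, b⟩ | ⟨a, b⟩) hs
      · have h := (Finset.mem_filter.1 hs).2
        by_contra hc
        simp only [Finset.mem_insert, Finset.mem_singleton, Sum.inl.injEq, Prod.mk.injEq,
          reduceCtorEq, or_false, not_or] at hc
        apply h
        have h1 : ¬(i = a ∧ j = b) := fun h => hc.1 ⟨h.1.symm, h.2.symm⟩
        have h2 : ¬(i = a ∧ j = b - 1) := fun h => hc.2 ⟨h.1.symm, by rw [h.2, sub_add_cancel]⟩
        simp [toricCode, h1, h2]
      · have h := (Finset.mem_filter.1 hs).2
        by_contra hc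
        simp only [Finset.mem_insert, Finset.mem_singleton, Sum.inr.injEq, Prod.mk.injEq,
          reduceCtorEq, false_or, not_or] at hc
        apply h
        have h1 : ¬(i = a ∧ j = b) := fun h => hc.1 ⟨h.1.symm, h.2.symm⟩
        have h2 : ¬(i = a + 1 ∧ j = b) := fun h => hc.2 ⟨by rw [h.1, add_sub_cancel_right], h.2.symm⟩
        simp [toricCode, h1, h2]

theorem sum_smul_single_inl {V W : Type*} [Fintype V] [DecidableEq V] [DecidableEq W] (σ : Equiv.Perm V)
    (c : V → ZMod 2) (a : ZMod 2 × ZMod 2) :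
    ∑ p, c p • (Pi.single (Sum.inl (σ p)) a : Pauli (V ⊕ W)) =
      Sum.elim (fun p => c (σ.symm p) • a) (0 : Pauli W) := by
  funext q
  rw [Finset.sum_apply]
  rcases q with q | q
  · rw [Finset.sum_eq_single (σ.symm q)]
    · simp
    · intro p _ hp
      have : q ≠ σ p := fun h => hp (by rw [h, Equiv.symm_apply_apply])
      simp [this]
    · intro h; exact absurd (Finset.mem_univ _) h
  · exact Finset.sum_eq_zero fun p _ => by simp

theorem sum_smul_single_inr {V W : Type*} [Fintype V] [DecidableEq V] [DecidableEq W] (σ : Equiv.Perm V)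
    (c : V → ZMod 2) (a : ZMod 2 × ZMod 2) :
    ∑ p, c p • (Pi.single (Sum.inr (σ p)) a : Pauli (W ⊕ V)) =
      Sum.elim (0 : Pauli W) (fun p => c (σ.symm p) • a) := by
  funext q
  rw [Finset.sum_apply]
  rcases q with q | q
  · exact Finset.sum_eq_zero fun p _ => by simp
  · rw [Finset.sum_eq_single (σ.symm q)]
    · simp
    · intro p _ hp
      have : q ≠ σ p := fun h => hp (by rw [h, Equiv.symm_apply_apply])
      simp [this]
    · intro h; exact absurd (Finset.mem_univ _) h

theorem sum_smul_toricCode_inl (c : ZMod d × ZMod d → ZMod 2) :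
    ∑ p, c p • toricCode d (Sum.inl p) =
      Sum.elim (fun p => (c p + c (p.1 + 1, p.2), 0)) (fun p => (c p + c (p.1, p.2 + 1), 0)) := by
  have h : ∀ p : ZMod d × ZMod d, c p • toricCode d (Sum.inl p) =
      c p • (Pi.single (Sum.inl (Equiv.refl _ p)) (1, 0) : Pauli (ToricQubit d)) +
      c p • (Pi.single (Sum.inl (((Equiv.subRight 1).prodCongr (Equiv.refl _)) p)) (1, 0) : Pauli (ToricQubit d)) +
      c p • (Pi.single (Sum.inr (Equiv.refl _ p)) (1, 0) : Pauli (ToricQubit d)) +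
      c p • (Pi.single (Sum.inr (((Equiv.refl _).prodCongr (Equiv.subRight 1)) p)) (1, 0) : Pauli (ToricQubit d)) :=
    fun p => by rw [← smul_add, ← smul_add, ← smul_add]; rfl
  rw [Finset.sum_congr rfl fun p _ => h p, Finset.sum_add_distrib, Finset.sum_add_distrib,
    Finset.sum_add_distrib, sum_smul_single_inl, sum_smul_single_inl, sum_smul_single_inr,
    sum_smul_single_inr]
  funext q
  rcases q with q | q <;> simp [Prod.map]

theorem sum_smul_toricCode_inr (c : ZMod d × ZMod d → ZMod 2) :
    ∑ p, c p • toricCode d (Sum.inr p) =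
      Sum.elim (fun p => (0, c p + c (p.1, p.2 - 1))) (fun p => (0, c p + c (p.1 - 1, p.2))) := by
  have h : ∀ p : ZMod d × ZMod d, c p • toricCode d (Sum.inr p) =
      c p • (Pi.single (Sum.inl (Equiv.refl _ p)) (0, 1) : Pauli (ToricQubit d)) +
      c p • (Pi.single (Sum.inl (((Equiv.refl _).prodCongr (Equiv.addRight 1)) p)) (0, 1) : Pauli (ToricQubit d)) +
      c p • (Pi.single (Sum.inr (Equiv.refl _ p)) (0, 1) : Pauli (ToricQubit d)) +
      c p • (Pi.single (Sum.inr (((Equiv.addRight 1).prodCongr (Equiv.refl _)) p)) (0, 1) : Pauli (ToricQubit d)) :=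
    fun p => by rw [← smul_add, ← smul_add, ← smul_add]; rfl
  rw [Finset.sum_congr rfl fun p _ => h p, Finset.sum_add_distrib, Finset.sum_add_distrib,
    Finset.sum_add_distrib, sum_smul_single_inl, sum_smul_single_inl, sum_smul_single_inr,
    sum_smul_single_inr]
  funext q
  rcases q with q | q <;> simp [Prod.map, sub_eq_add_neg]

/-- The boundary of a boundary vanishes: in each commutation relation every coefficient occurs
twice. -/
theorem isStabilizerCode_toricCode : IsStabilizerCode (toricCode d) := by
  have hx : ∀ c : ZMod d × ZMod d → ZMod 2,
      IsLogical (toricCode d) (∑ p, c p • toricCode d (Sum.inl p)) := by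
    intro c
    rw [sum_smul_toricCode_inl, isLogical_toricCode]
    refine ⟨fun i j => by simp, fun i j => ?_⟩
    simp only [Sum.elim_inl, Sum.elim_inr]
    have e : c (i, j) + c (i + 1, j) + (c (i, j + 1) + c (i + 1, j + 1)) + (c (i, j) + c (i, j + 1)) +
      (c (i + 1, j) + c (i + 1, j + 1)) = 2 * (c (i, j) + c (i + 1, j) + c (i, j + 1) +
        c (i + 1, j + 1)) := by ring
    exact e.trans (mul_eq_zero_of_left (by decide) _)
  have hz : ∀ c : ZMod d × ZMod d → ZMod 2,
      IsLogical (toricCode d) (∑ p, c p • toricCode d (Sum.inr p)) := by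
    intro c
    rw [sum_smul_toricCode_inr, isLogical_toricCode]
    refine ⟨fun i j => ?_, fun i j => by simp⟩
    simp only [Sum.elim_inl, Sum.elim_inr]
    have e : c (i, j) + c (i, j - 1) + (c (i - 1, j) + c (i - 1, j - 1)) + (c (i, j) + c (i - 1, j)) +
      (c (i, j - 1) + c (i - 1, j - 1)) = 2 * (c (i, j) + c (i, j - 1) + c (i - 1, j) +
        c (i - 1, j - 1)) := by ring
    exact e.trans (mul_eq_zero_of_left (by decide) _)
  intro s t
  rcases t with t | t
  · have := hx (Pi.single t 1) s
    simpa [Pi.single_apply] using this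
  · have := hz (Pi.single t 1) s
    simpa [Pi.single_apply] using this

theorem eq_const_of_shift {c : ZMod d × ZMod d → ZMod 2} {s : ZMod d} (hs : s = 1 ∨ s = -1)
    (h1 : ∀ p, c p + c (p.1 + s, p.2) = 0) (h2 : ∀ p, c p + c (p.1, p.2 + s) = 0)
    (p : ZMod d × ZMod d) : c p = c 0 := by
  obtain ⟨i, j⟩ := p
  have e1 := eq_apply_zero_of_shift_or hs (f := fun i => c (i, j))
    (fun i => (CharTwo.add_eq_zero.1 (h1 (i, j))).symm) i
  have e2 := eq_apply_zero_of_shift_or hs (f := fun j => c (0, j))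
    (fun j => (CharTwo.add_eq_zero.1 (h2 (0, j))).symm) j
  exact e1.trans e2

/-- The only relations among the `2 d²` checks are that all vertex checks, and all face checks,
multiply to the identity. So the rank is `2 d² - 2` on `2 d²` qubits. -/
theorem numLogical_toricCode : numLogical (toricCode d) = 2 := by
  let f : (ToricQubit d → ZMod 2) →ₗ[ZMod 2] Pauli (ToricQubit d) := Fintype.linearCombination (ZMod 2) (toricCode d)
  have hf : ∀ c, f c = Sum.elim (fun p => (c (Sum.inl p) + c (Sum.inl (p.1 + 1, p.2)),
      c (Sum.inr p) + c (Sum.inr (p.1, p.2 - 1))))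
      (fun p => (c (Sum.inl p) + c (Sum.inl (p.1, p.2 + 1)),
        c (Sum.inr p) + c (Sum.inr (p.1 - 1, p.2)))) := by
    intro c
    have : f c = ∑ s, c s • toricCode d s := Fintype.linearCombination_apply ..
    rw [this, Fintype.sum_sum_type, sum_smul_toricCode_inl (fun p => c (Sum.inl p)),
      sum_smul_toricCode_inr (fun p => c (Sum.inr p))]
    funext q
    rcases q with q | q <;> simp
  have hrange : LinearMap.range f = stab (toricCode d) := Fintype.range_linearCombination _ _
  let g : (ZMod 2 × ZMod 2) →ₗ[ZMod 2] (ToricQubit d → ZMod 2) :=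
    { toFun := fun a => Sum.elim (fun _ => a.1) (fun _ => a.2)
      map_add' := fun a b => by funext q; rcases q with q | q <;> rfl
      map_smul' := fun a b => by funext q; rcases q with q | q <;> rfl }
  have hg : Function.Injective g := by
    intro a b h
    exact Prod.ext (congrFun h (Sum.inl 0)) (congrFun h (Sum.inr 0))
  have hker : LinearMap.ker f = LinearMap.range g := by
    ext c
    rw [LinearMap.mem_ker, LinearMap.mem_range]
    constructor
    · intro h
      rw [hf] at h
      refine ⟨(c (Sum.inl 0), c (Sum.inr 0)), ?_⟩
      have hl : ∀ p, c (Sum.inl p) = c (Sum.inl 0) :=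
        eq_const_of_shift (c := fun p => c (Sum.inl p)) (Or.inl rfl)
          (fun p => congrArg Prod.fst (congrFun h (Sum.inl p)))
          (fun p => congrArg Prod.fst (congrFun h (Sum.inr p)))
      have hr : ∀ p, c (Sum.inr p) = c (Sum.inr 0) :=
        eq_const_of_shift (c := fun p => c (Sum.inr p)) (Or.inr rfl)
          (fun p => by
            rw [← sub_eq_add_neg]; exact congrArg Prod.snd (congrFun h (Sum.inr p)))
          (fun p => by
            rw [← sub_eq_add_neg]; exact congrArg Prod.snd (congrFun h (Sum.inl p)))
      funext q
      rcases q with q | q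
      · exact (hl q).symm
      · exact (hr q).symm
    · rintro ⟨a, rfl⟩
      rw [hf]
      funext q
      rcases q with q | q <;>
        exact Prod.ext (CharTwo.add_self_eq_zero _) (CharTwo.add_self_eq_zero _)
  have h1 := f.finrank_range_add_finrank_ker
  rw [hrange, hker, LinearMap.finrank_range_of_inj hg, Module.finrank_prod, Module.finrank_self,
    Module.finrank_fintype_fun_eq_card] at h1
  have h2 : Fintype.card (ToricQubit d) = Fintype.card ((ZMod d × ZMod d) ⊕ (ZMod d × ZMod d)) := rfl
  have h3 : (Module.finrank (ZMod 2) (stab (toricCode d)) : ℤ) + (1 + 1) =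
      Fintype.card ((ZMod d × ZMod d) ⊕ (ZMod d × ZMod d)) := by
    exact_mod_cast h1
  rw [numLogical]
  linarith

/-- The operator `X` on the horizontal edges between two adjacent columns. -/
def colX (i : ZMod d) : Pauli (ToricQubit d) := Sum.elim (fun p => if p.1 = i then (1, 0) else 0) 0

/-- The operator `Z` on the horizontal edges of a row. -/
def rowZ (j : ZMod d) : Pauli (ToricQubit d) := Sum.elim (fun p => if p.2 = j then (0, 1) else 0) 0

/-- The operator `X` on the vertical edges between two adjacent rows. -/
def rowX (j : ZMod d) : Pauli (ToricQubit d) := Sum.elim 0 (fun p => if p.2 = j then (1, 0) else 0)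

/-- The operator `Z` on the vertical edges of a column. -/
def colZ (i : ZMod d) : Pauli (ToricQubit d) := Sum.elim 0 (fun p => if p.1 = i then (0, 1) else 0)

theorem symp_colX (i : ZMod d) (P : Pauli (ToricQubit d)) :
    symp (ToricQubit d) (colX i) P = ∑ j, (P (Sum.inl (i, j))).2 := by
  rw [symp_apply, Fintype.sum_sum_type, Fintype.sum_prod_type, Finset.sum_eq_single i]
  · simp [colX, localSymp]
  · intro a _ ha
    simp [colX, localSymp, ha]
  · intro h; exact absurd (Finset.mem_univ _) h

theorem symp_colZ (i : ZMod d) (P : Pauli (ToricQubit d)) :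
    symp (ToricQubit d) (colZ i) P = ∑ j, (P (Sum.inr (i, j))).1 := by
  rw [symp_apply, Fintype.sum_sum_type, Fintype.sum_prod_type, Fintype.sum_prod_type, add_comm,
    Finset.sum_eq_single i]
  · simp [colZ, localSymp]
  · intro a _ ha
    simp [colZ, localSymp, ha]
  · intro h; exact absurd (Finset.mem_univ _) h

theorem symp_rowZ (j : ZMod d) (P : Pauli (ToricQubit d)) :
    symp (ToricQubit d) (rowZ j) P = ∑ i, (P (Sum.inl (i, j))).1 := by
  rw [symp_apply, Fintype.sum_sum_type, Fintype.sum_prod_type_right, Finset.sum_eq_single j]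
  · simp [rowZ, localSymp]
  · intro a _ ha
    simp [rowZ, localSymp, ha]
  · intro h; exact absurd (Finset.mem_univ _) h

theorem symp_rowX (j : ZMod d) (P : Pauli (ToricQubit d)) :
    symp (ToricQubit d) (rowX j) P = ∑ i, (P (Sum.inr (i, j))).2 := by
  rw [symp_apply, Fintype.sum_sum_type, Fintype.sum_prod_type, Fintype.sum_prod_type_right, add_comm,
    Finset.sum_eq_single j]
  · simp [rowX, localSymp]
  · intro a _ ha
    simp [rowX, localSymp, ha]
  · intro h; exact absurd (Finset.mem_univ _) h

theorem isLogical_colX (i : ZMod d) : IsLogical (toricCode d) (colX i) :=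
  isLogical_toricCode.2 ⟨fun a b => by simp only [colX, Sum.elim_inl, Sum.elim_inr]; split_ifs <;> simp,
    fun a b => by simp [colX, CharTwo.add_self_eq_zero]⟩

theorem isLogical_colZ (i : ZMod d) : IsLogical (toricCode d) (colZ i) :=
  isLogical_toricCode.2 ⟨fun a b => by simp [colZ, CharTwo.add_self_eq_zero],
    fun a b => by simp only [colZ, Sum.elim_inl, Sum.elim_inr]; split_ifs <;> simp⟩

theorem isLogical_rowZ (j : ZMod d) : IsLogical (toricCode d) (rowZ j) :=
  isLogical_toricCode.2 ⟨fun a b => by simp [rowZ, CharTwo.add_self_eq_zero],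
    fun a b => by simp only [rowZ, Sum.elim_inl, Sum.elim_inr]; split_ifs <;> simp⟩

theorem isLogical_rowX (j : ZMod d) : IsLogical (toricCode d) (rowX j) :=
  isLogical_toricCode.2 ⟨fun a b => by simp only [rowX, Sum.elim_inl, Sum.elim_inr]; split_ifs <;> simp,
    fun a b => by simp [rowX, CharTwo.add_self_eq_zero]⟩


/-- Commutation with a string does not change under parallel translation, because the check
conditions on `P` relate neighbouring line sums as in `sum_eq_of_shift`. -/
theorem symp_colX_eq {P : Pauli (ToricQubit d)} (hP : IsLogical (toricCode d) P)
    (i : ZMod d) : symp (ToricQubit d) (colX i) P = symp (ToricQubit d) (colX 0) P := by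
  rw [symp_colX, symp_colX]
  refine sum_eq_of_shift (Or.inr rfl) (g := fun i j => (P (Sum.inl (i, j))).2)
    (h := fun i j => (P (Sum.inr (i, j))).2) (fun i j => ?_) i
  rw [← sub_eq_add_neg, ← sub_eq_add_neg]
  exact (isLogical_toricCode.1 hP).1 i j

theorem symp_rowX_eq {P : Pauli (ToricQubit d)} (hP : IsLogical (toricCode d) P)
    (j : ZMod d) : symp (ToricQubit d) (rowX j) P = symp (ToricQubit d) (rowX 0) P := by
  rw [symp_rowX, symp_rowX]
  refine sum_eq_of_shift (Or.inr rfl) (g := fun j i => (P (Sum.inr (i, j))).2)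
    (h := fun j i => (P (Sum.inl (i, j))).2) (fun j i => ?_) j
  rw [← sub_eq_add_neg, ← sub_eq_add_neg, ← (isLogical_toricCode.1 hP).1 i j]
  ring

theorem symp_rowZ_eq {P : Pauli (ToricQubit d)} (hP : IsLogical (toricCode d) P)
    (j : ZMod d) : symp (ToricQubit d) (rowZ j) P = symp (ToricQubit d) (rowZ 0) P := by
  rw [symp_rowZ, symp_rowZ]
  refine sum_eq_of_shift (Or.inl rfl) (g := fun j i => (P (Sum.inl (i, j))).1)
    (h := fun j i => (P (Sum.inr (i, j))).1) (fun j i => ?_) j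
  exact (isLogical_toricCode.1 hP).2 i j

theorem symp_colZ_eq {P : Pauli (ToricQubit d)} (hP : IsLogical (toricCode d) P)
    (i : ZMod d) : symp (ToricQubit d) (colZ i) P = symp (ToricQubit d) (colZ 0) P := by
  rw [symp_colZ, symp_colZ]
  refine sum_eq_of_shift (Or.inl rfl) (g := fun i j => (P (Sum.inr (i, j))).1)
    (h := fun i j => (P (Sum.inl (i, j))).1) (fun i j => ?_) i
  rw [← (isLogical_toricCode.1 hP).2 i j]
  ring

/-- An operator that anticommutes with one string anticommutes with all its translates, and must
meet each of them. -/
theorem exists_of_symp_colX_ne {P : Pauli (ToricQubit d)} (hP : IsLogical (toricCode d) P)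
    (h : symp (ToricQubit d) (colX 0) P ≠ 0) (i : ZMod d) :
    ∃ j, P (Sum.inl (i, j)) ≠ 0 := by
  rw [← symp_colX_eq hP i, symp_colX] at h
  obtain ⟨j, -, hj⟩ := Finset.exists_ne_zero_of_sum_ne_zero h
  exact ⟨j, fun h' => hj (by rw [h']; rfl)⟩

theorem exists_of_symp_rowX_ne {P : Pauli (ToricQubit d)} (hP : IsLogical (toricCode d) P)
    (h : symp (ToricQubit d) (rowX 0) P ≠ 0) (j : ZMod d) :
    ∃ i, P (Sum.inr (i, j)) ≠ 0 := by
  rw [← symp_rowX_eq hP j, symp_rowX] at h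
  obtain ⟨i, -, hi⟩ := Finset.exists_ne_zero_of_sum_ne_zero h
  exact ⟨i, fun h' => hi (by rw [h']; rfl)⟩

theorem exists_of_symp_rowZ_ne {P : Pauli (ToricQubit d)} (hP : IsLogical (toricCode d) P)
    (h : symp (ToricQubit d) (rowZ 0) P ≠ 0) (j : ZMod d) :
    ∃ i, P (Sum.inl (i, j)) ≠ 0 := by
  rw [← symp_rowZ_eq hP j, symp_rowZ] at h
  obtain ⟨i, -, hi⟩ := Finset.exists_ne_zero_of_sum_ne_zero h
  exact ⟨i, fun h' => hi (by rw [h']; rfl)⟩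

theorem exists_of_symp_colZ_ne {P : Pauli (ToricQubit d)} (hP : IsLogical (toricCode d) P)
    (h : symp (ToricQubit d) (colZ 0) P ≠ 0) (i : ZMod d) :
    ∃ j, P (Sum.inr (i, j)) ≠ 0 := by
  rw [← symp_colZ_eq hP i, symp_colZ] at h
  obtain ⟨j, -, hj⟩ := Finset.exists_ne_zero_of_sum_ne_zero h
  exact ⟨j, fun h' => hj (by rw [h']; rfl)⟩

end Toric


/-! ### Distance and irreducibility of the toric code -/

section Toric

variable {d : ℕ} [NeZero d]

theorem nonOverlapping_horizontal_vertical {V W : Type*} (P : Pauli V) (R : Pauli W) :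
    NonOverlapping (Sum.elim P 0 : Pauli (V ⊕ W)) (Sum.elim 0 R : Pauli (V ⊕ W)) := by
  rintro (q | q)
  · exact Or.inr rfl
  · exact Or.inl rfl

theorem symp_colX_rowZ : symp (ToricQubit d) (colX 0) (rowZ 0) = 1 := by
  simp [symp_colX, rowZ, apply_ite Prod.snd]

theorem symp_colZ_rowX : symp (ToricQubit d) (colZ 0) (rowX 0) = 1 := by
  simp [symp_colZ, rowX, apply_ite Prod.fst]

theorem symp_colX_rowX : symp (ToricQubit d) (colX 0) (rowX 0) = 0 :=
  symp_eq_zero_of_nonOverlapping (nonOverlapping_horizontal_vertical _ _)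

theorem symp_colZ_rowZ : symp (ToricQubit d) (colZ 0) (rowZ 0) = 0 := by
  rw [symp_comm]
  exact symp_eq_zero_of_nonOverlapping (nonOverlapping_horizontal_vertical _ _)

theorem symp_rowZ_rowX : symp (ToricQubit d) (rowZ 0) (rowX 0) = 0 :=
  symp_eq_zero_of_nonOverlapping (nonOverlapping_horizontal_vertical _ _)

theorem symp_colX_colZ : symp (ToricQubit d) (colX 0) (colZ 0) = 0 :=
  symp_eq_zero_of_nonOverlapping (nonOverlapping_horizontal_vertical _ _)

theorem wt_rowZ : wt (rowZ (0 : ZMod d)) = d := by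
  refine le_antisymm ?_ ?_
  · refine (Finset.card_le_card (t := Finset.univ.image fun i : ZMod d => Sum.inl (i, 0)) ?_).trans
      (Finset.card_image_le.trans (by rw [Finset.card_univ, ZMod.card]))
    rintro (⟨i, j⟩ | q) hq
    · have h := (Finset.mem_filter.1 hq).2
      have hj : j = 0 := by
        by_contra hj
        exact h (if_neg hj)
      rw [hj]
      exact Finset.mem_image_of_mem _ (Finset.mem_univ _)
    · exact absurd rfl (Finset.mem_filter.1 hq).2
  · refine (ZMod.card d).ge.trans (card_le_wt_of_injective (fun i : ZMod d => Sum.inl (i, 0)) ?_ ?_)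
    · intro i i' h
      simpa using h
    · intro i
      simp [rowZ]

theorem wt_rowX : wt (rowX (0 : ZMod d)) = d := by
  refine le_antisymm ?_ ?_
  · refine (Finset.card_le_card (t := Finset.univ.image fun i : ZMod d => Sum.inr (i, 0)) ?_).trans
      (Finset.card_image_le.trans (by rw [Finset.card_univ, ZMod.card]))
    rintro (q | ⟨i, j⟩) hq
    · exact absurd rfl (Finset.mem_filter.1 hq).2
    · have h := (Finset.mem_filter.1 hq).2
      have hj : j = 0 := by
        by_contra hj
        exact h (if_neg hj)
      rw [hj]
      exact Finset.mem_image_of_mem _ (Finset.mem_univ _)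
  · refine (ZMod.card d).ge.trans (card_le_wt_of_injective (fun i : ZMod d => Sum.inr (i, 0)) ?_ ?_)
    · intro i i' h
      simpa using h
    · intro i
      simp [rowX]

/-- Commuting with `rowZ` and `rowX` puts `P` in the group they generate together with the
stabilizers; `colX` and `colZ` then read off the two coefficients. -/
theorem mem_stab_toricCode {P : Pauli (ToricQubit d)} (hP : IsLogical (toricCode d) P)
    (h1 : symp (ToricQubit d) (colX 0) P = 0) (h2 : symp (ToricQubit d) (colZ 0) P = 0)
    (h3 : symp (ToricQubit d) (rowZ 0) P = 0) (h4 : symp (ToricQubit d) (rowX 0) P = 0) :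
    P ∈ stab (toricCode d) := by
  have h := mem_sup_of_commute isStabilizerCode_toricCode numLogical_toricCode (isLogical_rowZ 0)
    (isLogical_rowX 0) (isLogical_colX 0) (isLogical_colZ 0) symp_rowZ_rowX
    (by rw [symp_colX_rowZ]; exact one_ne_zero) symp_colX_rowX
    (by rw [symp_colZ_rowX]; exact one_ne_zero) symp_colZ_rowZ hP h3 h4
  rw [Submodule.mem_sup] at h
  obtain ⟨y, hy, z, hz, rfl⟩ := h
  obtain ⟨i, j, rfl⟩ := Submodule.mem_span_pair.1 hz
  have hyX : symp (ToricQubit d) (colX 0) y = 0 := by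
    rw [symp_comm]; exact symp_eq_zero_of_mem_stab (isLogical_colX 0) hy
  have hyZ : symp (ToricQubit d) (colZ 0) y = 0 := by
    rw [symp_comm]; exact symp_eq_zero_of_mem_stab (isLogical_colZ 0) hy
  simp only [map_add, map_smul, hyX, symp_colX_rowZ, symp_colX_rowX] at h1
  simp only [map_add, map_smul, hyZ, symp_colZ_rowZ, symp_colZ_rowX] at h2
  have hi : i = 0 := by simpa using h1
  have hj : j = 0 := by simpa using h2
  rw [hi, hj, zero_smul, zero_smul, add_zero, add_zero]
  exact hy

/-- A nontrivial logical operator anticommutes with one of the four basic strings and therefore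
meets all `d` of its pairwise disjoint translates. -/
theorem isDistance_toricCode : IsDistance (toricCode d) d := by
  constructor
  · refine ⟨rowZ 0, ⟨isLogical_rowZ 0, fun h => ?_⟩, wt_rowZ⟩
    have h1 := symp_eq_zero_of_mem_stab (isLogical_colX 0) h
    rw [symp_comm, symp_colX_rowZ] at h1
    exact one_ne_zero h1
  · rintro _ ⟨P, ⟨hP, hP'⟩, rfl⟩
    have hd : Fintype.card (ZMod d) = d := ZMod.card d
    by_cases h1 : symp (ToricQubit d) (colX 0) P = 0
    · by_cases h2 : symp (ToricQubit d) (colZ 0) P = 0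
      · by_cases h3 : symp (ToricQubit d) (rowZ 0) P = 0
        · by_cases h4 : symp (ToricQubit d) (rowX 0) P = 0
          · exact absurd (mem_stab_toricCode hP h1 h2 h3 h4) hP'
          · choose f hf using exists_of_symp_rowX_ne hP h4
            exact hd.ge.trans (card_le_wt_of_injective (fun j => Sum.inr (f j, j))
              (fun _ _ h => congrArg Prod.snd (Sum.inr_injective h)) hf)
        · choose f hf using exists_of_symp_rowZ_ne hP h3
          exact hd.ge.trans (card_le_wt_of_injective (fun j => Sum.inl (f j, j))
            (fun _ _ h => congrArg Prod.snd (Sum.inl_injective h)) hf)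
      · choose f hf using exists_of_symp_colZ_ne hP h2
        exact hd.ge.trans (card_le_wt_of_injective (fun j => Sum.inr (j, f j))
          (fun _ _ h => congrArg Prod.fst (Sum.inr_injective h)) hf)
    · choose f hf using exists_of_symp_colX_ne hP h1
      exact hd.ge.trans (card_le_wt_of_injective (fun j => Sum.inl (j, f j))
        (fun _ _ h => congrArg Prod.fst (Sum.inl_injective h)) hf)

/-- The translates of `colX` lie on horizontal edges and those of `colZ` on vertical ones, so the
two sets of `d` qubits are disjoint. -/
theorem two_mul_le_wt {P : Pauli (ToricQubit d)} (hP : IsLogical (toricCode d) P)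
    (h1 : symp (ToricQubit d) (colX 0) P ≠ 0) (h2 : symp (ToricQubit d) (colZ 0) P ≠ 0) :
    2 * d ≤ wt P := by
  choose f hf using exists_of_symp_colX_ne hP h1
  choose g hg using exists_of_symp_colZ_ne hP h2
  have h := card_le_wt_of_injective (P := P)
    (Sum.map (fun i => (i, f i)) (fun i => (i, g i)) : ZMod d ⊕ ZMod d → _)
    (Sum.map_injective.2 ⟨fun _ _ h => congrArg Prod.fst h, fun _ _ h => congrArg Prod.fst h⟩)
    (by rintro (i | i); exacts [hf i, hg i])
  rw [Fintype.card_sum, ZMod.card] at h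
  omega

theorem productIrreducible_toricCode :
    ProductIrreducible (toricCode d) (rowZ 0) (rowX 0) (2 * d) := by
  refine ⟨colX 0, colZ 0, isLogical_colX 0, isLogical_colZ 0, fun h => ?_, symp_colX_rowX,
    fun h => ?_, symp_colZ_rowZ, symp_colX_colZ, fun L hL => ?_⟩
  · exact one_ne_zero (symp_colX_rowZ.symm.trans h)
  · exact one_ne_zero (symp_colZ_rowX.symm.trans h)
  · rw [Submodule.mem_sup] at hL
    obtain ⟨y, hy, z, hz, rfl⟩ := hL
    obtain ⟨i, j, rfl⟩ := Submodule.mem_span_pair.1 hz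
    have hyX : symp (ToricQubit d) (colX 0) y = 0 := by
      rw [symp_comm]; exact symp_eq_zero_of_mem_stab (isLogical_colX 0) hy
    have hyZ : symp (ToricQubit d) (colZ 0) y = 0 := by
      rw [symp_comm]; exact symp_eq_zero_of_mem_stab (isLogical_colZ 0) hy
    have hlog := mem_logicals.1 (Submodule.add_mem _
      (Submodule.add_mem _ (stab_le_logicals isStabilizerCode_toricCode hy)
        (Submodule.add_mem _ (Submodule.smul_mem _ i (mem_logicals.2 (isLogical_colX (0 : ZMod d))))
          (Submodule.smul_mem _ j (mem_logicals.2 (isLogical_colZ (0 : ZMod d))))))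
      (Submodule.add_mem _ (mem_logicals.2 (isLogical_rowZ (0 : ZMod d)))
        (mem_logicals.2 (isLogical_rowX (0 : ZMod d)))))
    -- Stabilizers, `colX` and `colZ` commute with both column strings, so the admissible factors
    -- cannot remove the anticommutation due to `rowZ` and `rowX`.
    refine two_mul_le_wt hlog ?_ ?_
    · simp [hyX, symp_self, symp_colX_colZ, symp_colX_rowZ, symp_colX_rowX]
    · simp [hyZ, symp_self, symp_comm (colZ 0) (colX 0), symp_colX_colZ, symp_colZ_rowZ,
        symp_colZ_rowX]

theorem isLeftCode_toricCode (d : ℕ) [NeZero d] :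
    IsLeftCode (toricCode d) d (rowZ 0) (rowX 0) where
  stabilizer := isStabilizerCode_toricCode
  distance := isDistance_toricCode
  two_qubits := numLogical_toricCode
  logical_Z := isLogical_rowZ 0
  logical_X := isLogical_rowX 0
  weight_Z := wt_rowZ
  weight_X := wt_rowX
  nonOverlapping := nonOverlapping_horizontal_vertical _ _
  irreducible := productIrreducible_toricCode

end Toric

end Surgery

theorem theorem6 :
    (∀ α β : ℕ, ∃ (α' β' : ℕ) (c : ℝ),
      ∀ (Ql Sl Qr Sr : Type*) [Fintype Ql] [Fintype Sl] [Fintype Qr] [Fintype Sr]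
        (Hl : Sl → Surgery.Pauli Ql) (Hr : Sr → Surgery.Pauli Qr) (dl dr : ℕ)
        (Zl Xl : Surgery.Pauli Ql) (Zr Xr : Surgery.Pauli Qr),
        Surgery.IsLDPC Hr α β → Surgery.IsStabilizerCode Hr → Surgery.IsDistance Hr dr →
        Surgery.IsLogical Hr Zr → Surgery.IsLogical Hr Xr → Surgery.NonOverlapping Zr Xr →
        Surgery.IsLDPC Hl α β → Surgery.IsLeftCode Hl dl Zl Xl →
        max (Surgery.wt Zr) (Surgery.wt Xr) ≤ dl →
        ∃ (A : Surgery.AuxGraph (Surgery.joinCode Hl Hr) (Surgery.joinOp Zl Zr))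
          (B : Surgery.AuxGraph (Surgery.joinCode Hl Hr) (Surgery.joinOp Xl Xr)),
          A.PortInjective ∧ B.PortInjective ∧
          (A.size : ℝ) ≤ c * (dl * Real.log dl ^ 3 + 1) ∧
          (B.size : ℝ) ≤ c * (dl * Real.log dl ^ 3 + 1) ∧
          Surgery.IsStabilizerCode (Surgery.deformedCode A B) ∧
          Surgery.MeasuresExactly A B ∧
          Surgery.IsLDPC (Surgery.deformedCode A B) α' β' ∧
          ∃ d, Surgery.IsDistance (Surgery.deformedCode A B) d ∧ dr ≤ d) ∧
    (∀ (d : ℕ) [NeZero d], Surgery.IsLDPC (Surgery.toricCode d) 4 4 ∧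
      ∃ Zl Xl, Surgery.IsLeftCode (Surgery.toricCode d) d Zl Xl) :=
  ⟨Surgery.exists_auxGraphs_of_isLeftCode, fun d _ =>
    ⟨Surgery.isLDPC_toricCode d, _, _, Surgery.isLeftCode_toricCode d⟩⟩
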